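/- Let $M^3$ be a smooth three-manifold, $J\subset\mathbb R$ and $U\subset M^3$ open sets, and let $\gamma=-N^2dt^2+g(t,x)$ be a smooth Lorentzian metric on $J\times U$ with lapse $N>0$ and $g(t,\cdot)$ Riemannian on the slices. Put $T=N^{-1}\partial_t$, $D_Tf=N^{-1}\partial_tf$ for functions $f$, $h_{ij}=-\frac1{2N}\partial_tg_{ij}$, $H=g^{ij}h_{ij}$, $\bar\gamma=N^2dt^2+g$, and let $R_{\alpha\beta\gamma\delta}$, $W_{\alpha\beta\gamma\delta}$ be the Riemann and Weyl tensors of $\gamma$, $R_{\alpha\beta}$ its Ricci tensor and $R$ its scalar curvature. Let $m,k,\alpha$ be real functions on $J\times U$, with $k$ differentiable and $\alpha$ twice continuously differentiable in $t$, such that: 1. ($k$-perfect fluid electric region) $R_{\alpha\beta}-\frac12R\,\gamma_{\alpha\beta}=\mathcal T_{\alpha\beta}$ with $\mathcal T_{TT}=m$, $\mathcal T_{Ti}=0$, $\mathcal T_{ij}=(k-1)\,m\,g_{ij}$, $k\in[0,\frac43]$, and $W_{Tijl}=0$; 2. ($\alpha$-expanding) $\alpha\in[0,\frac13]$ and $h\le\alpha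 Hg\le0$ as quadratic forms; 3. (evolution inequalities) $D_Tk=k'H$ and $D_T\alpha=\alpha'H$, where $k'=\alpha'=0$ where $H=0$ (so $D_Tk=D_T\alpha=0$ there), $\alpha'\ge0$, and $$0\le k',\qquad 3(4-3k)\,k'\le k(9k^2-12k+8)\min\Big\{\frac{9\alpha'}{4(1-3\alpha)},1\Big\},$$ the quotient being read as $+\infty$ where $\alpha=\frac13$. Let $$s_{\rm crit}=\sqrt{1-3\alpha}\Big(\frac{\sqrt2}4+2k\sqrt{\frac{1-3\alpha}{9k^2-12k+8}}\Big),\qquad S^{\rm pf}=(s+s_{\rm crit})\sqrt g,$$ where $s=|W_{\alpha\beta\gamma\delta}|_{\bar\gamma}/|R_{\alpha\beta\gamma\delta}|_{\bar\gamma}$ where the Riemann tensor is nonzero and $s=1$ where it vanishes, and $\sqrt g$ is the square root of the determinant of $(g_{ij})$ in an arbitrary smooth chart of $M^3$ (the statement holds in each of them). Then, for every $x\in U$ in the domain of the chart, $S^{\rm pf}(\cdot,x)$ is nondecreasing on every interval contained in $J$. At every point $(t,x)$ of the region with $x$ in the domain of the chart, $S^{\rm pf}$ has one-sided derivatives in $t$,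 both nonnegative; it is differentiable in $t$ except possibly where $W=0$ and the Riemann tensor is nonzero, and $$D_TS^{\rm pf}\ge0$$ wherever the derivative exists. The function $s_{\rm crit}$ is differentiable in $t$. Moreover, $D_TS^{\rm pf}$ exists and equals $0$ at a point if and only if there $D_Ts_{\rm crit}=0$ and either $h=0$, or $W=0$, the Riemann tensor is nonzero and $\alpha=\frac13$ (hence $s_{\rm crit}=0$). -/

import Mathlib

open scoped Manifold ContDiff Matrix

noncomputable section

namespace WeylEntropy

/-- The model space of the spatial slices. -/
abbrev E3 : Type := EuclideanSpace ℝ (Fin 3)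

/-! ### Curvature in coordinates `(t, x¹, x², x³)`

The index `0` is the time coordinate, the index `i + 1` the spatial coordinate `xⁱ`. -/

/-- The coordinate directions `∂_t, ∂_1, ∂_2, ∂_3`. -/
def coordDir : Fin 4 → ℝ × E3 :=
  Fin.cons ((1 : ℝ), (0 : E3)) (fun i : Fin 3 => ((0 : ℝ), EuclideanSpace.single i (1 : ℝ)))

/-- The partial derivative `∂_μ f` at `p`. -/
def pd (μ : Fin 4) (f : ℝ × E3 → ℝ) (p : ℝ × E3) : ℝ :=
  fderiv ℝ f p (coordDir μ)

/-- The `4 × 4` matrix with time-time entry `a`, vanishing mixed entries and spatial block `b`. -/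
def block (a : ℝ) (b : Matrix (Fin 3) (Fin 3) ℝ) : Matrix (Fin 4) (Fin 4) ℝ :=
  Matrix.of (Fin.cons (Fin.cons a (fun _ : Fin 3 => (0 : ℝ)))
    (fun i : Fin 3 => Fin.cons (0 : ℝ) (fun j : Fin 3 => b i j)))

section Curvature

variable (G : ℝ × E3 → Matrix (Fin 4) (Fin 4) ℝ)

/-- Christoffel symbols `Γ^c_{ab}` of the Levi-Civita connection of `G`. -/
def christoffel (c a b : Fin 4) (p : ℝ × E3) : ℝ :=
  (1 / 2) * ∑ d, (G p)⁻¹ c d *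
    (pd a (fun q => G q b d) p + pd b (fun q => G q a d) p - pd d (fun q => G q a b) p)

/-- `R^a_{bcd} = ∂_c Γ^a_{db} - ∂_d Γ^a_{cb} + Γ^a_{ce} Γ^e_{db} - Γ^a_{de} Γ^e_{cb}`. -/
def riemannUp (a b c d : Fin 4) (p : ℝ × E3) : ℝ :=
  pd c (christoffel G a d b) p - pd d (christoffel G a c b) p
    + ∑ e, (christoffel G a c e p * christoffel G e d b p
      - christoffel G a d e p * christoffel G e c b p)

/-- The Riemann tensor `R_{abcd}`; it equals `G_{ac} G_{bd} - G_{ad} G_{bc}` in curvature one. -/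
def riemann (p : ℝ × E3) (a b c d : Fin 4) : ℝ :=
  ∑ e, G p a e * riemannUp G e b c d p

/-- The Ricci tensor `R_{bd} = G^{ac} R_{abcd}`. -/
def ricci (p : ℝ × E3) (b d : Fin 4) : ℝ :=
  ∑ a, riemannUp G a b a d p

/-- The scalar curvature. -/
def scalar (p : ℝ × E3) : ℝ :=
  ∑ a, ∑ b, (G p)⁻¹ a b * ricci G p a b

/-- The Weyl tensor `W_{abcd}` in dimension four. -/
def weyl (p : ℝ × E3) (a b c d : Fin 4) : ℝ :=
  riemann G p a b c d
    - (1 / 2) * (ricci G p a c * G p b d - ricci G p a d * G p b c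
        + ricci G p b d * G p a c - ricci G p b c * G p a d)
    + (scalar G p / 6) * (G p a c * G p b d - G p a d * G p b c)

/-- The left-hand side `R_{ab} - R G_{ab} / 2` of the Einstein equation. -/
def einstein (p : ℝ × E3) (a b : Fin 4) : ℝ :=
  ricci G p a b - (1 / 2) * scalar G p * G p a b

end Curvature

/-- The norm of a `(0,4)`-tensor with respect to the Riemannian scalar product `B`. -/
def tensorNorm (B : Matrix (Fin 4) (Fin 4) ℝ) (S : Fin 4 → Fin 4 → Fin 4 → Fin 4 → ℝ) : ℝ :=
  Real.sqrt (∑ a, ∑ b, ∑ c, ∑ d, ∑ a', ∑ b', ∑ c', ∑ d',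
    B⁻¹ a a' * B⁻¹ b b' * B⁻¹ c c' * B⁻¹ d d' * S a b c d * S a' b' c' d')

/-! ### The foliated metric `-N² dt² + g` in coordinates -/

section Foliation

variable (N : ℝ × E3 → ℝ) (g : ℝ × E3 → Matrix (Fin 3) (Fin 3) ℝ)

/-- The Lorentzian metric `γ = -N² dt² + g`. -/
def lorentz (p : ℝ × E3) : Matrix (Fin 4) (Fin 4) ℝ := block (-(N p) ^ 2) (g p)

/-- The associated Riemannian metric `γ̄ = N² dt² + g`. -/
def riemannian (p : ℝ × E3) : Matrix (Fin 4) (Fin 4) ℝ := block ((N p) ^ 2) (g p)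

/-- The perfect fluid stress-energy tensor with density `m` and pressure `P`, in the coordinate
frame: `T_{tt} = N² T_{TT} = N² m` because `T = N⁻¹ ∂_t`, while `T_{ti} = 0`, `T_{ij} = P g_{ij}`. -/
def fluidStress (m P : ℝ) (p : ℝ × E3) : Matrix (Fin 4) (Fin 4) ℝ :=
  block ((N p) ^ 2 * m) (P • g p)

/-- The second fundamental form `h_{ij} = -(2N)⁻¹ ∂_t g_{ij}`. -/
def secondForm (p : ℝ × E3) : Matrix (Fin 3) (Fin 3) ℝ :=
  Matrix.of fun i j => -(1 / (2 * N p)) * pd 0 (fun q => g q i j) p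

/-- The mean curvature `H = g^{ij} h_{ij}`. -/
def meanCurv (p : ℝ × E3) : ℝ :=
  ∑ i, ∑ j, (g p)⁻¹ i j * secondForm N g p i j

open Classical in
/-- The Weyl entropy density: `|W| / |R|` (norms taken with `γ̄`) where the Riemann tensor does
not vanish, and `1` where it vanishes. -/
def entropyDensity (p : ℝ × E3) : ℝ :=
  if riemann (lorentz N g) p = 0 then 1
  else tensorNorm (riemannian N g p) (weyl (lorentz N g) p) /
    tensorNorm (riemannian N g p) (riemann (lorentz N g) p)

end Foliation

/-- The critical density
`s_crit = √(1 - 3α) (√2 / 4 + 2 k √((1 - 3α) / (9k² - 12k + 8)))`. -/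
def sCrit (k α : ℝ) : ℝ :=
  Real.sqrt (1 - 3 * α) * (Real.sqrt 2 / 4
    + 2 * k * Real.sqrt ((1 - 3 * α) / (9 * k ^ 2 - 12 * k + 8)))

/-! ### The spacetime `-N² dt² + g` over a three-manifold -/

section Manifold

variable {M : Type*} [TopologicalSpace M] [ChartedSpace E3 M]

/-- `φ` is a smooth chart of `M`. -/
abbrev IsChart (φ : OpenPartialHomeomorph M E3) : Prop :=
  φ ∈ IsManifold.maximalAtlas (𝓡 3) ∞ M

/-- The derivative `D_T f = N⁻¹ ∂_t f` of a function in the direction of the unit normal. -/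
def DT (N : ℝ → M → ℝ) (f : ℝ → M → ℝ) (t : ℝ) (x : M) : ℝ :=
  (N t x)⁻¹ * deriv (fun s => f s x) t

/-- A function on `ℝ × M` read in the chart `φ`. -/
def inChart (φ : OpenPartialHomeomorph M E3) (f : ℝ → M → ℝ) : ℝ × E3 → ℝ :=
  fun p => f p.1 (φ.symm p.2)

/-- The components `g_{ij} = g(∂_i, ∂_j)` of a time-dependent bilinear form in the chart `φ`. -/
def metricInChart (φ : OpenPartialHomeomorph M E3)
    (g : ℝ → (x : M) → TangentSpace (𝓡 3) x →L[ℝ] TangentSpace (𝓡 3) x →L[ℝ] ℝ) :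
    ℝ × E3 → Matrix (Fin 3) (Fin 3) ℝ :=
  fun p => Matrix.of fun i j =>
    g p.1 (φ.symm p.2)
      (mfderiv (𝓡 3) (𝓡 3) φ.symm p.2 (EuclideanSpace.single i (1 : ℝ) : E3))
      (mfderiv (𝓡 3) (𝓡 3) φ.symm p.2 (EuclideanSpace.single j (1 : ℝ) : E3))

variable (N : ℝ → M → ℝ)
  (g : ℝ → (x : M) → TangentSpace (𝓡 3) x →L[ℝ] TangentSpace (𝓡 3) x →L[ℝ] ℝ)

/-- The Weyl tensor of `-N² dt² + g` at `(t, x)`, in the coordinates `(t, φ)`. -/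
def weylAt (φ : OpenPartialHomeomorph M E3) (t : ℝ) (x : M) :
    Fin 4 → Fin 4 → Fin 4 → Fin 4 → ℝ :=
  weyl (lorentz (inChart φ N) (metricInChart φ g)) (t, φ x)

/-- The Riemann tensor of `-N² dt² + g` at `(t, x)`, in the coordinates `(t, φ)`. -/
def riemannAt (φ : OpenPartialHomeomorph M E3) (t : ℝ) (x : M) :
    Fin 4 → Fin 4 → Fin 4 → Fin 4 → ℝ :=
  riemann (lorentz (inChart φ N) (metricInChart φ g)) (t, φ x)

/-- The Einstein tensor of `-N² dt² + g` at `(t, x)`, in the coordinates `(t, φ)`. -/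
def einsteinAt (φ : OpenPartialHomeomorph M E3) (t : ℝ) (x : M) : Fin 4 → Fin 4 → ℝ :=
  einstein (lorentz (inChart φ N) (metricInChart φ g)) (t, φ x)

/-- The components of the second fundamental form at `(t, x)`, in the chart `φ`. -/
def secondFormAt (φ : OpenPartialHomeomorph M E3) (t : ℝ) (x : M) :
    Matrix (Fin 3) (Fin 3) ℝ :=
  secondForm (inChart φ N) (metricInChart φ g) (t, φ x)

/-- The mean curvature at `(t, x)`, computed in the chart `φ`. -/
def meanCurvAt (φ : OpenPartialHomeomorph M E3) (t : ℝ) (x : M) : ℝ :=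
  meanCurv (inChart φ N) (metricInChart φ g) (t, φ x)

/-- The entropy `S^pf = (s + s_crit) √g` at `(t, x)`; `√g` is the density of the spatial volume
in the chart `φ`. -/
def entropyPF (k α : ℝ → M → ℝ) (φ : OpenPartialHomeomorph M E3) (t : ℝ) (x : M) : ℝ :=
  (entropyDensity (inChart φ N) (metricInChart φ g) (t, φ x) + sCrit (k t x) (α t x))
    * Real.sqrt (metricInChart φ g (t, φ x)).det

/-- `-N² dt² + g` is a smooth Lorentzian metric on the open set `J × U ⊆ ℝ × M`, with strictly
positive lapse `N` and Riemannian slices. -/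
structure IsFoliatedSpacetime (J : Set ℝ) (U : Set M) : Prop where
  isOpen_time : IsOpen J
  isOpen_space : IsOpen U
  lapse_smooth : ∀ φ : OpenPartialHomeomorph M E3, IsChart φ →
    ContDiffOn ℝ ∞ (inChart φ N) (J ×ˢ (φ.target ∩ φ.symm ⁻¹' U))
  metric_smooth : ∀ φ : OpenPartialHomeomorph M E3, IsChart φ → ∀ i j,
    ContDiffOn ℝ ∞ (fun p => metricInChart φ g p i j) (J ×ˢ (φ.target ∩ φ.symm ⁻¹' U))
  lapse_pos : ∀ t ∈ J, ∀ x ∈ U, 0 < N t x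
  metric_symm : ∀ t ∈ J, ∀ x ∈ U, ∀ v w : TangentSpace (𝓡 3) x, g t x v w = g t x w v
  metric_pos : ∀ t ∈ J, ∀ x ∈ U, ∀ v : TangentSpace (𝓡 3) x, v ≠ 0 → 0 < g t x v v

/-- `J × U` is a `k`-perfect fluid electric region, with mass density `m`: the Einstein equation
holds with the stress-energy tensor of a perfect fluid of pressure `(k - 1) m`, and the
components `W_{Tijk}` of the Weyl tensor vanish. -/
structure IsPerfectFluidElectricRegion (m k : ℝ → M → ℝ) (J : Set ℝ) (U : Set M) : Prop
    extends IsFoliatedSpacetime N g J U where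
  k_mem : ∀ t ∈ J, ∀ x ∈ U, k t x ∈ Set.Icc (0 : ℝ) (4 / 3)
  einstein_eq : ∀ φ : OpenPartialHomeomorph M E3, IsChart φ →
    ∀ t ∈ J, ∀ x ∈ φ.source ∩ U, ∀ a b : Fin 4,
      einsteinAt N g φ t x a b =
        fluidStress (inChart φ N) (metricInChart φ g) (m t x) ((k t x - 1) * m t x) (t, φ x) a b
  electric : ∀ φ : OpenPartialHomeomorph M E3, IsChart φ →
    ∀ t ∈ J, ∀ x ∈ φ.source ∩ U, ∀ i j l : Fin 3,
      weylAt N g φ t x 0 i.succ j.succ l.succ = 0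

/-- `J × U` is an `α`-expanding region: `h ≤ α H g ≤ 0` as quadratic forms. -/
structure IsExpandingRegion (α : ℝ → M → ℝ) (J : Set ℝ) (U : Set M) : Prop where
  α_mem : ∀ t ∈ J, ∀ x ∈ U, α t x ∈ Set.Icc (0 : ℝ) (1 / 3)
  expanding : ∀ φ : OpenPartialHomeomorph M E3, IsChart φ →
    ∀ t ∈ J, ∀ x ∈ φ.source ∩ U, ∀ v : Fin 3 → ℝ,
      v ⬝ᵥ (secondFormAt N g φ t x *ᵥ v) ≤
          α t x * meanCurvAt N g φ t x * (v ⬝ᵥ (metricInChart φ g (t, φ x) *ᵥ v)) ∧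
        α t x * meanCurvAt N g φ t x * (v ⬝ᵥ (metricInChart φ g (t, φ x) *ᵥ v)) ≤ 0

/-- The rate `u'` with `D_T u = u' H`; it is `0` where `H = 0`, by the convention `y / 0 = 0`. -/
def rate (u : ℝ → M → ℝ) (φ : OpenPartialHomeomorph M E3) (t : ℝ) (x : M) : ℝ :=
  DT N u t x / meanCurvAt N g φ t x

/-- The evolution inequalities
`0 ≤ k' ≤ k (9k² - 12k + 8) / (3 (4 - 3k)) · min {9α' / (4 (1 - 3α)), 1}` and `0 ≤ α'`,
where `D_T k = k' H`, `D_T α = α' H` and `k' = α' = 0` where `H = 0`.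
The denominator `3 (4 - 3k)` is multiplied out, and the quotient inside the minimum counts as
`+∞` where `α = 1/3`. -/
structure EvolutionInequalities (k α : ℝ → M → ℝ) (J : Set ℝ) (U : Set M) : Prop where
  k_diff : ∀ x ∈ U, DifferentiableOn ℝ (fun t => k t x) J
  α_diff : ∀ x ∈ U, ContDiffOn ℝ 2 (fun t => α t x) J
  stationary : ∀ φ : OpenPartialHomeomorph M E3, IsChart φ →
    ∀ t ∈ J, ∀ x ∈ φ.source ∩ U, meanCurvAt N g φ t x = 0 → DT N k t x = 0 ∧ DT N α t x = 0
  α_rate : ∀ φ : OpenPartialHomeomorph M E3, IsChart φ →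
    ∀ t ∈ J, ∀ x ∈ φ.source ∩ U, 0 ≤ rate N g α φ t x
  k_rate : ∀ φ : OpenPartialHomeomorph M E3, IsChart φ →
    ∀ t ∈ J, ∀ x ∈ φ.source ∩ U, 0 ≤ rate N g k φ t x
  k_rate_le : ∀ φ : OpenPartialHomeomorph M E3, IsChart φ →
    ∀ t ∈ J, ∀ x ∈ φ.source ∩ U,
      3 * (4 - 3 * k t x) * rate N g k φ t x ≤
        k t x * (9 * k t x ^ 2 - 12 * k t x + 8) *
          (open Classical in if α t x = 1 / 3 then 1
           else min (9 * rate N g α φ t x / (4 * (1 - 3 * α t x))) 1)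

end Manifold

end WeylEntropy

end

/-!
Let `K` be the second fundamental form as an operator, `X` the operator `W_{TiTj}`, and `v = tr X²`.
In a perfect fluid electric region `|W|² = 8 v` and `|R|² = 8 v + (9k² - 12k + 8) m² / 3`, and the
second Bianchi identity becomes a system of ordinary differential equations along the time lines:
`D_T m = k m H` and `D_T v = 4 H v - 6 tr (K X²) + k m tr (K X)`. As `X` is traceless, `tr (K X)`
only sees the traceless part of `K`, and `h ≤ α H g ≤ 0` bounds its norm by
`√(2/3) (1 - 3α) |H|` and `tr (K X²)` by `α H v`. Hence `s` cannot decrease faster than the volume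
factor lets `s + s_crit` increase, while the evolution inequalities say that `s_crit` itself does
not decrease. Where `W = 0` and the Riemann tensor is nonzero, `√v` has a kink with opposite
one-sided slopes, whose size `s_crit` is still large enough to absorb.
-/

noncomputable section

namespace WeylEntropy

section PartialDerivatives

open scoped Topology

variable {f f' : ℝ × E3 → ℝ} {p : ℝ × E3} {μ ν : Fin 4}

theorem pd_congr (h : f =ᶠ[𝓝 p] f') : pd μ f p = pd μ f' p := by
  rw [pd, pd, h.fderiv_eq]

theorem contDiffAt_pd (hf : ContDiffAt ℝ ∞ f p) : ContDiffAt ℝ ∞ (pd μ f) p :=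
  (hf.fderiv_right (m := ∞) (by simp)).clm_apply contDiffAt_const

theorem pd_const (c : ℝ) : pd μ (fun _ => c) p = 0 := by simp [pd]

theorem pd_add (hf : DifferentiableAt ℝ f p) (hf' : DifferentiableAt ℝ f' p) :
    pd μ (fun q => f q + f' q) p = pd μ f p + pd μ f' p := by
  simp [pd, fderiv_fun_add hf hf']

theorem pd_sub (hf : DifferentiableAt ℝ f p) (hf' : DifferentiableAt ℝ f' p) :
    pd μ (fun q => f q - f' q) p = pd μ f p - pd μ f' p := by
  simp [pd, fderiv_fun_sub hf hf']

theorem pd_mul (hf : DifferentiableAt ℝ f p) (hf' : DifferentiableAt ℝ f' p) :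
    pd μ (fun q => f q * f' q) p = pd μ f p * f' p + f p * pd μ f' p := by
  simp [pd, fderiv_fun_mul hf hf', add_comm, mul_comm]

theorem pd_sum {ι : Type*} {s : Finset ι} {F : ι → ℝ × E3 → ℝ}
    (hF : ∀ i ∈ s, DifferentiableAt ℝ (F i) p) :
    pd μ (fun q => ∑ i ∈ s, F i q) p = ∑ i ∈ s, pd μ (F i) p := by
  simp [pd, fderiv_fun_sum hF]

theorem pd_comm (hf : ContDiffAt ℝ 2 f p) : pd μ (pd ν f) p = pd ν (pd μ f) p := by
  have hd : DifferentiableAt ℝ (fderiv ℝ f) p :=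
    (hf.fderiv_right (m := 1) (by norm_num)).differentiableAt (by simp)
  have second_pd (a b : Fin 4) :
      pd a (pd b f) p = fderiv ℝ (fderiv ℝ f) p (coordDir a) (coordDir b) := by
    unfold pd
    rw [fderiv_clm_apply hd (differentiableAt_const _)]
    simp
  rw [second_pd, second_pd, (hf.isSymmSndFDerivAt (by simp)).eq]

theorem hasDerivAt_time {t : ℝ} {y : E3} (hf : DifferentiableAt ℝ f (t, y)) :
    HasDerivAt (fun s => f (s, y)) (pd 0 f (t, y)) t :=
  hf.hasFDerivAt.comp_hasDerivAt t ((hasDerivAt_id t).prodMk (hasDerivAt_const t y))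

end PartialDerivatives

section MatrixCalculus

open scoped Topology

variable {ι κ l : Type*}

section SmoothEntries

variable {E : Type*} [NormedAddCommGroup E] [NormedSpace ℝ E] {p : E}

/-- Smoothness of a matrix-valued function at a point. It is stated entry by entry, because
matrices carry no canonical norm. -/
def SmoothEntriesAt (F : E → Matrix ι κ ℝ) (p : E) : Prop :=
  ∀ i j, ContDiffAt ℝ ∞ (fun q => F q i j) p

namespace SmoothEntriesAt

theorem differentiableAt {F : E → Matrix ι κ ℝ} (hF : SmoothEntriesAt F p) (i : ι) (j : κ) :
    DifferentiableAt ℝ (fun q => F q i j) p :=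
  (hF i j).differentiableAt (by simp)

theorem add {F F' : E → Matrix ι κ ℝ} (hF : SmoothEntriesAt F p) (hF' : SmoothEntriesAt F' p) :
    SmoothEntriesAt (fun q => F q + F' q) p :=
  fun i j => (hF i j).add (hF' i j)

theorem sub {F F' : E → Matrix ι κ ℝ} (hF : SmoothEntriesAt F p) (hF' : SmoothEntriesAt F' p) :
    SmoothEntriesAt (fun q => F q - F' q) p :=
  fun i j => (hF i j).sub (hF' i j)

theorem mul [Fintype κ] {F : E → Matrix ι κ ℝ} {F' : E → Matrix κ l ℝ}
    (hF : SmoothEntriesAt F p) (hF' : SmoothEntriesAt F' p) :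
    SmoothEntriesAt (fun q => F q * F' q) p := by
  intro i j
  simp only [Matrix.mul_apply]
  exact ContDiffAt.sum fun e _ => (hF i e).mul (hF' e j)

theorem transpose {F : E → Matrix ι κ ℝ} (hF : SmoothEntriesAt F p) :
    SmoothEntriesAt (fun q => (F q)ᵀ) p :=
  fun i j => hF j i

variable [Fintype κ] [DecidableEq κ] {F : E → Matrix κ κ ℝ}

theorem contDiffAt_det (hF : SmoothEntriesAt F p) : ContDiffAt ℝ ∞ (fun q => (F q).det) p := by
  simp only [Matrix.det_apply']
  exact ContDiffAt.sum fun σ _ => contDiffAt_const.mul (contDiffAt_prod fun i _ => hF _ _)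

theorem adjugate (hF : SmoothEntriesAt F p) : SmoothEntriesAt (fun q => (F q).adjugate) p := by
  intro i j
  simp only [Matrix.adjugate_apply]
  refine contDiffAt_det (F := fun q => (F q).updateRow j (Pi.single i 1)) fun a b => ?_
  by_cases h : a = j
  · subst h
    simpa using contDiffAt_const
  · simpa [Matrix.updateRow_ne h] using hF a b

theorem inv (hF : SmoothEntriesAt F p) (hdet : (F p).det ≠ 0) :
    SmoothEntriesAt (fun q => (F q)⁻¹) p := by
  intro i j
  simpa [Matrix.inv_def] using (hF.contDiffAt_det.inv hdet).mul (hF.adjugate i j)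

end SmoothEntriesAt

end SmoothEntries

variable {p : ℝ × E3} {μ ν : Fin 4}

/-- The entrywise partial derivative `∂_μ F` of a matrix-valued function. -/
def pdM (μ : Fin 4) (F : ℝ × E3 → Matrix ι κ ℝ) (p : ℝ × E3) : Matrix ι κ ℝ :=
  Matrix.of fun i j => pd μ (fun q => F q i j) p

theorem pdM_apply (F : ℝ × E3 → Matrix ι κ ℝ) (i : ι) (j : κ) :
    pdM μ F p i j = pd μ (fun q => F q i j) p := rfl

theorem SmoothEntriesAt.pdM {F : ℝ × E3 → Matrix ι κ ℝ} (hF : SmoothEntriesAt F p) :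
    SmoothEntriesAt (pdM μ F) p :=
  fun i j => contDiffAt_pd (hF i j)

theorem pdM_congr {F F' : ℝ × E3 → Matrix ι κ ℝ} (h : F =ᶠ[𝓝 p] F') : pdM μ F p = pdM μ F' p := by
  ext i j
  exact pd_congr (h.mono fun q hq => by simp only [hq])

theorem pdM_add {F F' : ℝ × E3 → Matrix ι κ ℝ}
    (hF : ∀ i j, DifferentiableAt ℝ (fun q => F q i j) p)
    (hF' : ∀ i j, DifferentiableAt ℝ (fun q => F' q i j) p) :
    pdM μ (fun q => F q + F' q) p = pdM μ F p + pdM μ F' p := by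
  ext i j
  exact pd_add (hF i j) (hF' i j)

theorem pdM_sub {F F' : ℝ × E3 → Matrix ι κ ℝ}
    (hF : ∀ i j, DifferentiableAt ℝ (fun q => F q i j) p)
    (hF' : ∀ i j, DifferentiableAt ℝ (fun q => F' q i j) p) :
    pdM μ (fun q => F q - F' q) p = pdM μ F p - pdM μ F' p := by
  ext i j
  exact pd_sub (hF i j) (hF' i j)

theorem pdM_mul [Fintype κ] {F : ℝ × E3 → Matrix ι κ ℝ} {F' : ℝ × E3 → Matrix κ l ℝ}
    (hF : ∀ i j, DifferentiableAt ℝ (fun q => F q i j) p)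
    (hF' : ∀ i j, DifferentiableAt ℝ (fun q => F' q i j) p) :
    pdM μ (fun q => F q * F' q) p = pdM μ F p * F' p + F p * pdM μ F' p := by
  ext i j
  simp only [pdM_apply, Matrix.mul_apply, Matrix.add_apply]
  rw [pd_sum (F := fun e q => F q i e * F' q e j) fun e _ => (hF i e).mul (hF' e j),
    ← Finset.sum_add_distrib]
  exact Finset.sum_congr rfl fun e _ => pd_mul (hF i e) (hF' e j)

theorem pdM_transpose (F : ℝ × E3 → Matrix ι κ ℝ) :
    pdM μ (fun q => (F q)ᵀ) p = (pdM μ F p)ᵀ := rfl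

theorem pdM_comm {F : ℝ × E3 → Matrix ι κ ℝ} (hF : SmoothEntriesAt F p) :
    pdM μ (pdM ν F) p = pdM ν (pdM μ F) p := by
  ext i j
  exact pd_comm ((hF i j).of_le (WithTop.coe_le_coe.2 (le_top (a := (2 : ℕ∞)))))

theorem pdM_inv [Fintype κ] [DecidableEq κ] {F : ℝ × E3 → Matrix κ κ ℝ}
    (hF : SmoothEntriesAt F p) (hdet : (F p).det ≠ 0) :
    pdM μ (fun q => (F q)⁻¹) p = -((F p)⁻¹ * pdM μ F p * (F p)⁻¹) := by
  have hmul : (fun q => F q * (F q)⁻¹) =ᶠ[𝓝 p] fun _ => 1 :=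
    (hF.contDiffAt_det.continuousAt.eventually_ne hdet).mono fun q hq =>
      Matrix.mul_nonsing_inv _ (isUnit_iff_ne_zero.2 hq)
  have hzero : pdM μ F p * (F p)⁻¹ + F p * pdM μ (fun q => (F q)⁻¹) p = 0 := by
    rw [← pdM_mul hF.differentiableAt (hF.inv hdet).differentiableAt, pdM_congr hmul]
    ext i j
    exact pd_const _
  have hinv := congrArg ((F p)⁻¹ * ·) hzero
  simp only [Matrix.mul_add, Matrix.nonsing_inv_mul_cancel_left _ _ (isUnit_iff_ne_zero.2 hdet),
    Matrix.mul_zero] at hinv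
  rw [eq_neg_of_add_eq_zero_right hinv, Matrix.mul_assoc]

end MatrixCalculus

section Curvature

open scoped Topology

variable {Ω : Set (ℝ × E3)} {G : ℝ × E3 → Matrix (Fin 4) (Fin 4) ℝ} {p : ℝ × E3}

/-- The connection matrices `(Γ_μ)^a_b = Γ^a_{μb}`. -/
def connMatrix (G : ℝ × E3 → Matrix (Fin 4) (Fin 4) ℝ) (μ : Fin 4) (p : ℝ × E3) :
    Matrix (Fin 4) (Fin 4) ℝ := Matrix.of fun a b => christoffel G a μ b p

/-- The curvature matrices `(R_{cd})^a_b = R^a_{bcd}`. -/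
def curvMatrix (G : ℝ × E3 → Matrix (Fin 4) (Fin 4) ℝ) (c d : Fin 4) (p : ℝ × E3) :
    Matrix (Fin 4) (Fin 4) ℝ := Matrix.of fun a b => riemannUp G a b c d p

theorem curvMatrix_eq (c d : Fin 4) (p : ℝ × E3) :
    curvMatrix G c d p = pdM c (connMatrix G d) p - pdM d (connMatrix G c) p
      + connMatrix G c p * connMatrix G d p - connMatrix G d p * connMatrix G c p := by
  ext a b
  simp only [curvMatrix, Matrix.of_apply, riemannUp, Matrix.add_apply, Matrix.sub_apply,
    Matrix.mul_apply, pdM_apply, connMatrix, Finset.sum_sub_distrib]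
  ring

theorem curvMatrix_antisymm (c d : Fin 4) (p : ℝ × E3) :
    curvMatrix G c d p = -curvMatrix G d c p := by
  rw [curvMatrix_eq, curvMatrix_eq]
  abel

theorem riemann_eq_mul_curvMatrix (a b c d : Fin 4) :
    riemann G p a b c d = (G p * curvMatrix G c d p) a b := by
  simp [riemann, curvMatrix, Matrix.mul_apply]

theorem riemann_antisymm_right (a b c d : Fin 4) :
    riemann G p a b c d = -riemann G p a b d c := by
  rw [riemann_eq_mul_curvMatrix, riemann_eq_mul_curvMatrix, curvMatrix_antisymm]
  simp

theorem pair_symm_of_bianchi {ι : Type*} {S : ι → ι → ι → ι → ℝ}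
    (left : ∀ a b c d, S a b c d = -S b a c d) (right : ∀ a b c d, S a b c d = -S a b d c)
    (bianchi : ∀ a b c d, S a b c d + S a c d b + S a d b c = 0) (a b c d : ι) :
    S a b c d = S c d a b := by
  -- the alternating sum of the four cyclic Bianchi identities is `2 S_{abcd} - 2 S_{cdab}`
  linarith [bianchi a b c d, bianchi b c d a, bianchi c d a b, bianchi d a b c,
    left b a c d, left c a b d, right a c b d, left c b d a, left d a b c,
    left d b c a, right b d c a, left d c a b]

/-- A smooth symmetric nondegenerate matrix of metric coefficients on an open set. -/
structure IsMetric (Ω : Set (ℝ × E3)) (G : ℝ × E3 → Matrix (Fin 4) (Fin 4) ℝ) : Prop where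
  isOpen : IsOpen Ω
  smooth : ∀ q ∈ Ω, SmoothEntriesAt G q
  symm : ∀ q ∈ Ω, (G q).IsSymm
  det_ne : ∀ q ∈ Ω, (G q).det ≠ 0

namespace IsMetric

theorem eventually_mem (hG : IsMetric Ω G) (hp : p ∈ Ω) : ∀ᶠ q in 𝓝 p, q ∈ Ω :=
  hG.isOpen.eventually_mem hp

theorem isUnit_det (hG : IsMetric Ω G) (hp : p ∈ Ω) : IsUnit (G p).det :=
  (hG.det_ne p hp).isUnit

theorem pd_symm (hG : IsMetric Ω G) (hp : p ∈ Ω) (μ a b : Fin 4) :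
    pd μ (fun q => G q a b) p = pd μ (fun q => G q b a) p :=
  pd_congr ((hG.eventually_mem hp).mono fun q hq => (hG.symm q hq).apply b a)

theorem smooth_connMatrix (hG : IsMetric Ω G) (hp : p ∈ Ω) (μ : Fin 4) :
    SmoothEntriesAt (connMatrix G μ) p := by
  intro a b
  have h (c i j : Fin 4) : ContDiffAt ℝ ∞ (pd c fun q => G q i j) p :=
    contDiffAt_pd (hG.smooth p hp i j)
  simp only [connMatrix, Matrix.of_apply, christoffel]
  exact contDiffAt_const.mul (ContDiffAt.sum fun d _ =>
    ((hG.smooth p hp).inv (hG.det_ne p hp) a d).mul (((h _ _ _).add (h _ _ _)).sub (h _ _ _)))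

theorem smooth_curvMatrix (hG : IsMetric Ω G) (hp : p ∈ Ω) (c d : Fin 4) :
    SmoothEntriesAt (curvMatrix G c d) p := by
  have h := hG.smooth_connMatrix hp
  rw [funext (curvMatrix_eq (G := G) c d)]
  exact (((h d).pdM.sub (h c).pdM).add ((h c).mul (h d))).sub ((h d).mul (h c))

theorem christoffel_symm (hG : IsMetric Ω G) (hp : p ∈ Ω) (c a b : Fin 4) :
    christoffel G c a b p = christoffel G c b a p := by
  simp only [christoffel]
  congr! 3 with d
  rw [hG.pd_symm hp d a b, add_comm]

theorem lower_christoffel (hG : IsMetric Ω G) (hp : p ∈ Ω) (a μ b : Fin 4) :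
    (G p * connMatrix G μ p) a b =
      (1 / 2) * (pd μ (fun q => G q b a) p + pd b (fun q => G q μ a) p
        - pd a (fun q => G q μ b) p) := by
  have h : connMatrix G μ p = (G p)⁻¹ * Matrix.of fun d b => (1 / 2) *
      (pd μ (fun q => G q b d) p + pd b (fun q => G q μ d) p - pd d (fun q => G q μ b) p) := by
    ext c e
    simp only [connMatrix, Matrix.of_apply, christoffel, Matrix.mul_apply, Finset.mul_sum]
    exact Finset.sum_congr rfl fun d _ => by ring
  rw [h, Matrix.mul_nonsing_inv_cancel_left _ _ (hG.isUnit_det hp), Matrix.of_apply]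

theorem pdM_metric (hG : IsMetric Ω G) (hp : p ∈ Ω) (μ : Fin 4) :
    pdM μ G p = G p * connMatrix G μ p + (connMatrix G μ p)ᵀ * G p := by
  have htr : (connMatrix G μ p)ᵀ * G p = (G p * connMatrix G μ p)ᵀ := by
    rw [Matrix.transpose_mul, (hG.symm p hp).eq]
  ext a b
  rw [htr, Matrix.add_apply, Matrix.transpose_apply, hG.lower_christoffel hp,
    hG.lower_christoffel hp, pdM_apply, hG.pd_symm hp μ b a]
  ring

theorem pdM_pdM_metric (hG : IsMetric Ω G) (hp : p ∈ Ω) (c d : Fin 4) :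
    pdM c (pdM d G) p =
      (G p * connMatrix G c p + (connMatrix G c p)ᵀ * G p) * connMatrix G d p
        + G p * pdM c (connMatrix G d) p
        + ((pdM c (connMatrix G d) p)ᵀ * G p
          + (connMatrix G d p)ᵀ * (G p * connMatrix G c p + (connMatrix G c p)ᵀ * G p)) := by
  have hg := hG.smooth p hp
  have hd := hG.smooth_connMatrix hp d
  rw [pdM_congr ((hG.eventually_mem hp).mono fun q hq => hG.pdM_metric hq d),
    pdM_add (hg.mul hd).differentiableAt (hd.transpose.mul hg).differentiableAt,
    pdM_mul hg.differentiableAt hd.differentiableAt,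
    pdM_mul hd.transpose.differentiableAt hg.differentiableAt, pdM_transpose, hG.pdM_metric hp c]

theorem metric_mul_curvMatrix_antisymm (hG : IsMetric Ω G) (hp : p ∈ Ω) (c d : Fin 4) :
    G p * curvMatrix G c d p + (curvMatrix G c d p)ᵀ * G p = 0 := by
  have h := pdM_comm (μ := c) (ν := d) (hG.smooth p hp)
  rw [hG.pdM_pdM_metric hp, hG.pdM_pdM_metric hp, ← sub_eq_zero] at h
  rw [curvMatrix_eq, ← h]
  simp only [Matrix.transpose_add, Matrix.transpose_sub, Matrix.transpose_mul]
  noncomm_ring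

theorem riemann_antisymm_left (hG : IsMetric Ω G) (hp : p ∈ Ω) (a b c d : Fin 4) :
    riemann G p a b c d = -riemann G p b a c d := by
  have htr : (curvMatrix G c d p)ᵀ * G p = (G p * curvMatrix G c d p)ᵀ := by
    rw [Matrix.transpose_mul, (hG.symm p hp).eq]
  have h := congrFun (congrFun (hG.metric_mul_curvMatrix_antisymm hp c d) a) b
  rw [htr, Matrix.add_apply, Matrix.transpose_apply, Matrix.zero_apply] at h
  rw [riemann_eq_mul_curvMatrix, riemann_eq_mul_curvMatrix]
  exact eq_neg_of_add_eq_zero_left h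

theorem first_bianchi_up (hG : IsMetric Ω G) (hp : p ∈ Ω) (a b c d : Fin 4) :
    riemannUp G a b c d p + riemannUp G a c d b p + riemannUp G a d b c p = 0 := by
  have hd (μ a b c) : pd μ (christoffel G a b c) p = pd μ (christoffel G a c b) p :=
    pd_congr ((hG.eventually_mem hp).mono fun q hq => hG.christoffel_symm hq a b c)
  simp only [riemannUp, Finset.sum_sub_distrib]
  rw [hd c a d b, hd d a c b, hd b a d c]
  simp only [hG.christoffel_symm hp _ d b, hG.christoffel_symm hp _ c b,
    hG.christoffel_symm hp _ d c]
  ring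

theorem first_bianchi (hG : IsMetric Ω G) (hp : p ∈ Ω) (a b c d : Fin 4) :
    riemann G p a b c d + riemann G p a c d b + riemann G p a d b c = 0 := by
  simp only [riemann, ← Finset.sum_add_distrib, ← mul_add, hG.first_bianchi_up hp, mul_zero,
    Finset.sum_const_zero]

theorem riemann_pair_symm (hG : IsMetric Ω G) (hp : p ∈ Ω) (a b c d : Fin 4) :
    riemann G p a b c d = riemann G p c d a b :=
  pair_symm_of_bianchi (hG.riemann_antisymm_left hp) riemann_antisymm_right
    (hG.first_bianchi hp) a b c d

theorem pdM_curvMatrix (hG : IsMetric Ω G) (hp : p ∈ Ω) (c d e : Fin 4) :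
    pdM e (curvMatrix G c d) p =
      pdM e (pdM c (connMatrix G d)) p - pdM e (pdM d (connMatrix G c)) p
        + (pdM e (connMatrix G c) p * connMatrix G d p
          + connMatrix G c p * pdM e (connMatrix G d) p)
        - (pdM e (connMatrix G d) p * connMatrix G c p
          + connMatrix G d p * pdM e (connMatrix G c) p) := by
  have hc := hG.smooth_connMatrix hp c
  have hd := hG.smooth_connMatrix hp d
  rw [funext (curvMatrix_eq (G := G) c d),
    pdM_sub ((hd.pdM.sub hc.pdM).add (hc.mul hd)).differentiableAt (hd.mul hc).differentiableAt,
    pdM_add (hd.pdM.sub hc.pdM).differentiableAt (hc.mul hd).differentiableAt,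
    pdM_sub hd.pdM.differentiableAt hc.pdM.differentiableAt,
    pdM_mul hc.differentiableAt hd.differentiableAt,
    pdM_mul hd.differentiableAt hc.differentiableAt]

theorem second_bianchi (hG : IsMetric Ω G) (hp : p ∈ Ω) (c d e : Fin 4) :
    (pdM e (curvMatrix G c d) p
        + (connMatrix G e p * curvMatrix G c d p - curvMatrix G c d p * connMatrix G e p))
      + (pdM c (curvMatrix G d e) p
        + (connMatrix G c p * curvMatrix G d e p - curvMatrix G d e p * connMatrix G c p))
      + (pdM d (curvMatrix G e c) p
        + (connMatrix G d p * curvMatrix G e c p - curvMatrix G e c p * connMatrix G d p)) = 0 := by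
  have h := hG.smooth_connMatrix hp
  rw [hG.pdM_curvMatrix hp, hG.pdM_curvMatrix hp, hG.pdM_curvMatrix hp,
    pdM_comm (μ := e) (ν := c) (h d), pdM_comm (μ := e) (ν := d) (h c),
    pdM_comm (μ := c) (ν := d) (h e), curvMatrix_eq, curvMatrix_eq, curvMatrix_eq]
  noncomm_ring

end IsMetric

end Curvature

section Tensors

open scoped Kronecker

variable {ι : Type*}

/-- A `(0,4)`-tensor as a matrix: the first pair of indices numbers the rows, the second pair the
columns. -/
def pairMatrix (S : ι → ι → ι → ι → ℝ) : Matrix (ι × ι) (ι × ι) ℝ :=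
  Matrix.of fun x y => S x.1 x.2 y.1 y.2

/-- The antisymmetries and the pair symmetry of curvature tensors. -/
structure HasRiemannSymmetries (S : ι → ι → ι → ι → ℝ) : Prop where
  antisymm_left : ∀ a b c d, S a b c d = -S b a c d
  antisymm_right : ∀ a b c d, S a b c d = -S a b d c
  pair_symm : ∀ a b c d, S a b c d = S c d a b

/-- The Kulkarni–Nomizu product of two `(0,2)`-tensors. -/
def kulkarniNomizu (A B : Matrix ι ι ℝ) (i j k l : ι) : ℝ :=
  A i k * B j l + A j l * B i k - A i l * B j k - A j k * B i l

namespace HasRiemannSymmetries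

variable {S S' : ι → ι → ι → ι → ℝ}

theorem eq_zero_left (hS : HasRiemannSymmetries S) (i k l : ι) : S i i k l = 0 :=
  self_eq_neg.1 (hS.antisymm_left i i k l)

theorem eq_zero_right (hS : HasRiemannSymmetries S) (i j k : ι) : S i j k k = 0 :=
  self_eq_neg.1 (hS.antisymm_right i j k k)

theorem add (hS : HasRiemannSymmetries S) (hS' : HasRiemannSymmetries S') :
    HasRiemannSymmetries (S + S') where
  antisymm_left a b c d := by
    simp only [Pi.add_apply, hS.antisymm_left a b, hS'.antisymm_left a b, neg_add]
  antisymm_right a b c d := by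
    simp only [Pi.add_apply, hS.antisymm_right a b c d, hS'.antisymm_right a b c d, neg_add]
  pair_symm a b c d := by
    simp only [Pi.add_apply, hS.pair_symm a b c d, hS'.pair_symm a b c d]

theorem smul (hS : HasRiemannSymmetries S) (r : ℝ) : HasRiemannSymmetries (r • S) where
  antisymm_left a b c d := by simp only [Pi.smul_apply, hS.antisymm_left a b, smul_neg]
  antisymm_right a b c d := by simp only [Pi.smul_apply, hS.antisymm_right a b c d, smul_neg]
  pair_symm a b c d := by simp only [Pi.smul_apply, hS.pair_symm a b c d]

theorem comp (hS : HasRiemannSymmetries S) {κ : Type*} (e : κ → ι) :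
    HasRiemannSymmetries fun i j k l => S (e i) (e j) (e k) (e l) :=
  ⟨fun _ _ _ _ => hS.antisymm_left _ _ _ _, fun _ _ _ _ => hS.antisymm_right _ _ _ _,
    fun _ _ _ _ => hS.pair_symm _ _ _ _⟩

end HasRiemannSymmetries

theorem hasRiemannSymmetries_kulkarniNomizu {A B : Matrix ι ι ℝ} (hA : A.IsSymm) (hB : B.IsSymm) :
    HasRiemannSymmetries (kulkarniNomizu A B) where
  antisymm_left a b c d := by simp only [kulkarniNomizu]; ring
  antisymm_right a b c d := by simp only [kulkarniNomizu]; ring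
  pair_symm a b c d := by
    simp only [kulkarniNomizu, hA.apply c a, hA.apply d b, hA.apply c b, hA.apply d a,
      hB.apply c a, hB.apply d b, hB.apply c b, hB.apply d a]
    ring

variable [Fintype ι]

/-- The components of a `(0,4)`-tensor in the frame formed by the columns of `F`. -/
def pull (F : Matrix ι ι ℝ) (S : ι → ι → ι → ι → ℝ) (a b c d : ι) : ℝ :=
  ((F ⊗ₖ F)ᵀ * pairMatrix S * (F ⊗ₖ F)) (a, b) (c, d)

theorem pairMatrix_pull (F : Matrix ι ι ℝ) (S : ι → ι → ι → ι → ℝ) :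
    pairMatrix (pull F S) = (F ⊗ₖ F)ᵀ * pairMatrix S * (F ⊗ₖ F) := rfl

theorem pull_apply (F : Matrix ι ι ℝ) (S : ι → ι → ι → ι → ℝ) (a b c d : ι) :
    pull F S a b c d =
      ∑ i, ∑ j, ∑ k, ∑ l, F i a * F j b * F k c * F l d * S i j k l := by
  rw [pull, Matrix.mul_assoc, Matrix.mul_apply]
  simp only [Matrix.mul_apply, Matrix.transpose_apply, Fintype.sum_prod_type, Finset.mul_sum,
    Matrix.kroneckerMap_apply, pairMatrix, Matrix.of_apply]
  refine Fintype.sum_congr _ _ fun i => Fintype.sum_congr _ _ fun j =>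
    Fintype.sum_congr _ _ fun k => Fintype.sum_congr _ _ fun l => ?_
  ring

theorem pull_add (F : Matrix ι ι ℝ) (S S' : ι → ι → ι → ι → ℝ) :
    pull F (S + S') = pull F S + pull F S' := by
  ext a b c d
  simp only [pull_apply, Pi.add_apply, mul_add, Finset.sum_add_distrib]

theorem pull_smul (F : Matrix ι ι ℝ) (r : ℝ) (S : ι → ι → ι → ι → ℝ) :
    pull F (r • S) = r • pull F S := by
  ext a b c d
  simp only [pull_apply, Pi.smul_apply, smul_eq_mul, Finset.mul_sum, mul_left_comm r]

theorem pull_injective [DecidableEq ι] {F : Matrix ι ι ℝ} (hF : IsUnit F) :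
    Function.Injective (pull F) := by
  intro S S' h
  have hK : IsUnit (F ⊗ₖ F) := by
    rw [Matrix.isUnit_iff_isUnit_det] at hF ⊢
    rw [Matrix.det_kronecker]
    exact (hF.pow _).mul (hF.pow _)
  have h' : (F ⊗ₖ F)ᵀ * pairMatrix S * (F ⊗ₖ F) = (F ⊗ₖ F)ᵀ * pairMatrix S' * (F ⊗ₖ F) := by
    rw [← pairMatrix_pull, ← pairMatrix_pull, h]
  have hpair := (Matrix.isUnit_transpose (F ⊗ₖ F)|>.2 hK).mul_left_cancel (hK.mul_right_cancel h')
  ext i j k l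
  exact congrFun₂ hpair (i, j) (k, l)

theorem pull_swap_left (F : Matrix ι ι ℝ) (S : ι → ι → ι → ι → ℝ) (a b c d : ι) :
    pull F (fun i j k l => S j i k l) a b c d = pull F S b a c d := by
  rw [pull_apply, pull_apply, Finset.sum_comm]
  congr! 4
  ring

theorem pull_swap_right (F : Matrix ι ι ℝ) (S : ι → ι → ι → ι → ℝ) (a b c d : ι) :
    pull F (fun i j k l => S i j l k) a b c d = pull F S a b d c := by
  rw [pull_apply, pull_apply]
  congr! 2
  rw [Finset.sum_comm]
  congr! 2
  ring

theorem pull_swap_pairs (F : Matrix ι ι ℝ) (S : ι → ι → ι → ι → ℝ) (a b c d : ι) :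
    pull F (fun i j k l => S k l i j) a b c d = pull F S c d a b := by
  have h : pairMatrix (pull F fun i j k l => S k l i j) = (pairMatrix (pull F S))ᵀ := by
    simp only [pairMatrix_pull, Matrix.transpose_mul, Matrix.transpose_transpose, Matrix.mul_assoc]
    rfl
  exact congrFun₂ h (a, b) (c, d)

theorem HasRiemannSymmetries.pull {S : ι → ι → ι → ι → ℝ} (hS : HasRiemannSymmetries S)
    (F : Matrix ι ι ℝ) : HasRiemannSymmetries (pull F S) where
  antisymm_left a b c d := by
    have h : S = (-1 : ℝ) • fun i j k l => S j i k l := by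
      ext i j k l
      simpa using hS.antisymm_left i j k l
    conv_lhs => rw [h, pull_smul]
    simp only [Pi.smul_apply, pull_swap_left, neg_smul, one_smul]
  antisymm_right a b c d := by
    have h : S = (-1 : ℝ) • fun i j k l => S i j l k := by
      ext i j k l
      simpa using hS.antisymm_right i j k l
    conv_lhs => rw [h, pull_smul]
    simp only [Pi.smul_apply, pull_swap_right, neg_smul, one_smul]
  pair_symm a b c d := by
    have h : S = fun i j k l => S k l i j := by
      ext i j k l
      exact hS.pair_symm i j k l
    conv_lhs => rw [h]
    exact pull_swap_pairs F S a b c d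

theorem pull_mul_mul (F A B : Matrix ι ι ℝ) (a b c d : ι) :
    pull F (fun i j k l => A i k * B j l) a b c d = (Fᵀ * A * F) a c * (Fᵀ * B * F) b d := by
  have h : pairMatrix (fun i j k l => A i k * B j l) = A ⊗ₖ B := rfl
  rw [pull, h, ← Matrix.kroneckerMap_transpose, ← Matrix.mul_kronecker_mul,
    ← Matrix.mul_kronecker_mul, Matrix.kroneckerMap_apply]

theorem pull_kulkarniNomizu (F A B : Matrix ι ι ℝ) :
    pull F (kulkarniNomizu A B) = kulkarniNomizu (Fᵀ * A * F) (Fᵀ * B * F) := by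
  have h : kulkarniNomizu A B =
      ((fun i j k l => A i k * B j l) + fun i j k l => B i k * A j l)
        + (-1 : ℝ) • ((fun i j k l => A i l * B j k) + fun i j k l => B i l * A j k) := by
    ext i j k l
    simp [kulkarniNomizu]
    ring
  ext a b c d
  rw [h]
  simp only [pull_add, pull_smul, Pi.add_apply, Pi.smul_apply, pull_mul_mul,
    pull_swap_right F fun i j k l => A i k * B j l, pull_swap_right F fun i j k l => B i k * A j l,
    kulkarniNomizu, smul_eq_mul]
  ring

theorem trace_mul_transpose_self {κ : Type*} [Fintype κ] (A : Matrix ι κ ℝ) :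
    (A * Aᵀ).trace = ∑ i, ∑ j, A i j ^ 2 := by
  simp only [← Matrix.sum_hadamard_eq, Matrix.hadamard_apply, sq]

theorem tensorNorm_eq_sqrt_trace (B : Matrix (Fin 4) (Fin 4) ℝ)
    (S : Fin 4 → Fin 4 → Fin 4 → Fin 4 → ℝ) :
    tensorNorm B S = Real.sqrt
      ((B⁻¹ ⊗ₖ B⁻¹) * pairMatrix S * (B⁻¹ ⊗ₖ B⁻¹)ᵀ * (pairMatrix S)ᵀ).trace := by
  set Q := B⁻¹ ⊗ₖ B⁻¹ with hQ
  set P := pairMatrix S with hP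
  have hsum : (Q * P * Qᵀ * Pᵀ).trace =
      ∑ x, ∑ y, ∑ x', ∑ y', Q x x' * Q y y' * P x y * P x' y' := by
    rw [← Matrix.sum_hadamard_eq]
    simp only [Matrix.hadamard_apply, Matrix.mul_apply, Finset.sum_mul, Matrix.transpose_apply]
    congr! 2
    rw [Finset.sum_comm]
    congr! 2
    ring
  rw [hsum, tensorNorm]
  congr 1
  simp only [hQ, hP, Fintype.sum_prod_type, Matrix.kroneckerMap_apply, pairMatrix, Matrix.of_apply]
  congr! 8
  ring

theorem tensorNorm_eq_sqrt_sum_pull {F B : Matrix (Fin 4) (Fin 4) ℝ} (hB : B⁻¹ = F * Fᵀ)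
    (S : Fin 4 → Fin 4 → Fin 4 → Fin 4 → ℝ) :
    tensorNorm B S = Real.sqrt (∑ a, ∑ b, ∑ c, ∑ d, pull F S a b c d ^ 2) := by
  have hK : B⁻¹ ⊗ₖ B⁻¹ = (F ⊗ₖ F) * (F ⊗ₖ F)ᵀ := by
    rw [hB, Matrix.mul_kronecker_mul, Matrix.kroneckerMap_transpose]
  have htrace : (pairMatrix (pull F S) * (pairMatrix (pull F S))ᵀ).trace =
      ∑ a, ∑ b, ∑ c, ∑ d, pull F S a b c d ^ 2 := by
    simp only [trace_mul_transpose_self, Fintype.sum_prod_type, pairMatrix, Matrix.of_apply]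
  rw [tensorNorm_eq_sqrt_trace, hK, ← htrace, pairMatrix_pull]
  congr 1
  simp only [Matrix.transpose_mul, Matrix.transpose_transpose, Matrix.mul_assoc]
  rw [Matrix.trace_mul_comm]
  simp only [Matrix.mul_assoc]

/-- The contraction `c^{ik} S_{ijkl}`. -/
def contract (c : Matrix ι ι ℝ) (S : ι → ι → ι → ι → ℝ) : Matrix ι ι ℝ :=
  Matrix.of fun j l => ∑ i, ∑ k, c i k * S i j k l

theorem contract_sub (c : Matrix ι ι ℝ) (S S' : ι → ι → ι → ι → ℝ) :
    contract c (S - S') = contract c S - contract c S' := by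
  ext j l
  simp only [contract, Matrix.of_apply, Matrix.sub_apply, Pi.sub_apply, mul_sub,
    Finset.sum_sub_distrib]

theorem contract_smul (c : Matrix ι ι ℝ) (r : ℝ) (S : ι → ι → ι → ι → ℝ) :
    contract c (r • S) = r • contract c S := by
  ext j l
  simp only [contract, Matrix.of_apply, Matrix.smul_apply, Pi.smul_apply, smul_eq_mul,
    Finset.mul_sum, mul_left_comm r]

theorem HasRiemannSymmetries.contract_isSymm {S : ι → ι → ι → ι → ℝ}
    (hS : HasRiemannSymmetries S) {c : Matrix ι ι ℝ} (hc : c.IsSymm) : (contract c S).IsSymm := by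
  ext j l
  simp only [contract, Matrix.transpose_apply, Matrix.of_apply]
  rw [Finset.sum_comm]
  congr! 2 with i _ k
  rw [hS.pair_symm, hc.apply]

theorem transpose_mul_mul_apply (F A : Matrix ι ι ℝ) (a c : ι) :
    (Fᵀ * A * F) a c = ∑ i, ∑ k, F i a * A i k * F k c := by
  simp only [Matrix.mul_apply, Matrix.transpose_apply, Finset.sum_mul]
  exact Finset.sum_comm

theorem contract_one_apply [DecidableEq ι] (S : ι → ι → ι → ι → ℝ) (j l : ι) :
    contract 1 S j l = ∑ i, S i j i l := by
  simp [contract, Matrix.one_apply]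

theorem contract_one_pull [DecidableEq ι] (F : Matrix ι ι ℝ) (S : ι → ι → ι → ι → ℝ) :
    contract 1 (pull F S) = Fᵀ * contract (F * Fᵀ) S * F := by
  ext b d
  have hpull (a : ι) : pull F S a b a d =
      ∑ j, ∑ l, ∑ i, ∑ k, F j b * (F i a * F k a * S i j k l) * F l d := by
    rw [pull_apply, Finset.sum_comm]
    refine Fintype.sum_congr _ _ fun j => ?_
    rw [Fintype.sum_congr _ _ fun i => Finset.sum_comm, Finset.sum_comm]
    refine Fintype.sum_congr _ _ fun l => Fintype.sum_congr _ _ fun i =>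
      Fintype.sum_congr _ _ fun k => ?_
    ring
  rw [contract_one_apply, transpose_mul_mul_apply]
  simp only [hpull, contract, Matrix.of_apply, Matrix.mul_apply,
    Matrix.transpose_apply, Finset.mul_sum, Finset.sum_mul]
  rw [Finset.sum_comm]
  refine Fintype.sum_congr _ _ fun j => ?_
  rw [Finset.sum_comm]
  refine Fintype.sum_congr _ _ fun l => ?_
  rw [Finset.sum_comm]
  refine Fintype.sum_congr _ _ fun i => ?_
  rw [Finset.sum_comm]

theorem contract_kulkarniNomizu (c A B : Matrix ι ι ℝ) :
    contract c (kulkarniNomizu A B) =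
      (c * Aᵀ).trace • B + (c * Bᵀ).trace • A - B * cᵀ * A - A * cᵀ * B := by
  have hmul (A B : Matrix ι ι ℝ) (j l : ι) :
      (A * cᵀ * B) j l = ∑ i, ∑ k, c i k * (A j k * B i l) := by
    simp only [Matrix.mul_apply, Matrix.transpose_apply, Finset.sum_mul]
    exact Fintype.sum_congr _ _ fun i => Fintype.sum_congr _ _ fun k => by ring
  ext j l
  simp only [← Matrix.sum_hadamard_eq, Matrix.sub_apply, Matrix.add_apply, Matrix.smul_apply,
    hmul, contract, Matrix.of_apply, kulkarniNomizu, Matrix.hadamard_apply, smul_eq_mul,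
    Finset.sum_mul, ← Finset.sum_sub_distrib, ← Finset.sum_add_distrib]
  exact Fintype.sum_congr _ _ fun i => Fintype.sum_congr _ _ fun k => by ring

theorem contract_inv_kulkarniNomizu_self [DecidableEq ι] {g : Matrix ι ι ℝ} (hg : g.IsSymm)
    (hdet : IsUnit g.det) :
    contract g⁻¹ (kulkarniNomizu g g) = (2 * (Fintype.card ι - 1 : ℝ)) • g := by
  rw [contract_kulkarniNomizu, hg.eq, hg.inv.eq, Matrix.nonsing_inv_mul _ hdet, Matrix.trace_one,
    Matrix.mul_nonsing_inv _ hdet, Matrix.one_mul]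
  module

end Tensors

section Frame

open scoped MatrixOrder in
theorem exists_frame {ι : Type*} [Fintype ι] [DecidableEq ι] {g : Matrix ι ι ℝ} (hg : g.PosDef) :
    ∃ L : Matrix ι ι ℝ, IsUnit L ∧ g⁻¹ = L * Lᵀ ∧ Lᵀ * g * L = 1 := by
  obtain ⟨L, hL, hgL⟩ :=
    CStarAlgebra.isStrictlyPositive_iff_eq_mul_star_self.1 hg.inv.isStrictlyPositive
  rw [Matrix.star_eq_conjTranspose, Matrix.conjTranspose_eq_transpose_of_trivial] at hgL
  have hdet : IsUnit L.det := (Matrix.isUnit_iff_isUnit_det L).1 hL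
  have hg' : g = L⁻¹ᵀ * L⁻¹ := by
    rw [← Matrix.nonsing_inv_nonsing_inv g hg.det_pos.ne'.isUnit, hgL, Matrix.mul_inv_rev,
      Matrix.transpose_nonsing_inv]
  refine ⟨L, hL, hgL, ?_⟩
  rw [hg', ← Matrix.mul_assoc, ← Matrix.transpose_mul, Matrix.nonsing_inv_mul _ hdet,
    Matrix.transpose_one, Matrix.one_mul, Matrix.nonsing_inv_mul _ hdet]

end Frame

section DimensionThree

namespace HasRiemannSymmetries

variable {S : Fin 3 → Fin 3 → Fin 3 → Fin 3 → ℝ}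

theorem eq_kulkarniNomizu_one (hS : HasRiemannSymmetries S) :
    S = kulkarniNomizu (contract 1 S) 1 - ((contract 1 S).trace / 4) • kulkarniNomizu 1 1 := by
  have left₁₀ := hS.antisymm_left 1 0
  have left₂₀ := hS.antisymm_left 2 0
  have left₂₁ := hS.antisymm_left 2 1
  have right₁₀ := fun a b => hS.antisymm_right a b 1 0
  have right₂₀ := fun a b => hS.antisymm_right a b 2 0
  have right₂₁ := fun a b => hS.antisymm_right a b 2 1
  have pair₀₂₀₁ := hS.pair_symm 0 2 0 1
  have pair₁₂₀₁ := hS.pair_symm 1 2 0 1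
  have pair₁₂₀₂ := hS.pair_symm 1 2 0 2
  ext i j k l
  fin_cases i <;> fin_cases j <;> fin_cases k <;> fin_cases l <;>
    simp [kulkarniNomizu, contract_one_apply, Matrix.trace, Fin.sum_univ_three, hS.eq_zero_left,
      hS.eq_zero_right, left₁₀, left₂₀, left₂₁, right₁₀, right₂₀, right₂₁,
      pair₀₂₀₁, pair₁₂₀₁, pair₁₂₀₂] <;> ring

theorem sum_sq_eq (hS : HasRiemannSymmetries S) :
    ∑ i, ∑ j, ∑ k, ∑ l, S i j k l ^ 2 =
      4 * ∑ j, ∑ l, contract 1 S j l ^ 2 - (contract 1 S).trace ^ 2 := by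
  have left₁₀ := hS.antisymm_left 1 0
  have left₂₀ := hS.antisymm_left 2 0
  have left₂₁ := hS.antisymm_left 2 1
  have right₁₀ := fun a b => hS.antisymm_right a b 1 0
  have right₂₀ := fun a b => hS.antisymm_right a b 2 0
  have right₂₁ := fun a b => hS.antisymm_right a b 2 1
  have pair₀₂₀₁ := hS.pair_symm 0 2 0 1
  have pair₁₂₀₁ := hS.pair_symm 1 2 0 1
  have pair₁₂₀₂ := hS.pair_symm 1 2 0 2
  simp only [contract_one_apply, Matrix.trace, Matrix.diag_apply, Fin.sum_univ_three,
    hS.eq_zero_left, hS.eq_zero_right, left₁₀, left₂₀, left₂₁, right₁₀, right₂₀, right₂₁,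
      pair₀₂₀₁, pair₁₂₀₁, pair₁₂₀₂]
  ring

theorem eq_kulkarniNomizu (hS : HasRiemannSymmetries S) {g : Matrix (Fin 3) (Fin 3) ℝ}
    (hg : g.PosDef) :
    S = kulkarniNomizu (contract g⁻¹ S) g
      - ((g⁻¹ * contract g⁻¹ S).trace / 4) • kulkarniNomizu g g := by
  obtain ⟨L, hL, hginv, hgL⟩ := exists_frame hg
  have hcontract : contract 1 (WeylEntropy.pull L S) = Lᵀ * contract g⁻¹ S * L := by
    rw [contract_one_pull, hginv]
  have htrace : (Lᵀ * contract g⁻¹ S * L).trace = (g⁻¹ * contract g⁻¹ S).trace := by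
    rw [Matrix.trace_mul_comm, ← Matrix.mul_assoc, ← hginv]
  refine pull_injective hL ?_
  rw [(hS.pull L).eq_kulkarniNomizu_one, hcontract, htrace, sub_eq_add_neg, ← neg_smul,
    sub_eq_add_neg, ← neg_smul, pull_add, pull_smul, pull_kulkarniNomizu, pull_kulkarniNomizu, hgL]

end HasRiemannSymmetries

end DimensionThree

section Block

@[simp] theorem block_zero_zero (a : ℝ) (b : Matrix (Fin 3) (Fin 3) ℝ) : block a b 0 0 = a := rfl

@[simp] theorem block_zero_succ (a : ℝ) (b : Matrix (Fin 3) (Fin 3) ℝ) (j : Fin 3) :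
    block a b 0 j.succ = 0 := rfl

@[simp] theorem block_succ_zero (a : ℝ) (b : Matrix (Fin 3) (Fin 3) ℝ) (i : Fin 3) :
    block a b i.succ 0 = 0 := rfl

@[simp] theorem block_succ_succ (a : ℝ) (b : Matrix (Fin 3) (Fin 3) ℝ) (i j : Fin 3) :
    block a b i.succ j.succ = b i j := rfl

theorem block_mul (a a' : ℝ) (b b' : Matrix (Fin 3) (Fin 3) ℝ) :
    block a b * block a' b' = block (a * a') (b * b') := by
  ext i j
  rw [Matrix.mul_apply, Fin.sum_univ_succ]
  cases i using Fin.cases <;> cases j using Fin.cases <;> simp [Matrix.mul_apply]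

theorem block_transpose (a : ℝ) (b : Matrix (Fin 3) (Fin 3) ℝ) :
    (block a b)ᵀ = block a bᵀ := by
  ext i j
  cases i using Fin.cases <;> cases j using Fin.cases <;> simp

theorem block_one : block 1 1 = 1 := by
  ext i j
  cases i using Fin.cases <;> cases j using Fin.cases <;>
    simp [Matrix.one_apply, Fin.succ_ne_zero, (Fin.succ_ne_zero _).symm]

theorem block_mul_block_inv {a : ℝ} {b : Matrix (Fin 3) (Fin 3) ℝ} (ha : a ≠ 0) (hb : b.det ≠ 0) :
    block a b * block a⁻¹ b⁻¹ = 1 := by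
  rw [block_mul, mul_inv_cancel₀ ha, Matrix.mul_nonsing_inv _ hb.isUnit, block_one]

theorem block_inv {a : ℝ} {b : Matrix (Fin 3) (Fin 3) ℝ} (ha : a ≠ 0) (hb : b.det ≠ 0) :
    (block a b)⁻¹ = block a⁻¹ b⁻¹ :=
  Matrix.inv_eq_right_inv (block_mul_block_inv ha hb)

theorem block_det_ne_zero {a : ℝ} {b : Matrix (Fin 3) (Fin 3) ℝ} (ha : a ≠ 0) (hb : b.det ≠ 0) :
    (block a b).det ≠ 0 :=
  (Matrix.isUnit_det_of_right_inverse (block_mul_block_inv ha hb)).ne_zero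

end Block

section Electric

variable {S : Fin 4 → Fin 4 → Fin 4 → Fin 4 → ℝ}

/-- The components `S_{Tijk}` of a `(0,4)`-tensor vanish: it has no magnetic part. -/
def IsPurelyElectric (S : Fin 4 → Fin 4 → Fin 4 → Fin 4 → ℝ) : Prop :=
  ∀ i j k : Fin 3, S 0 i.succ j.succ k.succ = 0

/-- The components `S_{TiTj}` of a `(0,4)`-tensor in a frame with lapse `n`. -/
def electricPart (n : ℝ) (S : Fin 4 → Fin 4 → Fin 4 → Fin 4 → ℝ) : Matrix (Fin 3) (Fin 3) ℝ :=
  Matrix.of fun i j => (n ^ 2)⁻¹ * S 0 i.succ 0 j.succ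

/-- The components `S_{ijkl}` of a `(0,4)`-tensor. -/
def spatialPart (S : Fin 4 → Fin 4 → Fin 4 → Fin 4 → ℝ) (i j k l : Fin 3) : ℝ :=
  S i.succ j.succ k.succ l.succ

/-- The contraction `g^{ik} S_{ijkl}` of the spatial part of a `(0,4)`-tensor. -/
def spatialRicci (g : Matrix (Fin 3) (Fin 3) ℝ) (S : Fin 4 → Fin 4 → Fin 4 → Fin 4 → ℝ) :
    Matrix (Fin 3) (Fin 3) ℝ :=
  contract g⁻¹ (spatialPart S)

theorem spatialPart_pull_block (a : ℝ) (L : Matrix (Fin 3) (Fin 3) ℝ)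
    (S : Fin 4 → Fin 4 → Fin 4 → Fin 4 → ℝ) :
    spatialPart (pull (block a L) S) = pull L (spatialPart S) := by
  ext i j k l
  simp [spatialPart, pull_apply, Fin.sum_univ_succ (n := 3)]

theorem electricPart_pull_block (n : ℝ) (L : Matrix (Fin 3) (Fin 3) ℝ)
    (S : Fin 4 → Fin 4 → Fin 4 → Fin 4 → ℝ) :
    electricPart 1 (pull (block n⁻¹ L) S) = Lᵀ * electricPart n S * L := by
  ext j l
  rw [transpose_mul_mul_apply]
  simp only [electricPart, Matrix.of_apply, pull_apply, Fin.sum_univ_succ (n := 3),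
    block_zero_zero, block_succ_zero, block_zero_succ, block_succ_succ, mul_zero, zero_mul,
    Finset.sum_const_zero, add_zero, zero_add]
  rw [one_pow, inv_one, one_mul]
  refine Fintype.sum_congr _ _ fun i => Fintype.sum_congr _ _ fun k => ?_
  ring

theorem IsPurelyElectric.pull_block (hS : IsPurelyElectric S) (a : ℝ)
    (L : Matrix (Fin 3) (Fin 3) ℝ) : IsPurelyElectric (pull (block a L) S) := by
  intro i j k
  simp [pull_apply, Fin.sum_univ_succ (n := 3), hS _ _ _]

theorem sum_sq_of_isPurelyElectric (hS : HasRiemannSymmetries S) (hE : IsPurelyElectric S) :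
    ∑ a, ∑ b, ∑ c, ∑ d, S a b c d ^ 2 = 4 * ∑ i, ∑ j, electricPart 1 S i j ^ 2
      + ∑ i, ∑ j, ∑ k, ∑ l, spatialPart S i j k l ^ 2 := by
  have hmixed (i j k : Fin 3) : S 0 i.succ j.succ k.succ ^ 2 = 0 := by rw [hE, sq, zero_mul]
  have hmixed₂ (i j k : Fin 3) : S i.succ 0 j.succ k.succ ^ 2 = 0 := by
    rw [hS.antisymm_left, neg_sq, hmixed]
  have hmixed₃ (i j k : Fin 3) : S j.succ k.succ 0 i.succ ^ 2 = 0 := by rw [hS.pair_symm, hmixed]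
  have hmixed₄ (i j k : Fin 3) : S j.succ k.succ i.succ 0 ^ 2 = 0 := by rw [hS.pair_symm, hmixed₂]
  have hleft (i j : Fin 3) : S i.succ 0 0 j.succ ^ 2 = S 0 i.succ 0 j.succ ^ 2 := by
    rw [hS.antisymm_left, neg_sq]
  have hright (i j : Fin 3) : S 0 i.succ j.succ 0 ^ 2 = S 0 i.succ 0 j.succ ^ 2 := by
    rw [hS.antisymm_right, neg_sq]
  have hboth (i j : Fin 3) : S i.succ 0 j.succ 0 ^ 2 = S 0 i.succ 0 j.succ ^ 2 := by
    rw [hS.antisymm_right, neg_sq, hleft]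
  simp only [Fin.sum_univ_succ (n := 3), hS.eq_zero_left, hS.eq_zero_right, hmixed, hmixed₂,
    hmixed₃, hmixed₄, hleft, hright, hboth, electricPart, spatialPart, Matrix.of_apply, one_pow,
    inv_one, one_mul, ne_eq, OfNat.ofNat_ne_zero, not_false_eq_true, zero_pow,
    Finset.sum_const_zero, add_zero, zero_add, Finset.sum_add_distrib]
  ring

theorem electricPart_isSymm (hS : HasRiemannSymmetries S) (n : ℝ) : (electricPart n S).IsSymm := by
  ext i j
  simp only [electricPart, Matrix.transpose_apply, Matrix.of_apply, hS.pair_symm 0 j.succ]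

theorem spatialPart_hasRiemannSymmetries (hS : HasRiemannSymmetries S) :
    HasRiemannSymmetries (spatialPart S) := hS.comp Fin.succ

theorem spatialRicci_isSymm (hS : HasRiemannSymmetries S) {g : Matrix (Fin 3) (Fin 3) ℝ}
    (hg : g.IsSymm) : (spatialRicci g S).IsSymm :=
  (spatialPart_hasRiemannSymmetries hS).contract_isSymm hg.inv

/-- In an orthonormal frame, the spatial part has squared norm `4 |Ric|² - s²`, and each of the
four arrangements of the two time indices contributes `|S_{TiTj}|²`. -/
theorem tensorNorm_of_isPurelyElectric (hS : HasRiemannSymmetries S) (hE : IsPurelyElectric S)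
    {n : ℝ} (hn : n ≠ 0) {g : Matrix (Fin 3) (Fin 3) ℝ} (hg : g.PosDef) :
    tensorNorm (block (n ^ 2) g) S = Real.sqrt
      (4 * ((g⁻¹ * electricPart n S) * (g⁻¹ * electricPart n S)).trace
        + (4 * ((g⁻¹ * spatialRicci g S) * (g⁻¹ * spatialRicci g S)).trace
          - (g⁻¹ * spatialRicci g S).trace ^ 2)) := by
  obtain ⟨L, -, hginv, -⟩ := exists_frame hg
  have hgsymm : g.IsSymm := hg.isHermitian
  have hframe : (block (n ^ 2) g)⁻¹ = block n⁻¹ L * (block n⁻¹ L)ᵀ := by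
    rw [block_inv (pow_ne_zero 2 hn) hg.det_pos.ne', block_transpose, block_mul, hginv, sq, mul_inv]
  have hnorm {A : Matrix (Fin 3) (Fin 3) ℝ} (hA : A.IsSymm) :
      ∑ i, ∑ j, (Lᵀ * A * L) i j ^ 2 = ((g⁻¹ * A) * (g⁻¹ * A)).trace := by
    have hsymm : (Lᵀ * A * L).IsSymm := by
      rw [Matrix.IsSymm, Matrix.transpose_mul, Matrix.transpose_mul, Matrix.transpose_transpose,
        hA.eq, Matrix.mul_assoc]
    rw [← trace_mul_transpose_self, hsymm.eq, hginv]
    simp only [Matrix.mul_assoc]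
    rw [Matrix.trace_mul_comm L]
    simp only [Matrix.mul_assoc]
  have htrace (A : Matrix (Fin 3) (Fin 3) ℝ) : (Lᵀ * A * L).trace = (g⁻¹ * A).trace := by
    rw [Matrix.trace_mul_comm, ← Matrix.mul_assoc, hginv]
  have hricci : contract 1 (pull L (spatialPart S)) = Lᵀ * spatialRicci g S * L := by
    rw [contract_one_pull, spatialRicci, hginv]
  rw [tensorNorm_eq_sqrt_sum_pull hframe,
    sum_sq_of_isPurelyElectric (hS.pull _) (hE.pull_block _ _), electricPart_pull_block,
    spatialPart_pull_block, ((spatialPart_hasRiemannSymmetries hS).pull L).sum_sq_eq, hricci,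
    hnorm (electricPart_isSymm hS n), hnorm (spatialRicci_isSymm hS hgsymm), htrace]

theorem eq_zero_iff_of_isPurelyElectric (hS : HasRiemannSymmetries S) (hE : IsPurelyElectric S)
    {n : ℝ} (hn : n ≠ 0) {g : Matrix (Fin 3) (Fin 3) ℝ} (hg : g.PosDef) :
    S = 0 ↔ electricPart n S = 0 ∧ spatialRicci g S = 0 := by
  constructor
  · rintro rfl
    constructor <;> ext <;> simp [electricPart, spatialRicci, spatialPart, contract]
  rintro ⟨helectric, hricci⟩
  have htime (i j : Fin 3) : S 0 i.succ 0 j.succ = 0 := by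
    simpa [electricPart, hn] using congrFun₂ helectric i j
  have hspace (i j k l : Fin 3) : S i.succ j.succ k.succ l.succ = 0 := by
    have h := (spatialPart_hasRiemannSymmetries hS).eq_kulkarniNomizu hg
    rw [← spatialRicci, hricci] at h
    simpa [spatialPart, kulkarniNomizu] using congrFun (congrFun₂ (congrFun h i) j k) l
  have hpair (i : Fin 3) (c d : Fin 4) : S 0 i.succ c d = 0 := by
    cases c using Fin.cases <;> cases d using Fin.cases
    · exact hS.eq_zero_right _ _ _
    · exact htime _ _
    · rw [hS.antisymm_right, htime, neg_zero]
    · exact hE _ _ _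
  have hpair' (i : Fin 3) (c d : Fin 4) : S i.succ 0 c d = 0 := by
    rw [hS.antisymm_left, hpair, neg_zero]
  ext a b c d
  cases a using Fin.cases <;> cases b using Fin.cases
  · exact hS.eq_zero_left _ _ _
  · exact hpair _ _ _
  · exact hpair' _ _ _
  · rw [hS.pair_symm]
    cases c using Fin.cases <;> cases d using Fin.cases
    · exact hS.eq_zero_left _ _ _
    · exact hpair _ _ _
    · exact hpair' _ _ _
    · exact hspace _ _ _ _

end Electric

section MetricCurvature

variable {Ω : Set (ℝ × E3)} {G : ℝ × E3 → Matrix (Fin 4) (Fin 4) ℝ} {p : ℝ × E3}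

theorem weyl_eq : weyl G p = riemann G p - (1 / 2 : ℝ) • kulkarniNomizu (ricci G p) (G p)
    + (scalar G p / 12) • kulkarniNomizu (G p) (G p) := by
  ext a b c d
  simp only [weyl, kulkarniNomizu, Pi.add_apply, Pi.sub_apply, Pi.smul_apply, smul_eq_mul]
  ring

namespace IsMetric

theorem riemannUp_eq (hG : IsMetric Ω G) (hp : p ∈ Ω) (a b c d : Fin 4) :
    riemannUp G a b c d p = ∑ e, (G p)⁻¹ a e * riemann G p e b c d := by
  simp only [riemann_eq_mul_curvMatrix]
  rw [← Matrix.mul_apply, Matrix.nonsing_inv_mul_cancel_left _ _ (hG.isUnit_det hp), curvMatrix,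
    Matrix.of_apply]

theorem hasRiemannSymmetries_riemann (hG : IsMetric Ω G) (hp : p ∈ Ω) :
    HasRiemannSymmetries (riemann G p) :=
  ⟨hG.riemann_antisymm_left hp, riemann_antisymm_right, hG.riemann_pair_symm hp⟩

theorem hasRiemannSymmetries_weyl (hG : IsMetric Ω G) (hp : p ∈ Ω)
    (hricci : Matrix.IsSymm (ricci G p)) : HasRiemannSymmetries (weyl G p) := by
  rw [weyl_eq, sub_eq_add_neg, ← neg_smul]
  exact ((hG.hasRiemannSymmetries_riemann hp).add
    ((hasRiemannSymmetries_kulkarniNomizu hricci (hG.symm p hp)).smul _)).add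
    ((hasRiemannSymmetries_kulkarniNomizu (hG.symm p hp) (hG.symm p hp)).smul _)

end IsMetric

end MetricCurvature

section Foliation

open scoped Topology

variable {Ω : Set (ℝ × E3)} {N : ℝ × E3 → ℝ} {g : ℝ × E3 → Matrix (Fin 3) (Fin 3) ℝ}
  {p : ℝ × E3}

/-- The mixed components `h^i_j` of the second fundamental form. -/
def shapeOp (N : ℝ × E3 → ℝ) (g : ℝ × E3 → Matrix (Fin 3) (Fin 3) ℝ) (p : ℝ × E3) :
    Matrix (Fin 3) (Fin 3) ℝ := (g p)⁻¹ * secondForm N g p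

/-- The mixed components of the contraction `g^{ik} R_{ijkl}` of the spatial part of the Riemann
tensor of the spacetime; this is not the Ricci tensor of the slice. -/
def spatialRicciOp (N : ℝ × E3 → ℝ) (g : ℝ × E3 → Matrix (Fin 3) (Fin 3) ℝ) (p : ℝ × E3) :
    Matrix (Fin 3) (Fin 3) ℝ := (g p)⁻¹ * spatialRicci (g p) (riemann (lorentz N g) p)

/-- The mixed components of the tidal tensor `R_{TiTj}`. -/
def tidalOp (N : ℝ × E3 → ℝ) (g : ℝ × E3 → Matrix (Fin 3) (Fin 3) ℝ) (p : ℝ × E3) :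
    Matrix (Fin 3) (Fin 3) ℝ := (g p)⁻¹ * electricPart (N p) (riemann (lorentz N g) p)

/-- The mixed components of the electric part `W_{TiTj}` of the Weyl tensor. -/
def weylElectricOp (N : ℝ × E3 → ℝ) (g : ℝ × E3 → Matrix (Fin 3) (Fin 3) ℝ) (p : ℝ × E3) :
    Matrix (Fin 3) (Fin 3) ℝ := (g p)⁻¹ * electricPart (N p) (weyl (lorentz N g) p)

/-- A smooth lapse and a smooth family of Riemannian metrics, in coordinates on an open set. -/
structure FoliatedChart (Ω : Set (ℝ × E3)) (N : ℝ × E3 → ℝ)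
    (g : ℝ × E3 → Matrix (Fin 3) (Fin 3) ℝ) : Prop where
  isOpen : IsOpen Ω
  lapse_smooth : ∀ q ∈ Ω, ContDiffAt ℝ ∞ N q
  metric_smooth : ∀ q ∈ Ω, SmoothEntriesAt g q
  lapse_pos : ∀ q ∈ Ω, 0 < N q
  metric_pos : ∀ q ∈ Ω, (g q).PosDef

namespace FoliatedChart

variable (h : FoliatedChart Ω N g) (hp : p ∈ Ω)
include h hp

theorem eventually_mem : ∀ᶠ q in 𝓝 p, q ∈ Ω := h.isOpen.eventually_mem hp

theorem lapse_ne_zero : N p ≠ 0 := (h.lapse_pos p hp).ne'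

theorem metric_symm : (g p).IsSymm := (h.metric_pos p hp).isHermitian

theorem metric_det_ne_zero : (g p).det ≠ 0 := (h.metric_pos p hp).det_pos.ne'

theorem metric_isUnit_det : IsUnit (g p).det := (h.metric_det_ne_zero hp).isUnit

omit hp in
theorem isMetric : IsMetric Ω (lorentz N g) where
  isOpen := h.isOpen
  smooth q hq a b := by
    cases a using Fin.cases <;> cases b using Fin.cases <;> simp only [lorentz, block_zero_zero,
      block_zero_succ, block_succ_zero, block_succ_succ]
    · exact ((h.lapse_smooth q hq).pow 2).neg
    · exact contDiffAt_const
    · exact contDiffAt_const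
    · exact h.metric_smooth q hq _ _
  symm q hq := by rw [Matrix.IsSymm, lorentz, block_transpose, (h.metric_symm hq).eq]
  det_ne q hq := block_det_ne_zero (neg_ne_zero.2 (pow_ne_zero 2 (h.lapse_ne_zero hq)))
    (h.metric_det_ne_zero hq)

theorem lorentz_inv : (lorentz N g p)⁻¹ = block (-(N p) ^ 2)⁻¹ (g p)⁻¹ :=
  block_inv (neg_ne_zero.2 (pow_ne_zero 2 (h.lapse_ne_zero hp))) (h.metric_det_ne_zero hp)

theorem hasRiemannSymmetries_riemann : HasRiemannSymmetries (riemann (lorentz N g) p) :=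
  h.isMetric.hasRiemannSymmetries_riemann hp

theorem pd_time_metric (i j : Fin 3) :
    pd 0 (fun q => g q i j) p = -(2 * N p) * secondForm N g p i j := by
  have hN := h.lapse_ne_zero hp
  rw [secondForm, Matrix.of_apply]
  field_simp

theorem pdM_time_metric : pdM 0 g p = -((2 * N p) • secondForm N g p) := by
  ext i j
  rw [pdM_apply, h.pd_time_metric hp, neg_mul]
  rfl

theorem secondForm_symm : (secondForm N g p).IsSymm := by
  ext i j
  rw [secondForm, Matrix.transpose_apply, Matrix.of_apply, Matrix.of_apply]
  exact congrArg _ (pd_congr ((h.eventually_mem hp).mono fun q hq => (h.metric_symm hq).apply i j))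

theorem metric_mul_shapeOp : g p * shapeOp N g p = secondForm N g p :=
  Matrix.mul_nonsing_inv_cancel_left _ _ (h.metric_isUnit_det hp)

theorem shapeOp_transpose : (shapeOp N g p)ᵀ = secondForm N g p * (g p)⁻¹ := by
  rw [shapeOp, Matrix.transpose_mul, (h.secondForm_symm hp).eq, (h.metric_symm hp).inv.eq]

theorem connMatrix_time (i j : Fin 3) :
    connMatrix (lorentz N g) 0 p i.succ j.succ = -N p * shapeOp N g p i j := by
  have hsymm (d : Fin 3) : pd 0 (fun q => g q j d) p = pd 0 (fun q => g q d j) p :=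
    pd_congr ((h.eventually_mem hp).mono fun q hq => (h.metric_symm hq).apply d j)
  rw [connMatrix, Matrix.of_apply, christoffel, h.lorentz_inv hp, Fin.sum_univ_succ]
  simp only [block_succ_zero, zero_mul, zero_add, block_succ_succ, block_zero_succ, pd_const,
    add_zero, sub_zero, lorentz, shapeOp, Matrix.mul_apply, Finset.mul_sum]
  refine Fintype.sum_congr _ _ fun d => ?_
  rw [hsymm, h.pd_time_metric hp]
  ring

theorem connMatrix_space_zero (k i : Fin 3) :
    connMatrix (lorentz N g) k.succ p i.succ 0 = -N p * shapeOp N g p i k := by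
  rw [← h.connMatrix_time hp]
  exact h.isMetric.christoffel_symm hp _ _ _

theorem connMatrix_zero_space (k j : Fin 3) :
    connMatrix (lorentz N g) k.succ p 0 j.succ = -(N p)⁻¹ * secondForm N g p k j := by
  have hN := h.lapse_ne_zero hp
  rw [connMatrix, Matrix.of_apply, christoffel, h.lorentz_inv hp, Fin.sum_univ_succ]
  simp only [block_zero_succ, zero_mul, Finset.sum_const_zero, add_zero, block_zero_zero,
    block_succ_zero, pd_const, zero_sub, lorentz, block_succ_succ, h.pd_time_metric hp]
  field_simp

theorem riemannUp_zero (b c d : Fin 4) :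
    riemannUp (lorentz N g) 0 b c d p = -((N p) ^ 2)⁻¹ * riemann (lorentz N g) p 0 b c d := by
  rw [h.isMetric.riemannUp_eq hp, h.lorentz_inv hp, Fin.sum_univ_succ]
  simp [inv_neg]

theorem riemannUp_succ (i : Fin 3) (b c d : Fin 4) :
    riemannUp (lorentz N g) i.succ b c d p =
      ∑ e : Fin 3, (g p)⁻¹ i e * riemann (lorentz N g) p e.succ b c d := by
  rw [h.isMetric.riemannUp_eq hp, h.lorentz_inv hp, Fin.sum_univ_succ]
  simp

theorem riemannUp_zero_zero (j l : Fin 3) :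
    riemannUp (lorentz N g) 0 j.succ 0 l.succ p =
      -electricPart (N p) (riemann (lorentz N g) p) j l := by
  rw [h.riemannUp_zero hp, electricPart, Matrix.of_apply, neg_mul]

theorem riemannUp_space_zero (i l : Fin 3) :
    riemannUp (lorentz N g) i.succ 0 l.succ 0 p = (N p) ^ 2 * tidalOp N g p i l := by
  have hN := h.lapse_ne_zero hp
  have hR := h.hasRiemannSymmetries_riemann hp
  rw [h.riemannUp_succ hp, tidalOp, Matrix.mul_apply, Finset.mul_sum]
  refine Fintype.sum_congr _ _ fun e => ?_
  rw [hR.antisymm_left, hR.antisymm_right, electricPart, Matrix.of_apply]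
  field_simp

theorem spatialRicci_riemann_apply (j l : Fin 3) :
    spatialRicci (g p) (riemann (lorentz N g) p) j l =
      ∑ i : Fin 3, riemannUp (lorentz N g) i.succ j.succ i.succ l.succ p := by
  simp only [h.riemannUp_succ hp, spatialRicci, contract, spatialPart, Matrix.of_apply]
  rw [Finset.sum_comm]
  simp only [(h.metric_symm hp).inv.apply]

theorem ricci_zero_zero : ricci (lorentz N g) p 0 0 = (N p) ^ 2 * (tidalOp N g p).trace := by
  have hzero : riemannUp (lorentz N g) 0 0 0 0 p = 0 := by
    rw [h.riemannUp_zero hp, (h.hasRiemannSymmetries_riemann hp).eq_zero_left, mul_zero]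
  rw [ricci, Fin.sum_univ_succ, hzero, zero_add, Matrix.trace, Finset.mul_sum]
  exact Fintype.sum_congr _ _ fun i => h.riemannUp_space_zero hp i i

theorem ricci_spatial (j l : Fin 3) : ricci (lorentz N g) p j.succ l.succ =
    spatialRicci (g p) (riemann (lorentz N g) p) j l
      - electricPart (N p) (riemann (lorentz N g) p) j l := by
  rw [ricci, Fin.sum_univ_succ, h.riemannUp_zero_zero hp, h.spatialRicci_riemann_apply hp]
  ring

theorem smooth_spatialRicci :
    SmoothEntriesAt (fun q => spatialRicci (g q) (riemann (lorentz N g) q)) p := by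
  intro j l
  have hsum : ContDiffAt ℝ ∞ (fun q => ∑ i : Fin 3,
      riemannUp (lorentz N g) i.succ j.succ i.succ l.succ q) p :=
    ContDiffAt.sum fun i _ => h.isMetric.smooth_curvMatrix hp i.succ l.succ i.succ j.succ
  exact hsum.congr_of_eventuallyEq
    ((h.eventually_mem hp).mono fun q hq => h.spatialRicci_riemann_apply hq j l)

theorem smooth_spatialRicciOp : SmoothEntriesAt (spatialRicciOp N g) p :=
  ((h.metric_smooth p hp).inv (h.metric_det_ne_zero hp)).mul (h.smooth_spatialRicci hp)

end FoliatedChart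

end Foliation

section Commutators

variable {A B : Matrix (Fin 4) (Fin 4) ℝ}

theorem commutator_apply_of_mixed_eq_zero (hrow : ∀ j : Fin 3, B 0 j.succ = 0)
    (hcol : ∀ i : Fin 3, B i.succ 0 = 0) (i j : Fin 3) :
    (A * B - B * A) i.succ j.succ = ∑ e : Fin 3, A i.succ e.succ * B e.succ j.succ
      - ∑ e : Fin 3, B i.succ e.succ * A e.succ j.succ := by
  simp [Matrix.mul_apply, Fin.sum_univ_succ (n := 3), hrow, hcol]

theorem commutator_apply_of_spatial_eq_zero (hspace : ∀ i j : Fin 3, B i.succ j.succ = 0)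
    (i j : Fin 3) :
    (A * B - B * A) i.succ j.succ = A i.succ 0 * B 0 j.succ - B i.succ 0 * A 0 j.succ := by
  simp [Matrix.mul_apply, Fin.sum_univ_succ (n := 3), hspace]

end Commutators

section ElectricEvolution

open scoped Topology

variable {Ω : Set (ℝ × E3)} {N : ℝ × E3 → ℝ} {g : ℝ × E3 → Matrix (Fin 3) (Fin 3) ℝ}
  {p : ℝ × E3}

namespace FoliatedChart

variable (h : FoliatedChart Ω N g) (hp : p ∈ Ω)
include h hp

theorem curvMatrix_space_space_zero_succ (hE : IsPurelyElectric (riemann (lorentz N g) p))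
    (k l j : Fin 3) : curvMatrix (lorentz N g) k.succ l.succ p 0 j.succ = 0 := by
  rw [curvMatrix, Matrix.of_apply, h.riemannUp_zero hp, hE, mul_zero]

theorem curvMatrix_space_space_succ_zero (hE : IsPurelyElectric (riemann (lorentz N g) p))
    (k l i : Fin 3) : curvMatrix (lorentz N g) k.succ l.succ p i.succ 0 = 0 := by
  rw [curvMatrix, Matrix.of_apply, h.riemannUp_succ hp]
  refine Finset.sum_eq_zero fun e _ => ?_
  rw [(h.hasRiemannSymmetries_riemann hp).antisymm_left, hE, neg_zero, mul_zero]

theorem curvMatrix_space_time_succ_succ (hE : IsPurelyElectric (riemann (lorentz N g) p))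
    (l i j : Fin 3) : curvMatrix (lorentz N g) l.succ 0 p i.succ j.succ = 0 := by
  have hR := h.hasRiemannSymmetries_riemann hp
  rw [curvMatrix, Matrix.of_apply, h.riemannUp_succ hp]
  refine Finset.sum_eq_zero fun e _ => ?_
  rw [hR.antisymm_right, hR.pair_symm, hE, neg_zero, mul_zero]

theorem curvMatrix_space_time_zero_succ (l j : Fin 3) :
    curvMatrix (lorentz N g) l.succ 0 p 0 j.succ =
      electricPart (N p) (riemann (lorentz N g) p) j l := by
  rw [curvMatrix_antisymm, Matrix.neg_apply, curvMatrix, Matrix.of_apply,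
    h.riemannUp_zero_zero hp, neg_neg]

theorem commutator_connMatrix_curvMatrix (hE : IsPurelyElectric (riemann (lorentz N g) p))
    (k l i j : Fin 3) :
    (connMatrix (lorentz N g) k.succ p * curvMatrix (lorentz N g) l.succ 0 p
      - curvMatrix (lorentz N g) l.succ 0 p * connMatrix (lorentz N g) k.succ p) i.succ j.succ =
    N p * (tidalOp N g p i l * secondForm N g p k j
      - shapeOp N g p i k * electricPart (N p) (riemann (lorentz N g) p) j l) := by
  have hN := h.lapse_ne_zero hp
  rw [commutator_apply_of_spatial_eq_zero (h.curvMatrix_space_time_succ_succ hp hE l),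
    h.connMatrix_space_zero hp, h.connMatrix_zero_space hp, h.curvMatrix_space_time_zero_succ hp,
    curvMatrix, Matrix.of_apply, h.riemannUp_space_zero hp]
  field_simp
  ring

/-- The spatial components of the second Bianchi identity for the directions `∂_k, ∂_l, ∂_t`;
the spatial derivatives drop out because they only see magnetic components. -/
theorem pd_time_riemannUp (hE : ∀ q ∈ Ω, IsPurelyElectric (riemann (lorentz N g) q))
    (i j k l : Fin 3) :
    pd 0 (riemannUp (lorentz N g) i.succ j.succ k.succ l.succ) p = N p *
      (∑ e, shapeOp N g p i e * riemannUp (lorentz N g) e.succ j.succ k.succ l.succ p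
        - ∑ e : Fin 3, riemannUp (lorentz N g) i.succ e.succ k.succ l.succ p * shapeOp N g p e j
        + (shapeOp N g p i k * electricPart (N p) (riemann (lorentz N g) p) j l
          - tidalOp N g p i l * secondForm N g p k j)
        - (shapeOp N g p i l * electricPart (N p) (riemann (lorentz N g) p) j k
          - tidalOp N g p i k * secondForm N g p l j)) := by
  have hmagnetic (a l : Fin 3) :
      pdM a.succ (curvMatrix (lorentz N g) l.succ 0) p i.succ j.succ = 0 := by
    rw [pdM_apply, pd_congr ((h.eventually_mem hp).mono fun q hq =>
      h.curvMatrix_space_time_succ_succ hq (hE q hq) l i j), pd_const]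
  have hmagnetic' :
      pdM l.succ (curvMatrix (lorentz N g) 0 k.succ) p i.succ j.succ = 0 := by
    rw [pdM_apply, pd_congr ((h.eventually_mem hp).mono fun q hq => by
      rw [curvMatrix_antisymm, Matrix.neg_apply,
        h.curvMatrix_space_time_succ_succ hq (hE q hq) k i j, neg_zero]), pd_const]
  have htime := commutator_apply_of_mixed_eq_zero (A := connMatrix (lorentz N g) 0 p)
    (h.curvMatrix_space_space_zero_succ hp (hE p hp) k l)
    (h.curvMatrix_space_space_succ_zero hp (hE p hp) k l) i j
  have hcomm (A B : Matrix (Fin 4) (Fin 4) ℝ) : A * -B - -B * A = -(A * B - B * A) := by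
    noncomm_ring
  have hbianchi := congrFun₂ (h.isMetric.second_bianchi hp k.succ l.succ 0) i.succ j.succ
  rw [curvMatrix_antisymm 0 k.succ p, hcomm] at hbianchi
  simp only [Matrix.add_apply, Matrix.neg_apply, Matrix.zero_apply, hmagnetic, hmagnetic', htime,
    h.commutator_connMatrix_curvMatrix hp (hE p hp), h.connMatrix_time hp, pdM_apply, mul_assoc,
    mul_left_comm _ (-N p), ← Finset.mul_sum] at hbianchi
  simp only [curvMatrix, Matrix.of_apply] at hbianchi
  linear_combination hbianchi

theorem shapeOp_mul_inv_isSymm : (shapeOp N g p * (g p)⁻¹).IsSymm := by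
  rw [Matrix.IsSymm, Matrix.transpose_mul, h.shapeOp_transpose hp, (h.metric_symm hp).inv.eq,
    shapeOp, Matrix.mul_assoc]

theorem sum_shapeOp_mul_riemannUp (j l : Fin 3) :
    ∑ i, ∑ e, shapeOp N g p i e * riemannUp (lorentz N g) e.succ j.succ i.succ l.succ p =
      contract (shapeOp N g p * (g p)⁻¹) (spatialPart (riemann (lorentz N g) p)) j l := by
  simp only [contract, Matrix.of_apply, h.riemannUp_succ hp]
  rw [Finset.sum_comm (f := fun i k => (shapeOp N g p * (g p)⁻¹) i k * _)]
  refine Fintype.sum_congr _ _ fun i => ?_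
  simp only [← (h.shapeOp_mul_inv_isSymm hp).apply _ i, Matrix.mul_apply, Finset.mul_sum,
    Finset.sum_mul, ← mul_assoc]
  exact Finset.sum_comm

theorem contract_shapeOp_mul_inv :
    contract (shapeOp N g p * (g p)⁻¹) (spatialPart (riemann (lorentz N g) p)) =
      (shapeOp N g p * spatialRicciOp N g p).trace • g p
        + (shapeOp N g p).trace • spatialRicci (g p) (riemann (lorentz N g) p)
        - secondForm N g p * spatialRicciOp N g p
        - spatialRicci (g p) (riemann (lorentz N g) p) * shapeOp N g p
        - ((spatialRicciOp N g p).trace / 2) •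
          ((shapeOp N g p).trace • g p - secondForm N g p) := by
  have hu := h.metric_isUnit_det hp
  have hP := spatialRicci_isSymm (h.hasRiemannSymmetries_riemann hp) (h.metric_symm hp)
  have hKg : shapeOp N g p * (g p)⁻¹ * g p = shapeOp N g p :=
    Matrix.nonsing_inv_mul_cancel_right _ _ hu
  have hKP : shapeOp N g p * (g p)⁻¹ * spatialRicci (g p) (riemann (lorentz N g) p) =
      shapeOp N g p * spatialRicciOp N g p := Matrix.mul_assoc _ _ _
  have hgKP : g p * (shapeOp N g p * (g p)⁻¹) * spatialRicci (g p) (riemann (lorentz N g) p) =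
      secondForm N g p * spatialRicciOp N g p := by
    rw [Matrix.mul_assoc, hKP, ← Matrix.mul_assoc, h.metric_mul_shapeOp hp]
  have hRicci : contract (g p)⁻¹ (spatialPart (riemann (lorentz N g) p)) =
    spatialRicci (g p) (riemann (lorentz N g) p) := rfl
  have hRicciOp : (g p)⁻¹ * spatialRicci (g p) (riemann (lorentz N g) p) =
    spatialRicciOp N g p := rfl
  conv_lhs => rw [(spatialPart_hasRiemannSymmetries
    (h.hasRiemannSymmetries_riemann hp)).eq_kulkarniNomizu (h.metric_pos p hp)]
  rw [hRicci, hRicciOp, contract_sub, contract_smul, contract_kulkarniNomizu,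
    contract_kulkarniNomizu, (h.shapeOp_mul_inv_isSymm hp).eq, hP.eq, (h.metric_symm hp).eq,
    Matrix.mul_assoc _ (_ * _) (g p), Matrix.mul_assoc (g p) (_ * _) (g p), hKg, hKP, hgKP,
    h.metric_mul_shapeOp hp]
  module

theorem pdM_spatialRicci (hE : ∀ q ∈ Ω, IsPurelyElectric (riemann (lorentz N g) q)) :
    pdM 0 (fun q => spatialRicci (g q) (riemann (lorentz N g) q)) p = N p •
      (contract (shapeOp N g p * (g p)⁻¹) (spatialPart (riemann (lorentz N g) p))
        - (shapeOp N g p)ᵀ * spatialRicci (g p) (riemann (lorentz N g) p)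
        + (shapeOp N g p).trace • electricPart (N p) (riemann (lorentz N g) p)
        - secondForm N g p * tidalOp N g p
        - electricPart (N p) (riemann (lorentz N g) p) * shapeOp N g p
        + (tidalOp N g p).trace • secondForm N g p) := by
  ext j l
  have hK := h.secondForm_symm hp
  have hsum : pdM 0 (fun q => spatialRicci (g q) (riemann (lorentz N g) q)) p j l =
      ∑ i : Fin 3, pd 0 (riemannUp (lorentz N g) i.succ j.succ i.succ l.succ) p := by
    rw [pdM_apply, pd_congr ((h.eventually_mem hp).mono fun q hq =>
      h.spatialRicci_riemann_apply hq j l)]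
    exact pd_sum fun i _ =>
      (h.isMetric.smooth_curvMatrix hp i.succ l.succ).differentiableAt i.succ j.succ
  rw [hsum]
  simp only [h.pd_time_riemannUp hp hE, ← Finset.mul_sum, Finset.sum_add_distrib,
    Finset.sum_sub_distrib, h.sum_shapeOp_mul_riemannUp hp, Matrix.smul_apply, Matrix.add_apply,
    Matrix.sub_apply, smul_eq_mul, Matrix.mul_apply, Matrix.transpose_apply,
    h.spatialRicci_riemann_apply hp, Matrix.trace, Matrix.diag_apply, ← Finset.sum_mul]
  rw [Finset.sum_comm (f := fun i e => riemannUp _ _ _ _ _ p * _), hK.apply j l]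
  simp only [Finset.sum_mul, hK.apply _ j, mul_comm (tidalOp N g p _ l),
    mul_comm (shapeOp N g p _ l), mul_comm (shapeOp N g p _ j)]
  ring

theorem pdM_spatialRicciOp (hE : ∀ q ∈ Ω, IsPurelyElectric (riemann (lorentz N g) q)) :
    pdM 0 (spatialRicciOp N g) p = N p •
      ((shapeOp N g p * spatialRicciOp N g p).trace • 1
        + (shapeOp N g p).trace • spatialRicciOp N g p - spatialRicciOp N g p * shapeOp N g p
        - ((spatialRicciOp N g p).trace / 2) • ((shapeOp N g p).trace • 1 - shapeOp N g p)
        + (shapeOp N g p).trace • tidalOp N g p - shapeOp N g p * tidalOp N g p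
        - tidalOp N g p * shapeOp N g p + (tidalOp N g p).trace • shapeOp N g p) := by
  have hdet := h.metric_det_ne_zero hp
  have hinv : pdM 0 (fun q => (g q)⁻¹) p = (2 * N p) • (shapeOp N g p * (g p)⁻¹) := by
    rw [pdM_inv (h.metric_smooth p hp) hdet, h.pdM_time_metric hp, Matrix.mul_neg, Matrix.neg_mul,
      neg_neg, Matrix.mul_smul, Matrix.smul_mul, shapeOp]
  have hmul : pdM 0 (spatialRicciOp N g) p =
      pdM 0 (fun q => (g q)⁻¹) p * spatialRicci (g p) (riemann (lorentz N g) p)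
        + (g p)⁻¹ * pdM 0 (fun q => spatialRicci (g q) (riemann (lorentz N g) q)) p :=
    pdM_mul ((h.metric_smooth p hp).inv hdet).differentiableAt
      (h.smooth_spatialRicci hp).differentiableAt
  have hginv : (g p)⁻¹ * g p = 1 := Matrix.nonsing_inv_mul _ (h.metric_isUnit_det hp)
  have hshape : (g p)⁻¹ * secondForm N g p = shapeOp N g p := rfl
  have hRicci : (g p)⁻¹ * spatialRicci (g p) (riemann (lorentz N g) p) =
    spatialRicciOp N g p := rfl
  have htidal : (g p)⁻¹ * electricPart (N p) (riemann (lorentz N g) p) = tidalOp N g p := rfl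
  rw [hmul, hinv, h.pdM_spatialRicci hp hE, h.contract_shapeOp_mul_inv hp, h.shapeOp_transpose hp]
  simp only [Matrix.mul_add, Matrix.mul_sub, Matrix.mul_smul, Matrix.smul_mul,
    Matrix.mul_assoc, hRicci, ← Matrix.mul_assoc (g p)⁻¹, hginv, hshape, htidal]
  module

end FoliatedChart

end ElectricEvolution

section PerfectFluid

open scoped Topology

/-- A perfect fluid electric region with density `m` and pressure `(k - 1) m`, in coordinates on
an open set. -/
structure FluidChart (Ω : Set (ℝ × E3)) (N : ℝ × E3 → ℝ)
    (g : ℝ × E3 → Matrix (Fin 3) (Fin 3) ℝ) (m k : ℝ × E3 → ℝ) : Prop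
    extends FoliatedChart Ω N g where
  einstein_eq : ∀ q ∈ Ω, ∀ a b,
    einstein (lorentz N g) q a b = fluidStress N g (m q) ((k q - 1) * m q) q a b
  electric : ∀ q ∈ Ω, IsPurelyElectric (weyl (lorentz N g) q)

variable {Ω : Set (ℝ × E3)} {N : ℝ × E3 → ℝ} {g : ℝ × E3 → Matrix (Fin 3) (Fin 3) ℝ}
  {m k : ℝ × E3 → ℝ} {p : ℝ × E3}

theorem sum_inv_mul_self {ι : Type*} [Fintype ι] [DecidableEq ι] {A : Matrix ι ι ℝ}
    (hA : A.IsSymm) (hdet : IsUnit A.det) : ∑ a, ∑ b, A⁻¹ a b * A a b = Fintype.card ι := by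
  rw [← Matrix.trace_one (n := ι) (R := ℝ), ← Matrix.nonsing_inv_mul A hdet]
  simp only [Matrix.trace, Matrix.diag_apply, Matrix.mul_apply, hA.apply]

theorem pd_trace {ι : Type*} [Fintype ι] {F : ℝ × E3 → Matrix ι ι ℝ} {μ : Fin 4}
    (hF : ∀ i j, DifferentiableAt ℝ (fun q => F q i j) p) :
    pd μ (fun q => (F q).trace) p = (pdM μ F p).trace :=
  pd_sum fun i _ => hF i i

/-- The traceless part of a `3 × 3` matrix. -/
def tracelessPart (K : Matrix (Fin 3) (Fin 3) ℝ) : Matrix (Fin 3) (Fin 3) ℝ :=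
  K - (K.trace / 3) • 1

namespace FluidChart

variable (h : FluidChart Ω N g m k) (hp : p ∈ Ω)
include h hp

theorem scalar_eq : scalar (lorentz N g) p = (4 - 3 * k p) * m p := by
  have hN := h.lapse_ne_zero hp
  have hG : ∑ a, ∑ b, (lorentz N g p)⁻¹ a b * lorentz N g p a b = 4 := by
    rw [sum_inv_mul_self (h.isMetric.symm p hp) (h.isMetric.isUnit_det hp)]
    norm_num
  have hg : ∑ i, ∑ j, (g p)⁻¹ i j * g p i j = 3 := by
    rw [sum_inv_mul_self (h.metric_symm hp) (h.metric_isUnit_det hp)]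
    norm_num
  have htrace : ∑ a, ∑ b, (lorentz N g p)⁻¹ a b * einstein (lorentz N g) p a b =
      scalar (lorentz N g) p - (1 / 2) * scalar (lorentz N g) p * 4 := by
    simp only [← hG, einstein, mul_sub, Finset.sum_sub_distrib, scalar, Finset.mul_sum,
      mul_left_comm]
  have hstress : ∑ a, ∑ b, (lorentz N g p)⁻¹ a b * einstein (lorentz N g) p a b =
      -m p + (k p - 1) * m p * 3 := by
    rw [← hg]
    simp only [h.einstein_eq p hp, h.lorentz_inv hp, fluidStress, Fin.sum_univ_succ (n := 3),
      block_zero_zero, block_zero_succ, block_succ_zero, block_succ_succ, zero_mul,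
      Finset.sum_const_zero, add_zero, zero_add, Matrix.smul_apply, smul_eq_mul, Finset.mul_sum,
      mul_left_comm _ ((k p - 1) * m p)]
    field_simp
  linarith

theorem ricci_eq : ricci (lorentz N g) p =
    block ((N p) ^ 2 * ((3 * k p - 2) / 2 * m p)) (((2 - k p) / 2 * m p) • g p) := by
  ext a b
  have heinstein := h.einstein_eq p hp a b
  rw [einstein, h.scalar_eq hp, sub_eq_iff_eq_add] at heinstein
  rw [heinstein]
  cases a using Fin.cases <;> cases b using Fin.cases <;> simp [fluidStress, lorentz] <;> ring

theorem hasRiemannSymmetries_weyl : HasRiemannSymmetries (weyl (lorentz N g) p) := by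
  refine h.isMetric.hasRiemannSymmetries_weyl hp ?_
  rw [h.ricci_eq hp, Matrix.IsSymm, block_transpose, Matrix.transpose_smul, (h.metric_symm hp).eq]

theorem isPurelyElectric_riemann : IsPurelyElectric (riemann (lorentz N g) p) := by
  intro i j l
  simpa [weyl, h.ricci_eq hp, lorentz] using h.electric p hp i j l

theorem electricPart_riemann : electricPart (N p) (riemann (lorentz N g) p) =
    electricPart (N p) (weyl (lorentz N g) p) + ((3 * k p - 2) / 6 * m p) • g p := by
  have hN := h.lapse_ne_zero hp
  ext i j
  simp only [electricPart, Matrix.add_apply, Matrix.smul_apply, Matrix.of_apply, weyl,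
    h.ricci_eq hp, h.scalar_eq hp, lorentz, block_zero_zero, block_zero_succ, block_succ_zero,
    block_succ_succ, smul_eq_mul]
  field_simp
  ring

theorem spatialPart_weyl : spatialPart (weyl (lorentz N g) p) =
    spatialPart (riemann (lorentz N g) p) - (m p / 6) • kulkarniNomizu (g p) (g p) := by
  ext i j k l
  simp only [spatialPart, weyl, h.ricci_eq hp, h.scalar_eq hp, lorentz, block_succ_succ,
    kulkarniNomizu, Matrix.smul_apply, Pi.sub_apply, Pi.smul_apply, smul_eq_mul]
  ring

theorem spatialRicci_riemann : spatialRicci (g p) (riemann (lorentz N g) p) =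
    electricPart (N p) (weyl (lorentz N g) p) + (2 / 3 * m p) • g p := by
  ext j l
  have hricci := h.ricci_spatial hp j l
  rw [h.ricci_eq hp, block_succ_succ, h.electricPart_riemann hp] at hricci
  simp only [Matrix.add_apply, Matrix.smul_apply, smul_eq_mul] at hricci ⊢
  linear_combination -hricci

theorem spatialRicci_weyl : spatialRicci (g p) (weyl (lorentz N g) p) =
    electricPart (N p) (weyl (lorentz N g) p) := by
  rw [spatialRicci, h.spatialPart_weyl hp, contract_sub, contract_smul,
    contract_inv_kulkarniNomizu_self (h.metric_symm hp) (h.metric_isUnit_det hp), ← spatialRicci,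
    h.spatialRicci_riemann hp, Fintype.card_fin]
  module

theorem tidalOp_eq : tidalOp N g p = weylElectricOp N g p + ((3 * k p - 2) / 6 * m p) • 1 := by
  rw [tidalOp, h.electricPart_riemann hp, Matrix.mul_add, Matrix.mul_smul,
    Matrix.nonsing_inv_mul _ (h.metric_isUnit_det hp), weylElectricOp]

theorem spatialRicciOp_eq : spatialRicciOp N g p = weylElectricOp N g p + (2 / 3 * m p) • 1 := by
  rw [spatialRicciOp, h.spatialRicci_riemann hp, Matrix.mul_add, Matrix.mul_smul,
    Matrix.nonsing_inv_mul _ (h.metric_isUnit_det hp), weylElectricOp]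

theorem trace_weylElectricOp : (weylElectricOp N g p).trace = 0 := by
  have hricci := h.ricci_zero_zero hp
  rw [h.ricci_eq hp, block_zero_zero, h.tidalOp_eq hp, Matrix.trace_add, Matrix.trace_smul,
    Matrix.trace_one, Fintype.card_fin, smul_eq_mul] at hricci
  have := mul_left_cancel₀ (pow_ne_zero 2 (h.lapse_ne_zero hp)) hricci
  norm_num at this
  linarith

theorem density_eq : m p = (1 / 2) * (spatialRicciOp N g p).trace := by
  rw [h.spatialRicciOp_eq hp, Matrix.trace_add, h.trace_weylElectricOp hp, Matrix.trace_smul,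
    Matrix.trace_one, Fintype.card_fin, smul_eq_mul]
  push_cast
  ring

theorem pdM_spatialRicciOp : pdM 0 (spatialRicciOp N g) p = N p •
    ((shapeOp N g p * weylElectricOp N g p).trace • 1
      + (2 * (shapeOp N g p).trace) • weylElectricOp N g p
      - (2 : ℝ) • (weylElectricOp N g p * shapeOp N g p) - shapeOp N g p * weylElectricOp N g p
      + (k p * m p / 2) • (shapeOp N g p + (shapeOp N g p).trace • 1)) := by
  rw [h.toFoliatedChart.pdM_spatialRicciOp hp fun q hq => h.isPurelyElectric_riemann hq,
    h.tidalOp_eq hp, h.spatialRicciOp_eq hp]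
  simp only [Matrix.mul_add, Matrix.add_mul, Matrix.mul_smul, Matrix.smul_mul, Matrix.mul_one,
    Matrix.one_mul, Matrix.trace_add, Matrix.trace_smul, Matrix.trace_one,
    h.trace_weylElectricOp hp, smul_eq_mul, Fintype.card_fin, zero_add]
  push_cast
  module

theorem pd_density : pd 0 m p = N p * (k p * m p * (shapeOp N g p).trace) := by
  have hQ := (h.smooth_spatialRicciOp hp).differentiableAt
  have htrace : DifferentiableAt ℝ (fun q => (spatialRicciOp N g q).trace) p :=
    DifferentiableAt.fun_sum fun i _ => hQ i i
  rw [pd_congr ((h.eventually_mem hp).mono fun q hq => h.density_eq hq),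
    pd_mul (differentiableAt_const _) htrace, pd_const, pd_trace hQ, h.pdM_spatialRicciOp hp]
  simp only [Matrix.trace_smul, Matrix.trace_add, Matrix.trace_sub, Matrix.trace_one,
    h.trace_weylElectricOp hp, Matrix.trace_mul_comm (weylElectricOp N g p), smul_eq_mul,
    Fintype.card_fin]
  push_cast
  ring

theorem contDiffAt_density : ContDiffAt ℝ ∞ m p := by
  have hQ := h.smooth_spatialRicciOp hp
  have hsmooth : ContDiffAt ℝ ∞ (fun q => 1 / 2 * (spatialRicciOp N g q).trace) p :=
    contDiffAt_const.mul (ContDiffAt.sum fun i _ => hQ i i)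
  exact hsmooth.congr_of_eventuallyEq ((h.eventually_mem hp).mono fun q hq => h.density_eq hq)

theorem pdM_weylElectricOp : pdM 0 (weylElectricOp N g) p = N p •
    ((shapeOp N g p * weylElectricOp N g p).trace • 1
      + (2 * (shapeOp N g p).trace) • weylElectricOp N g p
      - (2 : ℝ) • (weylElectricOp N g p * shapeOp N g p) - shapeOp N g p * weylElectricOp N g p
      + (k p * m p / 2) • tracelessPart (shapeOp N g p)) := by
  have hm := (h.contDiffAt_density hp).differentiableAt (by simp)
  have hscalar (i j : Fin 3) :
      DifferentiableAt ℝ (fun q => ((2 / 3 * m q) • (1 : Matrix (Fin 3) (Fin 3) ℝ)) i j) p :=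
    (hm.const_mul _).mul_const _
  have htraceless : weylElectricOp N g =ᶠ[𝓝 p] fun q => spatialRicciOp N g q
      - (2 / 3 * m q) • 1 :=
    (h.eventually_mem hp).mono fun q hq => eq_sub_of_add_eq (h.spatialRicciOp_eq hq).symm
  have hpd : pdM 0 (fun q => (2 / 3 * m q) • (1 : Matrix (Fin 3) (Fin 3) ℝ)) p =
      (2 / 3 * pd 0 m p) • 1 := by
    ext i j
    simp only [pdM_apply, Matrix.smul_apply, smul_eq_mul]
    rw [pd_mul (hm.const_mul _) (differentiableAt_const _), pd_mul (differentiableAt_const _) hm,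
      pd_const, pd_const]
    ring
  rw [pdM_congr htraceless, pdM_sub (h.smooth_spatialRicciOp hp).differentiableAt hscalar, hpd,
    h.pd_density hp, h.pdM_spatialRicciOp hp, tracelessPart]
  module

end FluidChart

end PerfectFluid

section Calculus

open scoped Topology

/-- `f` has right derivative `r` and left derivative `l` at `t`. -/
def HasOneSidedDerivs (f : ℝ → ℝ) (r l t : ℝ) : Prop :=
  HasDerivWithinAt f r (Set.Ici t) t ∧ HasDerivWithinAt f l (Set.Iic t) t

variable {f f₁ : ℝ → ℝ} {a b r l t : ℝ}

theorem hasOneSidedDerivs_of_hasDerivAt (h : HasDerivAt f a t) : HasOneSidedDerivs f a a t :=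
  ⟨h.hasDerivWithinAt, h.hasDerivWithinAt⟩

namespace HasOneSidedDerivs

theorem hasDerivAt (h : HasOneSidedDerivs f a a t) : HasDerivAt f a t := by
  rw [← hasDerivWithinAt_univ, ← Set.Iic_union_Ici (a := t)]
  exact h.2.union h.1

theorem right_eq_deriv (h : HasOneSidedDerivs f r l t) (hf : DifferentiableAt ℝ f t) :
    r = deriv f t :=
  (uniqueDiffWithinAt_Ici t).eq_deriv _ h.1 hf.hasDerivAt.hasDerivWithinAt

theorem left_eq_deriv (h : HasOneSidedDerivs f r l t) (hf : DifferentiableAt ℝ f t) :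
    l = deriv f t :=
  (uniqueDiffWithinAt_Iic t).eq_deriv _ h.2 hf.hasDerivAt.hasDerivWithinAt

theorem hasDerivAt_zero_iff (h : HasOneSidedDerivs f r l t) :
    (DifferentiableAt ℝ f t ∧ deriv f t = 0) ↔ r = 0 ∧ l = 0 := by
  refine ⟨fun ⟨hf, h0⟩ => ⟨?_, ?_⟩, ?_⟩
  · rw [h.right_eq_deriv hf, h0]
  · rw [h.left_eq_deriv hf, h0]
  · rintro ⟨rfl, rfl⟩
    exact ⟨h.hasDerivAt.differentiableAt, h.hasDerivAt.deriv⟩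

theorem continuousAt (h : HasOneSidedDerivs f r l t) : ContinuousAt f t := by
  rw [← continuousWithinAt_univ, ← Set.Iic_union_Ici (a := t)]
  exact h.2.continuousWithinAt.union h.1.continuousWithinAt

theorem congr_of_eventuallyEq (h : HasOneSidedDerivs f r l t) (hf : f₁ =ᶠ[𝓝 t] f) :
    HasOneSidedDerivs f₁ r l t :=
  ⟨h.1.congr_of_eventuallyEq (hf.filter_mono nhdsWithin_le_nhds) hf.eq_of_nhds,
    h.2.congr_of_eventuallyEq (hf.filter_mono nhdsWithin_le_nhds) hf.eq_of_nhds⟩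

end HasOneSidedDerivs

theorem monotoneOn_of_one_sided_derivs {I : Set ℝ} (hI : I.OrdConnected)
    (h : ∀ t ∈ I, ∃ r l, HasOneSidedDerivs f r l t ∧ 0 ≤ r) : MonotoneOn f I := by
  choose! r l hf hr using h
  intro a ha b hb hab
  have hsub : Set.Icc a b ⊆ I := hI.out ha hb
  exact image_le_of_deriv_right_le_deriv_boundary (f := fun _ => f a) (f' := fun _ => 0)
    continuousOn_const (fun _ _ => hasDerivWithinAt_const _ _ _) le_rfl
    (fun s hs => (hf s (hsub hs)).continuousAt.continuousWithinAt)
    (fun s hs => (hf s (hsub (Set.Ico_subset_Icc_self hs))).1)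
    (fun s hs => hr s (hsub (Set.Ico_subset_Icc_self hs))) (Set.right_mem_Icc.2 hab)

theorem eventually_eq_zero_of_linear_ode {c : ℝ → ℝ} (hc : ContinuousAt c t)
    (hf : ∀ᶠ s in 𝓝 t, HasDerivAt f (c s * f s) s) (h0 : f t = 0) :
    ∀ᶠ s in 𝓝 t, f s = 0 := by
  have hb : ∀ᶠ s in 𝓝 t, |c s| < |c t| + 1 := hc.abs.eventually_lt_const (lt_add_one _)
  refine ODE_solution_unique_of_eventually (v := fun s x => c s * x) (s := fun _ => Set.univ)
    (g := fun _ => 0) (K := Real.toNNReal (|c t| + 1)) ?_ ?_ ?_ h0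
  · filter_upwards [hb] with s hs
    refine LipschitzOnWith.of_dist_le_mul fun x _ y _ => ?_
    rw [Real.dist_eq, Real.dist_eq, ← mul_sub, abs_mul, Real.coe_toNNReal _ (by positivity)]
    gcongr
  · filter_upwards [hf] with s hs using ⟨hs, trivial⟩
  · exact .of_forall fun s => ⟨by simpa using hasDerivAt_const s (0 : ℝ), trivial⟩

theorem deriv_eventually_eq_zero_left (hf : DifferentiableAt ℝ f t) (h0 : f =ᶠ[𝓝[≤] t] 0) :
    deriv f =ᶠ[𝓝[≤] t] 0 := by
  have hlt : deriv f =ᶠ[𝓝[<] t] 0 := by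
    filter_upwards [eventually_eventually_nhdsWithin.2
      (h0.filter_mono (nhdsWithin_mono _ Set.Iio_subset_Iic_self)), self_mem_nhdsWithin]
      with s hs hst
    rw [isOpen_Iio.nhdsWithin_eq hst] at hs
    simpa using Filter.EventuallyEq.deriv_eq hs
  have hself : deriv f t = 0 :=
    (uniqueDiffWithinAt_Iic t).eq_deriv _ hf.hasDerivAt.hasDerivWithinAt
      ((hasDerivWithinAt_const t _ (0 : ℝ)).congr_of_eventuallyEq h0
        (h0.eq_of_nhdsWithin Set.self_mem_Iic))
  rw [← Set.Iio_insert, nhdsWithin_insert]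
  exact Filter.eventually_sup.2 ⟨hself, hlt⟩

theorem sub_isLittleO_sq (hf : ∀ᶠ s in 𝓝 t, DifferentiableAt ℝ f s)
    (h0 : deriv f t = 0) (hd : HasDerivAt (deriv f) 0 t) :
    (fun s => f s - f t) =o[𝓝 t] fun s => (s - t) ^ 2 := by
  have hd' : deriv f =o[𝓝 t] fun s => s - t := by
    simpa [h0] using hasDerivAt_iff_isLittleO.1 hd
  refine Asymptotics.isLittleO_iff.2 fun c hc => ?_
  obtain ⟨δ, hδ, hball⟩ := Metric.eventually_nhds_iff_ball.1
    (hf.and (Asymptotics.isLittleO_iff.1 hd' hc))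
  filter_upwards [Metric.ball_mem_nhds t hδ] with s hs
  have hsub : Metric.closedBall t |s - t| ⊆ Metric.ball t δ :=
    Metric.closedBall_subset_ball (by simpa [Real.dist_eq] using hs)
  have hmvt := (convex_closedBall t |s - t|).norm_image_sub_le_of_norm_deriv_le
    (C := c * |s - t|) (x := t) (y := s) (fun r hr => (hball r (hsub hr)).1)
    (fun r hr => ((hball r (hsub hr)).2).trans ?_)
    (Metric.mem_closedBall_self (abs_nonneg _)) (by simp [Real.dist_eq])
  · simpa [pow_two, mul_assoc] using hmvt
  · have : |r - t| ≤ |s - t| := by simpa [Real.dist_eq] using hr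
    rw [Real.norm_eq_abs (r - t)]
    gcongr

theorem hasDerivAt_sqrt_of_isLittleO_sq (h0 : f t = 0)
    (hf : f =o[𝓝 t] fun s => (s - t) ^ 2) : HasDerivAt (fun s => √(f s)) 0 t := by
  rw [hasDerivAt_iff_isLittleO]
  simp only [h0, Real.sqrt_zero, sub_zero, smul_zero]
  refine Asymptotics.isLittleO_iff.2 fun c hc => ?_
  filter_upwards [Asymptotics.isLittleO_iff.1 hf (pow_pos hc 2)] with s hs
  rw [Real.norm_of_nonneg (Real.sqrt_nonneg _), Real.norm_eq_abs]
  refine Real.sqrt_le_iff.2 ⟨by positivity, (le_abs_self _).trans ?_⟩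
  rwa [Real.norm_eq_abs, norm_pow, Real.norm_eq_abs, ← mul_pow] at hs

theorem hasDerivAt_sqrt_of_deriv_nonneg (hf : ContDiffAt ℝ 2 f t)
    (hd : ∀ᶠ s in 𝓝 t, 0 ≤ deriv f s) (hn : ∀ᶠ s in 𝓝 t, 0 ≤ f s) (h0 : f t = 0) :
    HasDerivAt (fun s => √(f s)) 0 t := by
  have hdiff : ∀ᶠ s in 𝓝 t, DifferentiableAt ℝ f s :=
    (hf.eventually (by simp)).mono fun s hs => hs.differentiableAt (by simp)
  have hleft : f =ᶠ[𝓝[≤] t] 0 := by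
    obtain ⟨ε, hε, hball⟩ := Metric.eventually_nhds_iff_ball.1 (hdiff.and (hd.and hn))
    have hmono : MonotoneOn f (Metric.ball t ε) :=
      monotoneOn_of_deriv_nonneg (convex_ball t ε)
        (fun s hs => (hball s hs).1.continuousAt.continuousWithinAt)
        (fun s hs => (hball s (interior_subset hs)).1.differentiableWithinAt)
        fun s hs => (hball s (interior_subset hs)).2.1
    filter_upwards [mem_nhdsWithin_of_mem_nhds (Metric.ball_mem_nhds t hε), self_mem_nhdsWithin]
      with s hs hst
    exact le_antisymm ((hmono hs (Metric.mem_ball_self hε) hst).trans_eq h0) (hball s hs).2.2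
  have hdleft := deriv_eventually_eq_zero_left hdiff.self_of_nhds hleft
  have hddiff : DifferentiableAt ℝ (deriv f) t :=
    (((hf.fderiv_right (m := 1) (by norm_num)).differentiableAt (by simp)).clm_apply
      (differentiableAt_const (1 : ℝ))).congr_of_eventuallyEq (.of_forall fun _ => rfl)
  have hdd : deriv (deriv f) t = 0 :=
    (deriv_eventually_eq_zero_left hddiff hdleft).eq_of_nhdsWithin Set.self_mem_Iic
  have hsmall := sub_isLittleO_sq hdiff (hdleft.eq_of_nhdsWithin Set.self_mem_Iic)
    (hdd ▸ hddiff.hasDerivAt)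
  simp only [h0, sub_zero] at hsmall
  exact hasDerivAt_sqrt_of_isLittleO_sq h0 hsmall

theorem hasDerivAt_sqrt_div_sqrt_add {w : ℝ → ℝ} {f' w' : ℝ} (hf : HasDerivAt f f' t)
    (hw : HasDerivAt w w' t) (hf0 : 0 < f t) (hw0 : 0 < w t) :
    HasDerivAt (fun s => √(f s) / √(f s + w s))
      (√(f t) / √(f t + w t) * (1 - (√(f t) / √(f t + w t)) ^ 2) / 2 * (f' / f t - w' / w t))
      t := by
  have hsum : 0 < f t + w t := add_pos hf0 hw0
  have hsqrt := Real.sqrt_pos.2 hsum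
  refine ((hf.sqrt hf0.ne').fun_div ((hf.fun_add hw).sqrt hsum.ne') hsqrt.ne').congr_deriv ?_
  have hy := Real.sq_sqrt hf0.le
  have hz := Real.sq_sqrt hsum.le
  have hy0 := Real.sqrt_pos.2 hf0
  set y := √(f t)
  set z := √(f t + w t)
  have hw2 : w t = z ^ 2 - y ^ 2 := by rw [hz, hy]; ring
  have hne : z ^ 2 - y ^ 2 ≠ 0 := hw2 ▸ hw0.ne'
  rw [hw2, ← hy]
  field_simp
  ring

end Calculus

section ScalarInequalities

/-- The polynomial `9k² - 12k + 8`; the Ricci part of the Riemann tensor of a perfect fluid of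
density `m` and pressure `(k - 1) m` has squared norm `(9k² - 12k + 8) m² / 3`. -/
def ricciCoeff (k : ℝ) : ℝ :=
  9 * k ^ 2 - 12 * k + 8

/-- The ratio `|W| / |R|` in terms of the density `m` and of the squared norm `v` of the electric
part of the Weyl tensor. -/
def weylRatio (k m v : ℝ) : ℝ :=
  if m = 0 then 1 else √(8 * v) / √(8 * v + ricciCoeff k * m ^ 2 / 3)

variable {H k m v α κ τ₁ τ₂ : ℝ}

theorem ricciCoeff_pos (k : ℝ) : 0 < ricciCoeff k := by
  unfold ricciCoeff
  nlinarith [sq_nonneg (3 * k - 2)]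

theorem weylRatio_zero_density (k v : ℝ) : weylRatio k 0 v = 1 :=
  if_pos rfl

theorem weylRatio_of_ne_zero (hm : m ≠ 0) :
    weylRatio k m v = √(8 * v) / √(8 * v + ricciCoeff k * m ^ 2 / 3) :=
  if_neg hm

theorem weylRatio_zero_weyl (hm : m ≠ 0) : weylRatio k m 0 = 0 := by
  simp [weylRatio_of_ne_zero hm]

theorem weylRatio_pos (hm : m ≠ 0) (hv : 0 < v) : 0 < weylRatio k m v := by
  have := ricciCoeff_pos k
  rw [weylRatio_of_ne_zero hm]
  positivity

theorem weylRatio_le_one (k m v : ℝ) : weylRatio k m v ≤ 1 := by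
  have := ricciCoeff_pos k
  unfold weylRatio
  split_ifs
  · exact le_rfl
  · exact div_le_one_of_le₀ (Real.sqrt_le_sqrt (le_add_of_nonneg_right (by positivity)))
      (Real.sqrt_nonneg _)

theorem sCrit_nonneg (hk : 0 ≤ k) : 0 ≤ sCrit k α := by
  unfold sCrit
  positivity

theorem sCrit_eq_zero_iff (hk : 0 ≤ k) (hα : α ≤ 1 / 3) : sCrit k α = 0 ↔ α = 1 / 3 := by
  have hpos : 0 < √2 / 4 + 2 * k * √((1 - 3 * α) / (9 * k ^ 2 - 12 * k + 8)) := by positivity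
  rw [sCrit, mul_eq_zero, or_iff_left hpos.ne', Real.sqrt_eq_zero (by linarith)]
  constructor <;> intro h <;> linarith

theorem sCrit_eq_add (k : ℝ) (hα : α ≤ 1 / 3) :
    sCrit k α = √2 / 4 * √(1 - 3 * α) + 2 * (1 - 3 * α) * (k / √(ricciCoeff k)) := by
  have hb : 0 ≤ 1 - 3 * α := by linarith
  rw [sCrit, Real.sqrt_div hb]
  nth_rewrite 4 [← Real.mul_self_sqrt hb]
  rw [ricciCoeff]
  ring

theorem le_sCrit (k : ℝ) (hα : α ≤ 1 / 3) :
    2 * (1 - 3 * α) * (k / √(ricciCoeff k)) ≤ sCrit k α := by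
  rw [sCrit_eq_add k hα]
  exact le_add_of_nonneg_left (by positivity)

theorem critical_polynomial_pos {s b : ℝ} (hs : 0 < s) (hs1 : s ≤ 1) (hb : 0 ≤ b) (hb1 : b ≤ 1) :
    0 < s * (1 - (1 + b ^ 2) * (1 - s ^ 2)) + √2 / 4 * b := by
  have hsqrt : 0.35 * b ≤ √2 / 4 * b := by
    have : (1.4 : ℝ) < √2 := Real.lt_sqrt_of_sq_lt (by norm_num)
    exact mul_le_mul_of_nonneg_right (by linarith) hb
  -- `s - 2s³` is largest at `s = 1/√6 ≈ 0.41`.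
  have hmax : s - 2 * s ^ 3 ≤ 0.28 := by
    nlinarith [mul_nonneg (by positivity : 0 ≤ 2 * s + 1.64) (sq_nonneg (s - 0.41))]
  have hbmax : b * (s - 2 * s ^ 3) ≤ b * 0.28 := mul_le_mul_of_nonneg_left hmax hb
  have hb2 : b ^ 2 * (s - s ^ 3) ≤ b * (s - s ^ 3) :=
    mul_le_mul_of_nonneg_right (by nlinarith) (by nlinarith [mul_nonneg hs.le (sub_nonneg.2 hs1)])
  have hpos : 0 < s ^ 3 * (1 - b) + 0.07 * b := by
    rcases hb1.eq_or_lt with rfl | h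
    · norm_num
    · have := mul_pos (pow_pos hs 3) (sub_pos.2 h)
      positivity
  nlinarith

theorem weylRatio_mul_shear_ge (hk : 0 ≤ k) (hm : m ≠ 0) (hv : 0 < v) {ρ : ℝ} (hρ : 0 ≤ ρ)
    (hτ₁ : τ₁ ^ 2 ≤ 2 / 3 * ρ ^ 2 * v) :
    -(4 * ρ * (k / √(ricciCoeff k))) ≤ weylRatio k m v * (k * m * τ₁ / v) := by
  have hq := ricciCoeff_pos k
  have hZ : 0 < 8 * v + ricciCoeff k * m ^ 2 / 3 := by positivity
  have hsq : (weylRatio k m v * (m * τ₁ / v)) ^ 2 ≤ (4 * ρ / √(ricciCoeff k)) ^ 2 :=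
    calc (weylRatio k m v * (m * τ₁ / v)) ^ 2
        = 8 * m ^ 2 / (8 * v + ricciCoeff k * m ^ 2 / 3) / v * τ₁ ^ 2 := by
          rw [weylRatio_of_ne_zero hm, mul_pow, div_pow, Real.sq_sqrt (by positivity),
            Real.sq_sqrt hZ.le]
          field_simp
      _ ≤ 8 * m ^ 2 / (8 * v + ricciCoeff k * m ^ 2 / 3) / v * (2 / 3 * ρ ^ 2 * v) := by gcongr
      _ ≤ 8 * m ^ 2 / (ricciCoeff k * m ^ 2 / 3) / v * (2 / 3 * ρ ^ 2 * v) := by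
          gcongr
          linarith
      _ = (4 * ρ / √(ricciCoeff k)) ^ 2 := by
          rw [div_pow, Real.sq_sqrt hq.le]
          field_simp
          ring
  have habs := (abs_le.1 (abs_le_of_sq_le_sq hsq (by positivity))).1
  calc -(4 * ρ * (k / √(ricciCoeff k))) = k * -(4 * ρ / √(ricciCoeff k)) := by ring
    _ ≤ k * (weylRatio k m v * (m * τ₁ / v)) := mul_le_mul_of_nonneg_left habs hk
    _ = weylRatio k m v * (k * m * τ₁ / v) := by ring

theorem weylRatio_rate_add_pos (hH : H < 0) (hk : 0 ≤ k) (hm : m ≠ 0) (hv : 0 < v)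
    (hα : α ∈ Set.Icc (0 : ℝ) (1 / 3)) (hτ₁ : τ₁ ^ 2 ≤ 2 / 3 * ((1 - 3 * α) * H) ^ 2 * v)
    (hτ₂ : τ₂ ≤ α * H * v) (hκ : 0 ≤ (18 * k - 12) * κ / ricciCoeff k + 2 * k) :
    0 < weylRatio k m v * (1 - weylRatio k m v ^ 2) / 2 *
        ((4 * H * v - 6 * τ₂ + k * m * τ₁) / v - H * ((18 * k - 12) * κ / ricciCoeff k + 2 * k))
      - H * (weylRatio k m v + sCrit k α) := by
  have hb : 0 ≤ 1 - 3 * α := by linarith [hα.2]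
  have hshear := weylRatio_mul_shear_ge (τ₁ := τ₁) hk hm hv
    (mul_nonneg hb (neg_nonneg.2 hH.le)) (by simpa using hτ₁)
  have hs0 := weylRatio_pos (k := k) hm hv
  have hs1 := weylRatio_le_one k m v
  rw [sCrit_eq_add k hα.2]
  set s := weylRatio k m v
  set c := k / √(ricciCoeff k)
  have hpoly := critical_polynomial_pos hs0 hs1 (Real.sqrt_nonneg (1 - 3 * α))
    (Real.sqrt_le_one.2 (by linarith [hα.1]))
  rw [Real.sq_sqrt hb] at hpoly
  have hc : 0 ≤ (1 - 3 * α) * -H * c :=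
    mul_nonneg (mul_nonneg hb (neg_nonneg.2 hH.le)) (by positivity)
  have hs2 : 0 ≤ 1 - s ^ 2 := by nlinarith
  have hlog : 2 * (1 + (1 - 3 * α)) * H + k * m * τ₁ / v
      ≤ (4 * H * v - 6 * τ₂ + k * m * τ₁) / v
        - H * ((18 * k - 12) * κ / ricciCoeff k + 2 * k) := by
    have hdiv : τ₂ / v ≤ α * H := (div_le_iff₀ hv).2 hτ₂
    have hsplit : (4 * H * v - 6 * τ₂ + k * m * τ₁) / v
        = 4 * H - 6 * (τ₂ / v) + k * m * τ₁ / v := by field_simp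
    rw [hsplit]
    nlinarith
  have hrate : (1 - s ^ 2) * s * (1 + (1 - 3 * α)) * H - 2 * ((1 - 3 * α) * -H * c)
      ≤ s * (1 - s ^ 2) / 2 * ((4 * H * v - 6 * τ₂ + k * m * τ₁) / v
        - H * ((18 * k - 12) * κ / ricciCoeff k + 2 * k)) := by
    refine le_trans ?_ (mul_le_mul_of_nonneg_left hlog (by positivity))
    nlinarith [mul_le_mul_of_nonneg_left hshear hs2, mul_nonneg (sq_nonneg s) hc]
  nlinarith [mul_pos (neg_pos.2 hH) hpoly]

end ScalarInequalities

section TimeLine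

open scoped Topology

/-- The parameters `k` and `α` along a time line with lapse `n` and mean curvature `H`, together
with their rates `κ = D_T k / H` and `β = D_T α / H`. -/
structure ParameterLine (J : Set ℝ) (n k α κ β H : ℝ → ℝ) : Prop where
  k_mem : ∀ t ∈ J, k t ∈ Set.Icc (0 : ℝ) (4 / 3)
  α_mem : ∀ t ∈ J, α t ∈ Set.Icc (0 : ℝ) (1 / 3)
  α_contDiffAt : ∀ t ∈ J, ContDiffAt ℝ 2 α t
  k_rate_nonneg : ∀ t ∈ J, 0 ≤ κ t
  α_rate_nonneg : ∀ t ∈ J, 0 ≤ β t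
  k_rate_le : ∀ t ∈ J, 3 * (4 - 3 * k t) * κ t ≤ k t * ricciCoeff (k t)
  k_rate_mul_le : ∀ t ∈ J,
    3 * (4 - 3 * k t) * κ t * (4 * (1 - 3 * α t)) ≤ k t * ricciCoeff (k t) * (9 * β t)
  hasDerivAt_k : ∀ t ∈ J, HasDerivAt k (n t * (κ t * H t)) t
  hasDerivAt_α : ∀ t ∈ J, HasDerivAt α (n t * (β t * H t)) t

/-- The scalar quantities of a perfect fluid electric region along a time line: lapse `n`, density
`m`, parameters `k` and `α` with rates `κ` and `β`, mean curvature `H`, `v = tr X²`,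
`τ₁ = tr (K X)` and `τ₂ = tr (K X²)` for the electric part `X` of the Weyl tensor and the shape
operator `K`, volume density `D`, and entropy `S`. -/
structure EntropyLine (J : Set ℝ) (n m k α κ β H v τ₁ τ₂ D S : ℝ → ℝ) : Prop
    extends ParameterLine J n k α κ β H where
  isOpen : IsOpen J
  lapse_pos : ∀ t ∈ J, 0 < n t
  volume_pos : ∀ t ∈ J, 0 < D t
  meanCurv_nonpos : ∀ t ∈ J, H t ≤ 0
  continuousAt_lapse_mul_meanCurv : ∀ t ∈ J, ContinuousAt (fun s => n s * H s) t
  v_nonneg : ∀ t ∈ J, 0 ≤ v t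
  τ₁_sq_le : ∀ t ∈ J, τ₁ t ^ 2 ≤ 2 / 3 * ((1 - 3 * α t) * H t) ^ 2 * v t
  τ₂_le : ∀ t ∈ J, τ₂ t ≤ α t * H t * v t
  τ₂_eq_zero : ∀ t ∈ J, H t = 0 → τ₂ t = 0
  hasDerivAt_volume : ∀ t ∈ J, HasDerivAt D (-(n t * H t) * D t) t
  hasDerivAt_density : ∀ t ∈ J, HasDerivAt m (n t * (k t * m t * H t)) t
  hasDerivAt_v : ∀ t ∈ J,
    HasDerivAt v (n t * (4 * H t * v t - 6 * τ₂ t + k t * m t * τ₁ t)) t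
  sqrt_v_kink : ∀ t ∈ J, v t = 0 → ∃ w,
    0 ≤ w ∧ w ^ 2 ≤ (n t * k t * m t / 2) ^ 2 * (2 / 3 * ((1 - 3 * α t) * H t) ^ 2) ∧
      HasOneSidedDerivs (fun s => √(v s)) w (-w) t
  entropy_eq : ∀ t ∈ J, S t = (weylRatio (k t) (m t) (v t) + sCrit (k t) (α t)) * D t

theorem hasDerivAt_ricciCoeff {k : ℝ → ℝ} {k' t : ℝ} (hk : HasDerivAt k k' t) :
    HasDerivAt (fun s => ricciCoeff (k s)) ((18 * k t - 12) * k') t := by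
  refine ((((hk.fun_pow 2).const_mul 9).fun_sub (hk.const_mul 12)).add_const 8).congr_deriv ?_
  push_cast
  ring

theorem hasDerivAt_div_sqrt_ricciCoeff {k : ℝ → ℝ} {k' t : ℝ} (hk : HasDerivAt k k' t) :
    HasDerivAt (fun s => k s / √(ricciCoeff (k s)))
      (k' * (8 - 6 * k t) / (ricciCoeff (k t) * √(ricciCoeff (k t)))) t := by
  have hq := ricciCoeff_pos (k t)
  have hsqrt := Real.sqrt_pos.2 hq
  refine (hk.fun_div ((hasDerivAt_ricciCoeff hk).sqrt hq.ne') hsqrt.ne').congr_deriv ?_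
  have hsq := Real.sq_sqrt hq.le
  field_simp
  rw [hsq, ricciCoeff]
  ring

namespace EntropyLine

variable {J : Set ℝ} {n m k α κ β H v τ₁ τ₂ D S : ℝ → ℝ}
  (h : EntropyLine J n m k α κ β H v τ₁ τ₂ D S) {t : ℝ} (ht : t ∈ J)
include h ht

theorem eventually_mem : ∀ᶠ s in 𝓝 t, s ∈ J :=
  h.isOpen.mem_nhds ht

theorem lapse_mul_meanCurv_nonpos : n t * H t ≤ 0 :=
  mul_nonpos_of_nonneg_of_nonpos (h.lapse_pos t ht).le (h.meanCurv_nonpos t ht)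

theorem α_deriv_nonpos : n t * (β t * H t) ≤ 0 := by
  have := mul_nonpos_of_nonneg_of_nonpos (h.α_rate_nonneg t ht) (h.lapse_mul_meanCurv_nonpos ht)
  linarith

theorem exists_hasDerivAt_sqrt_one_sub :
    ∃ c, 0 ≤ c ∧ HasDerivAt (fun s => √(1 - 3 * α s)) c t := by
  have hderiv : ∀ s ∈ J, HasDerivAt (fun r => 1 - 3 * α r) (-(3 * (n s * (β s * H s)))) s :=
    fun s hs => ((h.hasDerivAt_α s hs).const_mul 3).const_sub 1
  have hnonneg : ∀ s ∈ J, 0 ≤ 1 - 3 * α s := fun s hs => by linarith [(h.α_mem s hs).2]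
  rcases (hnonneg t ht).eq_or_lt with h0 | hpos
  · refine ⟨0, le_rfl, hasDerivAt_sqrt_of_deriv_nonneg
      (contDiffAt_const.sub (contDiffAt_const.mul (h.α_contDiffAt t ht)))
      ((h.eventually_mem ht).mono fun s hs => ?_) ((h.eventually_mem ht).mono hnonneg) h0.symm⟩
    rw [(hderiv s hs).deriv]
    linarith [h.α_deriv_nonpos hs]
  · exact ⟨_, div_nonneg (by linarith [h.α_deriv_nonpos ht]) (by positivity),
      (hderiv t ht).sqrt hpos.ne'⟩

theorem exists_hasDerivAt_mul_div_sqrt_ricciCoeff :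
    ∃ c, 0 ≤ c ∧
      HasDerivAt (fun s => 2 * (1 - 3 * α s) * (k s / √(ricciCoeff (k s)))) c t := by
  have hα := (((h.hasDerivAt_α t ht).const_mul 3).const_sub 1).const_mul 2
  refine ⟨_, ?_, hα.fun_mul (hasDerivAt_div_sqrt_ricciCoeff (h.hasDerivAt_k t ht))⟩
  have hq := ricciCoeff_pos (k t)
  have hsqrt := Real.sqrt_pos.2 hq
  have hrate : (1 - 3 * α t) * κ t * (8 - 6 * k t) ≤ 3 * β t * k t * ricciCoeff (k t) := by
    have hnonneg : 0 ≤ β t * (k t * ricciCoeff (k t)) :=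
      mul_nonneg (h.α_rate_nonneg t ht) (mul_nonneg (h.k_mem t ht).1 hq.le)
    linarith [h.k_rate_mul_le t ht]
  have hnum : 0 ≤ 2 * -(n t * H t) * (3 * β t * k t * ricciCoeff (k t)
      - (1 - 3 * α t) * κ t * (8 - 6 * k t)) :=
    mul_nonneg (mul_nonneg zero_le_two (neg_nonneg.2 (h.lapse_mul_meanCurv_nonpos ht)))
      (sub_nonneg.2 hrate)
  refine (div_nonneg hnum (mul_pos hq hsqrt).le).trans_eq ?_
  field_simp
  ring

theorem exists_hasDerivAt_sCrit :
    ∃ c, 0 ≤ c ∧ HasDerivAt (fun s => sCrit (k s) (α s)) c t := by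
  obtain ⟨c₁, hc₁, hd₁⟩ := h.exists_hasDerivAt_sqrt_one_sub ht
  obtain ⟨c₂, hc₂, hd₂⟩ := h.exists_hasDerivAt_mul_div_sqrt_ricciCoeff ht
  refine ⟨√2 / 4 * c₁ + c₂, by positivity,
    ((hd₁.const_mul (√2 / 4)).fun_add hd₂).congr_of_eventuallyEq ?_⟩
  filter_upwards [h.eventually_mem ht] with s hs using sCrit_eq_add _ (h.α_mem s hs).2

theorem sCrit_nonneg : 0 ≤ sCrit (k t) (α t) :=
  WeylEntropy.sCrit_nonneg (h.k_mem t ht).1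

theorem hasDerivAt_weylRatio_of_density_eq_zero (hm : m t = 0) :
    HasDerivAt (fun s => weylRatio (k s) (m s) (v s)) 0 t := by
  have hvacuum : ∀ᶠ s in 𝓝 t, m s = 0 := by
    refine eventually_eq_zero_of_linear_ode (c := fun s => n s * H s * k s)
      ((h.continuousAt_lapse_mul_meanCurv t ht).mul (h.hasDerivAt_k t ht).continuousAt) ?_ hm
    filter_upwards [h.eventually_mem ht] with s hs
    exact (h.hasDerivAt_density s hs).congr_deriv (by ring)
  refine (hasDerivAt_const t (1 : ℝ)).congr_of_eventuallyEq ?_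
  filter_upwards [hvacuum] with s hs
  rw [hs, weylRatio_zero_density]

theorem eventually_weylRatio_eq (hm : m t ≠ 0) :
    ∀ᶠ s in 𝓝 t, weylRatio (k s) (m s) (v s)
      = √(8 * v s) / √(8 * v s + ricciCoeff (k s) * m s ^ 2 / 3) :=
  ((h.hasDerivAt_density t ht).continuousAt.eventually_ne hm).mono fun _ hs =>
    weylRatio_of_ne_zero hs

theorem hasDerivAt_ricciCoeff_mul_sq :
    HasDerivAt (fun s => ricciCoeff (k s) * m s ^ 2 / 3)
      (n t * H t * ((18 * k t - 12) * κ t / ricciCoeff (k t) + 2 * k t)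
        * (ricciCoeff (k t) * m t ^ 2 / 3)) t := by
  have hq := ricciCoeff_pos (k t)
  refine (((hasDerivAt_ricciCoeff (h.hasDerivAt_k t ht)).fun_mul
    ((h.hasDerivAt_density t ht).fun_pow 2)).div_const 3).congr_deriv ?_
  field_simp
  push_cast
  ring

theorem hasDerivAt_weylRatio (hm : m t ≠ 0) (hv : 0 < v t) :
    HasDerivAt (fun s => weylRatio (k s) (m s) (v s))
      (n t * (weylRatio (k t) (m t) (v t) * (1 - weylRatio (k t) (m t) (v t) ^ 2) / 2 *
        ((4 * H t * v t - 6 * τ₂ t + k t * m t * τ₁ t) / v t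
          - H t * ((18 * k t - 12) * κ t / ricciCoeff (k t) + 2 * k t)))) t := by
  have hq := ricciCoeff_pos (k t)
  refine ((hasDerivAt_sqrt_div_sqrt_add ((h.hasDerivAt_v t ht).const_mul 8)
    (h.hasDerivAt_ricciCoeff_mul_sq ht) (by positivity)
    (by positivity)).congr_of_eventuallyEq (h.eventually_weylRatio_eq ht hm)).congr_deriv ?_
  rw [← weylRatio_of_ne_zero hm]
  field_simp

theorem k_logRate_nonneg : 0 ≤ (18 * k t - 12) * κ t / ricciCoeff (k t) + 2 * k t := by
  have hq := ricciCoeff_pos (k t)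
  rw [← sub_neg_eq_add, sub_nonneg, le_div_iff₀ hq]
  linarith [h.k_rate_le t ht, h.k_rate_nonneg t ht]

/- The volume grows at the relative rate `-n H`, which outweighs any decrease of the ratio. -/
theorem exists_hasDerivAt_weylRatio (hreg : m t = 0 ∨ v t ≠ 0) :
    ∃ σ, HasDerivAt (fun s => weylRatio (k s) (m s) (v s)) σ t ∧
      0 ≤ σ - n t * H t * (weylRatio (k t) (m t) (v t) + sCrit (k t) (α t)) ∧
      (σ - n t * H t * (weylRatio (k t) (m t) (v t) + sCrit (k t) (α t)) = 0 ↔ H t = 0) := by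
  suffices ∃ σ, HasDerivAt (fun s => weylRatio (k s) (m s) (v s)) σ t ∧ (H t = 0 → σ = 0) ∧
      (H t < 0 → 0 < σ - n t * H t * (weylRatio (k t) (m t) (v t) + sCrit (k t) (α t))) by
    obtain ⟨σ, hσ, hzero, hpos⟩ := this
    refine ⟨σ, hσ, ?_⟩
    rcases (h.meanCurv_nonpos t ht).eq_or_lt with hH | hH
    · simp [hzero hH, hH]
    · exact ⟨(hpos hH).le, iff_of_false (hpos hH).ne' hH.ne⟩
  have hn := h.lapse_pos t ht
  by_cases hm : m t = 0
  · refine ⟨0, h.hasDerivAt_weylRatio_of_density_eq_zero ht hm, fun _ => rfl, fun hH => ?_⟩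
    rw [hm, weylRatio_zero_density]
    nlinarith [mul_neg_of_pos_of_neg hn hH, h.sCrit_nonneg ht]
  · have hv : 0 < v t := (h.v_nonneg t ht).lt_of_ne' (hreg.resolve_left hm)
    refine ⟨_, h.hasDerivAt_weylRatio ht hm hv, fun hH => ?_, fun hH => ?_⟩
    · have hτ₁ : τ₁ t = 0 := by simpa [hH, sq_nonpos_iff] using h.τ₁_sq_le t ht
      simp [hH, hτ₁, h.τ₂_eq_zero t ht hH]
    · rw [mul_assoc (n t), ← mul_sub]
      exact mul_pos hn (weylRatio_rate_add_pos hH (h.k_mem t ht).1 hm hv (h.α_mem t ht)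
        (h.τ₁_sq_le t ht) (h.τ₂_le t ht) (h.k_logRate_nonneg ht))

theorem kink_slope_le (hm : m t ≠ 0) {w : ℝ}
    (hw : w ^ 2 ≤ (n t * k t * m t / 2) ^ 2 * (2 / 3 * ((1 - 3 * α t) * H t) ^ 2)) :
    √8 * w / √(ricciCoeff (k t) * m t ^ 2 / 3) ≤ -(n t * H t * sCrit (k t) (α t)) := by
  have hq := ricciCoeff_pos (k t)
  have hQ : 0 < ricciCoeff (k t) * m t ^ 2 / 3 := by positivity
  have hnH := neg_nonneg.2 (h.lapse_mul_meanCurv_nonpos ht)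
  have hα : 0 ≤ 1 - 3 * α t := by linarith [(h.α_mem t ht).2]
  have hk := (h.k_mem t ht).1
  calc √8 * w / √(ricciCoeff (k t) * m t ^ 2 / 3)
      ≤ -(n t * H t) * (2 * (1 - 3 * α t) * (k t / √(ricciCoeff (k t)))) := by
        refine le_of_sq_le_sq ?_ (by positivity)
        rw [div_pow, mul_pow, Real.sq_sqrt (by norm_num), Real.sq_sqrt hQ.le, div_le_iff₀ hQ,
          mul_pow, mul_pow (2 * _), div_pow, Real.sq_sqrt hq.le]
        refine (mul_le_mul_of_nonneg_left hw (by norm_num)).trans_eq ?_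
        field_simp
        ring
    _ ≤ -(n t * H t) * sCrit (k t) (α t) :=
        mul_le_mul_of_nonneg_left (le_sCrit _ (h.α_mem t ht).2) hnH
    _ = -(n t * H t * sCrit (k t) (α t)) := neg_mul _ _

theorem exists_hasOneSidedDerivs_weylRatio (hm : m t ≠ 0) (hv : v t = 0) :
    ∃ σ, 0 ≤ σ ∧ σ ≤ -(n t * H t * sCrit (k t) (α t)) ∧
      HasOneSidedDerivs (fun s => weylRatio (k s) (m s) (v s)) σ (-σ) t := by
  obtain ⟨w, hw, hw2, hkink⟩ := h.sqrt_v_kink t ht hv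
  have hq := ricciCoeff_pos (k t)
  have hQ : 0 < ricciCoeff (k t) * m t ^ 2 / 3 := by positivity
  have hdenom := (((h.hasDerivAt_v t ht).const_mul 8).fun_add
    (h.hasDerivAt_ricciCoeff_mul_sq ht)).sqrt (by rw [hv]; linarith)
  have hquot : ∀ {u I}, HasDerivWithinAt (fun s => √(v s)) u I t →
      HasDerivWithinAt (fun s => √(8 * v s) / √(8 * v s + ricciCoeff (k s) * m s ^ 2 / 3))
        (√8 * u / √(ricciCoeff (k t) * m t ^ 2 / 3)) I t := fun {u I} hu => by
    have hz := Real.sqrt_pos.2 hQ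
    simp only [Real.sqrt_mul (by norm_num : (0 : ℝ) ≤ 8)]
    refine ((hu.const_mul √8).fun_div hdenom.hasDerivWithinAt ?_).congr_deriv ?_
    · simpa only [hv, mul_zero, zero_add] using hz.ne'
    · simp only [hv, mul_zero, zero_add, Real.sqrt_zero]
      field_simp
      ring
  refine ⟨_, by positivity, h.kink_slope_le ht hm hw2, HasOneSidedDerivs.congr_of_eventuallyEq
    ⟨hquot hkink.1, ?_⟩ (h.eventually_weylRatio_eq ht hm)⟩
  simpa only [mul_neg, neg_div] using hquot hkink.2

theorem hasOneSidedDerivs_entropy {c σ₁ σ₂ : ℝ}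
    (hc : HasDerivAt (fun s => sCrit (k s) (α s)) c t)
    (hσ : HasOneSidedDerivs (fun s => weylRatio (k s) (m s) (v s)) σ₁ σ₂ t) :
    HasOneSidedDerivs S
      (D t * (c + (σ₁ - n t * H t * (weylRatio (k t) (m t) (v t) + sCrit (k t) (α t)))))
      (D t * (c + (σ₂ - n t * H t * (weylRatio (k t) (m t) (v t) + sCrit (k t) (α t))))) t := by
  have hprod : ∀ {σ I}, HasDerivWithinAt (fun s => weylRatio (k s) (m s) (v s)) σ I t →
      HasDerivWithinAt (fun s => (weylRatio (k s) (m s) (v s) + sCrit (k s) (α s)) * D s)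
        (D t * (c + (σ - n t * H t * (weylRatio (k t) (m t) (v t) + sCrit (k t) (α t))))) I t :=
    fun hσ => ((hσ.fun_add hc.hasDerivWithinAt).fun_mul
      (h.hasDerivAt_volume t ht).hasDerivWithinAt).congr_deriv (by ring)
  exact HasOneSidedDerivs.congr_of_eventuallyEq ⟨hprod hσ.1, hprod hσ.2⟩
    ((h.eventually_mem ht).mono h.entropy_eq)

theorem exists_hasOneSidedDerivs : ∃ a b, HasOneSidedDerivs S a b t ∧ 0 ≤ a ∧ 0 ≤ b := by
  obtain ⟨c, hc0, hc⟩ := h.exists_hasDerivAt_sCrit ht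
  have hD := (h.volume_pos t ht).le
  by_cases hreg : m t = 0 ∨ v t ≠ 0
  · obtain ⟨σ, hσ, hnet, -⟩ := h.exists_hasDerivAt_weylRatio ht hreg
    exact ⟨_, _, h.hasOneSidedDerivs_entropy ht hc (hasOneSidedDerivs_of_hasDerivAt hσ),
      by positivity, by positivity⟩
  · push Not at hreg
    obtain ⟨σ, hσ0, hσ1, hσ⟩ := h.exists_hasOneSidedDerivs_weylRatio ht hreg.1 hreg.2
    refine ⟨_, _, h.hasOneSidedDerivs_entropy ht hc hσ, ?_, ?_⟩ <;>
      rw [hreg.2, weylRatio_zero_weyl hreg.1] <;>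
      exact mul_nonneg hD (by linarith)

theorem differentiableAt_of_regular (hreg : m t = 0 ∨ v t ≠ 0) : DifferentiableAt ℝ S t := by
  obtain ⟨c, -, hc⟩ := h.exists_hasDerivAt_sCrit ht
  obtain ⟨σ, hσ, -⟩ := h.exists_hasDerivAt_weylRatio ht hreg
  exact (h.hasOneSidedDerivs_entropy ht hc
    (hasOneSidedDerivs_of_hasDerivAt hσ)).hasDerivAt.differentiableAt

theorem deriv_eq_zero_iff :
    (DifferentiableAt ℝ S t ∧ deriv S t = 0) ↔
      deriv (fun s => sCrit (k s) (α s)) t = 0 ∧ (H t = 0 ∨ m t ≠ 0 ∧ v t = 0 ∧ α t = 1 / 3) := by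
  obtain ⟨c, hc0, hc⟩ := h.exists_hasDerivAt_sCrit ht
  have hD := (h.volume_pos t ht).ne'
  rw [hc.deriv]
  by_cases hreg : m t = 0 ∨ v t ≠ 0
  · obtain ⟨σ, hσ, hnet, hiff⟩ := h.exists_hasDerivAt_weylRatio ht hreg
    rw [(h.hasOneSidedDerivs_entropy ht hc
      (hasOneSidedDerivs_of_hasDerivAt hσ)).hasDerivAt_zero_iff, and_self,
      mul_eq_zero_iff_left hD, add_eq_zero_iff_of_nonneg hc0 hnet, hiff]
    tauto
  · push Not at hreg
    obtain ⟨hm, hv⟩ := hreg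
    obtain ⟨σ, hσ0, hσ1, hσ⟩ := h.exists_hasOneSidedDerivs_weylRatio ht hm hv
    have hzero : H t = 0 ∨ α t = 1 / 3 ↔ n t * H t * sCrit (k t) (α t) = 0 := by
      rw [← sCrit_eq_zero_iff (h.k_mem t ht).1 (h.α_mem t ht).2, mul_eq_zero, mul_eq_zero,
        or_iff_right (h.lapse_pos t ht).ne']
    rw [(h.hasOneSidedDerivs_entropy ht hc hσ).hasDerivAt_zero_iff, mul_eq_zero_iff_left hD,
      mul_eq_zero_iff_left hD, hv, weylRatio_zero_weyl hm, zero_add]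
    simp only [ne_eq, hm, not_false_eq_true, true_and, hzero]
    constructor
    · rintro ⟨h₁, -⟩
      constructor <;> linarith
    · rintro ⟨hc0', hs⟩
      constructor <;> linarith

end EntropyLine

end TimeLine

section MetricSymmetricOperators

variable {ι : Type*} [Fintype ι] {g K Q X : Matrix ι ι ℝ}

theorem trace_mul_self_le_sq_trace (hQ : Q.PosSemidef) : (Q * Q).trace ≤ Q.trace ^ 2 := by
  have hminor (i j : ι) : Q i j * Q j i ≤ Q i i * Q j j := by
    have hdet := (hQ.submatrix ![i, j]).det_nonneg
    rwa [Matrix.det_fin_two, sub_nonneg] at hdet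
  simp only [Matrix.trace, Matrix.diag_apply, Matrix.mul_apply, sq, Finset.sum_mul_sum]
  exact Finset.sum_le_sum fun i _ => Finset.sum_le_sum fun j _ => hminor i j

theorem sq_trace_mul_le_of_isSymm (hK : K.IsSymm) (hX : X.IsSymm) :
    (K * X).trace ^ 2 ≤ (K * K).trace * (X * X).trace := by
  have htrace (A : Matrix ι ι ℝ) : (A * X).trace = ∑ p : ι × ι, A p.1 p.2 * X p.1 p.2 := by
    simp only [Fintype.sum_prod_type, Matrix.trace, Matrix.diag_apply, Matrix.mul_apply, hX.apply]
  have hsq {A : Matrix ι ι ℝ} (hA : A.IsSymm) : (A * A).trace = ∑ p : ι × ι, A p.1 p.2 ^ 2 := by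
    simp only [Fintype.sum_prod_type, ← trace_mul_transpose_self, hA.eq]
  rw [htrace, hsq hK, hsq hX]
  exact Finset.sum_mul_sq_le_sq_mul_sq _ _ _

/- Conjugation by an orthonormal frame turns `g`-symmetric operators into symmetric matrices. -/
theorem exists_symmetrizing_algEquiv [DecidableEq ι] (hg : g.PosDef) :
    ∃ e : Matrix ι ι ℝ ≃ₐ[ℝ] Matrix ι ι ℝ, (∀ A, (e A).trace = A.trace) ∧
      (∀ A, (g * A).IsSymm → (e A).IsSymm) ∧ ∀ A, (g * A).PosSemidef → (e A).PosSemidef := by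
  obtain ⟨L, ⟨u, rfl⟩, -, hL⟩ := exists_frame hg
  have hinv : (↑u⁻¹ : Matrix ι ι ℝ) = (u : Matrix ι ι ℝ)ᵀ * g :=
    Units.inv_eq_of_mul_eq_one_left hL
  let e : Matrix ι ι ℝ ≃ₐ[ℝ] Matrix ι ι ℝ :=
    MulSemiringAction.toAlgEquiv ℝ _ (ConjAct.toConjAct u⁻¹)
  have he (A : Matrix ι ι ℝ) : e A = (↑u⁻¹ : Matrix ι ι ℝ) * A * u :=
    (ConjAct.units_smul_def _ _).trans (by rw [ConjAct.ofConjAct_toConjAct, inv_inv])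
  have he' (A : Matrix ι ι ℝ) : e A = (u : Matrix ι ι ℝ)ᵀ * (g * A) * u := by
    rw [he, hinv, Matrix.mul_assoc _ g A]
  refine ⟨e, fun A => ?_, fun A hA => ?_, fun A hA => ?_⟩
  · rw [he, Matrix.trace_mul_comm, ← Matrix.mul_assoc, Units.mul_inv, Matrix.one_mul]
  · rw [he', Matrix.IsSymm, Matrix.transpose_mul, Matrix.transpose_mul, hA.eq,
      Matrix.transpose_transpose]
    exact (Matrix.mul_assoc _ _ _).symm
  · rw [he', ← Matrix.conjTranspose_eq_transpose_of_trivial]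
    exact hA.conjTranspose_mul_mul_same _

theorem trace_mul_self_nonneg (hg : g.PosDef) (hX : (g * X).IsSymm) : 0 ≤ (X * X).trace := by
  classical
  obtain ⟨e, htr, hsymm, -⟩ := exists_symmetrizing_algEquiv hg
  rw [← htr, map_mul]
  nth_rw 2 [← (hsymm X hX).eq]
  rw [trace_mul_transpose_self]
  positivity

theorem trace_mul_self_eq_zero_iff (hg : g.PosDef) (hX : (g * X).IsSymm) :
    (X * X).trace = 0 ↔ X = 0 := by
  classical
  obtain ⟨e, htr, hsymm, -⟩ := exists_symmetrizing_algEquiv hg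
  rw [← htr, map_mul, ← map_eq_zero_iff e e.injective]
  nth_rw 2 [← (hsymm X hX).eq]
  rw [← Matrix.conjTranspose_eq_transpose_of_trivial,
    Matrix.trace_mul_conjTranspose_self_eq_zero_iff]

theorem sq_trace_mul_le (hg : g.PosDef) (hK : (g * K).IsSymm) (hX : (g * X).IsSymm) :
    (K * X).trace ^ 2 ≤ (K * K).trace * (X * X).trace := by
  classical
  obtain ⟨e, htr, hsymm, -⟩ := exists_symmetrizing_algEquiv hg
  simpa only [← map_mul, htr] using sq_trace_mul_le_of_isSymm (hsymm K hK) (hsymm X hX)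

theorem trace_mul_mul_self_nonneg (hg : g.PosDef) (hQ : (g * Q).PosSemidef)
    (hX : (g * X).IsSymm) : 0 ≤ (Q * (X * X)).trace := by
  classical
  obtain ⟨e, htr, hsymm, hpos⟩ := exists_symmetrizing_algEquiv hg
  have h := ((hpos Q hQ).conjTranspose_mul_mul_same (e X)).trace_nonneg
  rwa [Matrix.conjTranspose_eq_transpose_of_trivial, (hsymm X hX).eq, Matrix.mul_assoc,
    Matrix.trace_mul_comm, Matrix.mul_assoc, ← map_mul, ← map_mul, htr] at h

theorem trace_mul_self_le_sq_trace_of_mul_posSemidef (hg : g.PosDef) (hQ : (g * Q).PosSemidef) :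
    (Q * Q).trace ≤ Q.trace ^ 2 := by
  classical
  obtain ⟨e, htr, -, hpos⟩ := exists_symmetrizing_algEquiv hg
  simpa only [← map_mul, htr] using trace_mul_self_le_sq_trace (hpos Q hQ)

theorem trace_nonneg_of_mul_posSemidef (hg : g.PosDef) (hQ : (g * Q).PosSemidef) :
    0 ≤ Q.trace := by
  classical
  obtain ⟨e, htr, -, hpos⟩ := exists_symmetrizing_algEquiv hg
  exact (hpos Q hQ).trace_nonneg.trans_eq (htr Q)

theorem trace_eq_zero_iff_of_mul_posSemidef (hg : g.PosDef) (hQ : (g * Q).PosSemidef) :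
    Q.trace = 0 ↔ Q = 0 := by
  classical
  obtain ⟨e, htr, -, hpos⟩ := exists_symmetrizing_algEquiv hg
  rw [← htr, (hpos Q hQ).trace_eq_zero_iff, map_eq_zero_iff e e.injective]

end MetricSymmetricOperators

section TracelessParts

variable {g K X : Matrix (Fin 3) (Fin 3) ℝ} {a : ℝ}

theorem trace_smul_one_sub (K : Matrix (Fin 3) (Fin 3) ℝ) (a : ℝ) :
    (a • 1 - K).trace = 3 * a - K.trace := by
  simp [mul_comm]

theorem trace_tracelessPart_mul_self (K : Matrix (Fin 3) (Fin 3) ℝ) :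
    (tracelessPart K * tracelessPart K).trace = (K * K).trace - K.trace ^ 2 / 3 := by
  simp only [tracelessPart, Matrix.sub_mul, Matrix.mul_sub, Matrix.smul_mul, Matrix.mul_smul,
    Matrix.one_mul, Matrix.mul_one, Matrix.trace_sub, Matrix.trace_smul, Matrix.trace_one,
    smul_eq_mul, Fintype.card_fin]
  push_cast
  ring

theorem trace_tracelessPart_mul (hX : X.trace = 0) :
    (tracelessPart K * X).trace = (K * X).trace := by
  simp [tracelessPart, Matrix.sub_mul, hX]

theorem tracelessPart_smul_one_sub : tracelessPart (a • 1 - K) = -tracelessPart K := by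
  rw [tracelessPart, tracelessPart, trace_smul_one_sub]
  module

variable (hg : g.PosDef) (hK : (g * (a • 1 - K)).PosSemidef)
include hg hK

theorem trace_le_of_posSemidef : K.trace ≤ 3 * a := by
  have h := trace_nonneg_of_mul_posSemidef hg hK
  rwa [trace_smul_one_sub, sub_nonneg] at h

theorem eq_smul_one_of_trace_eq (htr : K.trace = 3 * a) : K = a • 1 := by
  refine (sub_eq_zero.1 ((trace_eq_zero_iff_of_mul_posSemidef hg hK).1 ?_)).symm
  rw [trace_smul_one_sub, htr, sub_self]

theorem trace_tracelessPart_sq_le :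
    (tracelessPart K * tracelessPart K).trace ≤ 2 / 3 * (3 * a - K.trace) ^ 2 := by
  have h := trace_mul_self_le_sq_trace_of_mul_posSemidef hg hK
  rw [← neg_mul_neg, ← tracelessPart_smul_one_sub (a := a), trace_tracelessPart_mul_self,
    ← trace_smul_one_sub]
  linarith

theorem trace_mul_mul_self_le (hX : (g * X).IsSymm) :
    (K * (X * X)).trace ≤ a * (X * X).trace := by
  have h := trace_mul_mul_self_nonneg hg hK hX
  rwa [Matrix.sub_mul, Matrix.trace_sub, Matrix.smul_mul, Matrix.one_mul, Matrix.trace_smul,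
    smul_eq_mul, sub_nonneg] at h

theorem isSymm_mul_tracelessPart : (g * tracelessPart K).IsSymm := by
  have hsplit : g * tracelessPart K = (a - K.trace / 3) • g - g * (a • 1 - K) := by
    simp only [tracelessPart, Matrix.mul_sub, Matrix.mul_smul, Matrix.mul_one]
    module
  rw [hsplit]
  exact (Matrix.IsSymm.smul hg.isHermitian _).sub hK.isHermitian

theorem sq_trace_mul_le_of_trace_eq_zero (hX : (g * X).IsSymm) (hX0 : X.trace = 0) :
    (K * X).trace ^ 2 ≤ 2 / 3 * (3 * a - K.trace) ^ 2 * (X * X).trace := by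
  rw [← trace_tracelessPart_mul hX0]
  exact (sq_trace_mul_le hg (isSymm_mul_tracelessPart hg hK) hX).trans
    (mul_le_mul_of_nonneg_right (trace_tracelessPart_sq_le hg hK) (trace_mul_self_nonneg hg hX))

end TracelessParts

section MatrixCurves

open scoped Topology

variable {ι : Type*} [Fintype ι] {t : ℝ}

theorem trace_adjugate_mul [DecidableEq ι] (A B : Matrix ι ι ℝ) :
    (A.adjugate * B).trace = ∑ i, (A.updateCol i fun j => B j i).det := by
  refine Finset.sum_congr rfl fun i _ => ?_
  rw [← Matrix.cramer_apply, Matrix.cramer_eq_adjugate_mulVec]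
  rfl

theorem pd_prod {κ : Type*} [DecidableEq κ] {F : κ → ℝ × E3 → ℝ} {s : Finset κ} {μ : Fin 4}
    {p : ℝ × E3} (hF : ∀ i ∈ s, DifferentiableAt ℝ (F i) p) :
    pd μ (fun q => ∏ i ∈ s, F i q) p = ∑ i ∈ s, (∏ j ∈ s.erase i, F j p) * pd μ (F i) p := by
  simp [pd, fderiv_finsetProd hF]

theorem pd_det [DecidableEq ι] {F : ℝ × E3 → Matrix ι ι ℝ} {μ : Fin 4} {p : ℝ × E3}
    (hF : ∀ i j, DifferentiableAt ℝ (fun q => F q i j) p) :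
    pd μ (fun q => (F q).det) p = ((F p).adjugate * pdM μ F p).trace := by
  have hcol (i : ι) (σ : Equiv.Perm ι) : ∏ j, ((F p).updateCol i fun j => pdM μ F p j i) (σ j) j =
      (∏ j ∈ Finset.univ.erase i, F p (σ j) j) * pd μ (fun q => F q (σ i) i) p := by
    rw [← Finset.prod_erase_mul _ _ (Finset.mem_univ i), Matrix.updateCol_self, pdM_apply]
    refine congrArg (· * _) (Finset.prod_congr rfl fun j hj => ?_)
    rw [Matrix.updateCol_ne (Finset.ne_of_mem_erase hj)]
  have hprod (σ : Equiv.Perm ι) : DifferentiableAt ℝ (fun q => ∏ i, F q (σ i) i) p :=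
    (HasFDerivAt.finsetProd fun i _ => (hF (σ i) i).hasFDerivAt).differentiableAt
  simp only [trace_adjugate_mul, Matrix.det_apply', hcol]
  rw [pd_sum fun σ _ => (hprod σ).const_mul _, Finset.sum_comm]
  refine Finset.sum_congr rfl fun σ _ => ?_
  rw [pd_mul (differentiableAt_const _) (hprod σ), pd_const, pd_prod fun i _ => hF _ _,
    Finset.mul_sum, zero_mul, zero_add]

theorem hasOneSidedDerivs_abs_mul {f : ℝ → ℝ} (hf : ContinuousAt f t) :
    HasOneSidedDerivs (fun s => |s - t| * f s) (f t) (-f t) t := by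
  have hderiv : HasDerivAt (fun s => (s - t) * f s) (f t) t := by
    refine hasDerivAt_iff_tendsto_slope.2 ((hf.tendsto.mono_left nhdsWithin_le_nhds).congr' ?_)
    filter_upwards [self_mem_nhdsWithin] with s hs
    have hne : s - t ≠ 0 := sub_ne_zero.2 hs
    simp [slope_def_field, hne]
  refine ⟨hderiv.hasDerivWithinAt.congr_of_mem (fun s hs => ?_) Set.self_mem_Ici,
    hderiv.fun_neg.hasDerivWithinAt.congr_of_mem (fun s hs => ?_) Set.self_mem_Iic⟩
  · rw [abs_of_nonneg (sub_nonneg.2 hs)]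
  · rw [abs_of_nonpos (sub_nonpos.2 hs), neg_mul]

theorem hasOneSidedDerivs_sqrt_trace_sq {X : ℝ → Matrix ι ι ℝ} {X' : Matrix ι ι ℝ}
    (hX : ∀ i j, HasDerivAt (fun s => X s i j) (X' i j) t) (h0 : X t = 0) :
    HasOneSidedDerivs (fun s => √(X s * X s).trace) √(X' * X').trace (-√(X' * X').trace) t := by
  let Y (s : ℝ) : Matrix ι ι ℝ := Matrix.of fun i j => dslope (fun r => X r i j) t s
  have hYt : Y t = X' := by
    ext i j
    exact (dslope_same _ _).trans (hX i j).deriv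
  have hXY (s : ℝ) : X s = (s - t) • Y s := by
    ext i j
    have hslope := sub_smul_dslope (fun r => X r i j) t s
    rw [h0, Matrix.zero_apply, sub_zero] at hslope
    exact hslope.symm
  have hsqrt (s : ℝ) : √(X s * X s).trace = |s - t| * √(Y s * Y s).trace := by
    rw [hXY s, Matrix.smul_mul, Matrix.mul_smul, smul_smul, Matrix.trace_smul, smul_eq_mul,
      Real.sqrt_mul (mul_self_nonneg _), Real.sqrt_mul_self_eq_abs]
  have hY : ContinuousAt Y t := continuousAt_pi.2 fun i => continuousAt_pi.2 fun j =>
    continuousAt_dslope_same.2 (hX i j).differentiableAt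
  have htrace : ContinuousAt (fun s => √(Y s * Y s).trace) t :=
    (Continuous.matrix_trace (continuous_id.matrix_mul continuous_id)).continuousAt.comp hY |>.sqrt
  simpa only [hsqrt, ← hYt] using hasOneSidedDerivs_abs_mul htrace

end MatrixCurves

section Expansion

variable {Ω : Set (ℝ × E3)} {N : ℝ × E3 → ℝ} {g : ℝ × E3 → Matrix (Fin 3) (Fin 3) ℝ}
  {p : ℝ × E3} {a : ℝ}

/-- The inequalities `h ≤ a H g ≤ 0` between quadratic forms at the point `p`. -/
def IsExpandingAt (N : ℝ × E3 → ℝ) (g : ℝ × E3 → Matrix (Fin 3) (Fin 3) ℝ) (a : ℝ)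
    (p : ℝ × E3) : Prop :=
  ∀ w, w ⬝ᵥ (secondForm N g p *ᵥ w) ≤ a * meanCurv N g p * (w ⬝ᵥ (g p *ᵥ w)) ∧
    a * meanCurv N g p * (w ⬝ᵥ (g p *ᵥ w)) ≤ 0

namespace FoliatedChart

variable (h : FoliatedChart Ω N g) (hp : p ∈ Ω)
include h hp

theorem trace_shapeOp : (shapeOp N g p).trace = meanCurv N g p := by
  simp only [shapeOp, meanCurv, Matrix.trace, Matrix.diag_apply, Matrix.mul_apply,
    (h.secondForm_symm hp).apply]

theorem smooth_secondForm : SmoothEntriesAt (secondForm N g) p := fun i j =>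
  (contDiffAt_const.div (contDiffAt_const.mul (h.lapse_smooth p hp))
    (mul_ne_zero two_ne_zero (h.lapse_ne_zero hp))).neg.mul
      (contDiffAt_pd (h.metric_smooth p hp i j))

theorem contDiffAt_meanCurv : ContDiffAt ℝ ∞ (meanCurv N g) p :=
  ContDiffAt.sum fun i _ => ContDiffAt.sum fun j _ =>
    ((h.metric_smooth p hp).inv (h.metric_det_ne_zero hp) i j).mul (h.smooth_secondForm hp i j)

theorem pd_det_metric :
    pd 0 (fun q => (g q).det) p = -(2 * N p * meanCurv N g p * (g p).det) := by
  have hadj : (g p).adjugate = (g p).det • (g p)⁻¹ := by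
    rw [Matrix.inv_def, smul_smul, Ring.mul_inverse_cancel _ (h.metric_isUnit_det hp), one_smul]
  rw [pd_det (h.metric_smooth p hp).differentiableAt, h.pdM_time_metric hp, hadj, Matrix.mul_neg,
    Matrix.mul_smul, Matrix.smul_mul, ← shapeOp, Matrix.trace_neg, Matrix.trace_smul,
    Matrix.trace_smul, h.trace_shapeOp hp, smul_eq_mul, smul_eq_mul]
  ring

theorem metric_mul_smul_one_sub_shapeOp :
    g p * (a • 1 - shapeOp N g p) = a • g p - secondForm N g p := by
  rw [Matrix.mul_sub, h.metric_mul_shapeOp hp, Matrix.mul_smul, Matrix.mul_one]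

theorem posSemidef_of_isExpandingAt (hexp : IsExpandingAt N g a p) :
    (g p * ((a * meanCurv N g p) • 1 - shapeOp N g p)).PosSemidef := by
  rw [h.metric_mul_smul_one_sub_shapeOp hp]
  refine .of_dotProduct_mulVec_nonneg
    (((h.metric_symm hp).smul _).sub (h.secondForm_symm hp)) fun w => ?_
  simpa [Matrix.sub_mulVec, Matrix.smul_mulVec] using (hexp w).1

theorem mul_meanCurv_nonpos (hexp : IsExpandingAt N g a p) : a * meanCurv N g p ≤ 0 :=
  nonpos_of_mul_nonpos_left (hexp (Pi.single 0 1)).2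
    (by simpa using (h.metric_pos p hp).diag_pos (i := 0))

theorem meanCurv_nonpos (hexp : IsExpandingAt N g a p) : meanCurv N g p ≤ 0 := by
  rw [← h.trace_shapeOp hp]
  linarith [trace_le_of_posSemidef (h.metric_pos p hp) (h.posSemidef_of_isExpandingAt hp hexp),
    h.mul_meanCurv_nonpos hp hexp]

theorem shapeOp_eq_zero_of_meanCurv_eq_zero (hexp : IsExpandingAt N g a p)
    (hH : meanCurv N g p = 0) : shapeOp N g p = 0 := by
  have hK := h.posSemidef_of_isExpandingAt hp hexp
  rw [hH, mul_zero] at hK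
  rw [eq_smul_one_of_trace_eq (h.metric_pos p hp) hK (by rw [h.trace_shapeOp hp, hH, mul_zero]),
    zero_smul]

theorem secondForm_eq_zero_iff (hexp : IsExpandingAt N g a p) :
    secondForm N g p = 0 ↔ meanCurv N g p = 0 := by
  refine ⟨fun hII => by simp [meanCurv, hII], fun hH => ?_⟩
  rw [← h.metric_mul_shapeOp hp, h.shapeOp_eq_zero_of_meanCurv_eq_zero hp hexp hH, Matrix.mul_zero]

end FoliatedChart

section TimeLine

variable {t : ℝ} {y : E3} (h : FoliatedChart Ω N g) (ht : (t, y) ∈ Ω)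
include h ht

theorem FoliatedChart.continuousAt_lapse_mul_meanCurv :
    ContinuousAt (fun s => N (s, y) * meanCurv N g (s, y)) t :=
  ((h.lapse_smooth _ ht).mul (h.contDiffAt_meanCurv ht)).continuousAt.comp
    (f := fun s => (s, y)) (by fun_prop)

theorem FoliatedChart.hasDerivAt_volume : HasDerivAt (fun s => √(g (s, y)).det)
    (-(N (t, y) * meanCurv N g (t, y)) * √(g (t, y)).det) t := by
  have hdet := (h.metric_pos _ ht).det_pos
  have hderiv := hasDerivAt_time ((h.metric_smooth _ ht).contDiffAt_det.differentiableAt (by simp))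
  refine (hderiv.sqrt hdet.ne').congr_deriv ?_
  have hsqrt := Real.sqrt_pos.2 hdet
  rw [h.pd_det_metric ht, ← Real.mul_self_sqrt hdet.le, Real.sqrt_mul_self hsqrt.le]
  field_simp

end TimeLine

end Expansion

section FluidTimeLine

open scoped Topology

/-- The squared norm `tr X²` of the electric part `X` of the Weyl tensor. -/
def weylElectricSq (N : ℝ × E3 → ℝ) (g : ℝ × E3 → Matrix (Fin 3) (Fin 3) ℝ) (p : ℝ × E3) : ℝ :=
  (weylElectricOp N g p * weylElectricOp N g p).trace

namespace FluidChart

variable {Ω : Set (ℝ × E3)} {N : ℝ × E3 → ℝ} {g : ℝ × E3 → Matrix (Fin 3) (Fin 3) ℝ}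
  {m k : ℝ × E3 → ℝ} {p : ℝ × E3} {a : ℝ}

variable (h : FluidChart Ω N g m k) (hp : p ∈ Ω)
include h hp

theorem metric_mul_weylElectricOp :
    g p * weylElectricOp N g p = electricPart (N p) (weyl (lorentz N g) p) :=
  Matrix.mul_nonsing_inv_cancel_left _ _ (h.metric_isUnit_det hp)

theorem isSymm_metric_mul_weylElectricOp : (g p * weylElectricOp N g p).IsSymm := by
  rw [h.metric_mul_weylElectricOp hp]
  exact electricPart_isSymm (h.hasRiemannSymmetries_weyl hp) _

theorem weylElectricSq_nonneg : 0 ≤ weylElectricSq N g p :=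
  trace_mul_self_nonneg (h.metric_pos p hp) (h.isSymm_metric_mul_weylElectricOp hp)

theorem weylElectricSq_eq_zero_iff : weylElectricSq N g p = 0 ↔ weylElectricOp N g p = 0 :=
  trace_mul_self_eq_zero_iff (h.metric_pos p hp) (h.isSymm_metric_mul_weylElectricOp hp)

theorem weylElectricSq_eq_zero_iff_electricPart :
    weylElectricSq N g p = 0 ↔ electricPart (N p) (weyl (lorentz N g) p) = 0 := by
  rw [h.weylElectricSq_eq_zero_iff hp, ← h.metric_mul_weylElectricOp hp,
    ((Matrix.isUnit_iff_isUnit_det _).2 (h.metric_isUnit_det hp)).mul_right_eq_zero]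

theorem tensorNorm_weyl : tensorNorm (riemannian N g p) (weyl (lorentz N g) p) =
    √(8 * weylElectricSq N g p) := by
  rw [riemannian, tensorNorm_of_isPurelyElectric (h.hasRiemannSymmetries_weyl hp)
    (h.electric p hp) (h.lapse_ne_zero hp) (h.metric_pos p hp), h.spatialRicci_weyl hp,
    ← weylElectricOp, h.trace_weylElectricOp hp, ← weylElectricSq]
  ring_nf

theorem tensorNorm_riemann : tensorNorm (riemannian N g p) (riemann (lorentz N g) p) =
    √(8 * weylElectricSq N g p + ricciCoeff (k p) * m p ^ 2 / 3) := by
  rw [riemannian, tensorNorm_of_isPurelyElectric (h.hasRiemannSymmetries_riemann hp)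
    (h.isPurelyElectric_riemann hp) (h.lapse_ne_zero hp) (h.metric_pos p hp), ← tidalOp,
    ← spatialRicciOp, h.tidalOp_eq hp, h.spatialRicciOp_eq hp, weylElectricSq, ricciCoeff]
  congr 1
  simp only [Matrix.add_mul, Matrix.mul_add, Matrix.smul_mul, Matrix.mul_smul, Matrix.one_mul,
    Matrix.mul_one, Matrix.trace_add, Matrix.trace_smul, Matrix.trace_one, smul_eq_mul,
    Fintype.card_fin, h.trace_weylElectricOp hp]
  push_cast
  ring

theorem weyl_eq_zero_iff : weyl (lorentz N g) p = 0 ↔ weylElectricSq N g p = 0 := by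
  rw [eq_zero_iff_of_isPurelyElectric (h.hasRiemannSymmetries_weyl hp) (h.electric p hp)
    (h.lapse_ne_zero hp) (h.metric_pos p hp), h.spatialRicci_weyl hp, and_self,
    h.weylElectricSq_eq_zero_iff_electricPart hp]

theorem riemann_eq_zero_iff :
    riemann (lorentz N g) p = 0 ↔ weylElectricSq N g p = 0 ∧ m p = 0 := by
  rw [eq_zero_iff_of_isPurelyElectric (h.hasRiemannSymmetries_riemann hp)
    (h.isPurelyElectric_riemann hp) (h.lapse_ne_zero hp) (h.metric_pos p hp),
    h.weylElectricSq_eq_zero_iff_electricPart hp]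
  constructor
  · rintro ⟨helectric, hricci⟩
    have hm : m p = 0 := by
      rw [h.density_eq hp, spatialRicciOp, hricci, Matrix.mul_zero, Matrix.trace_zero, mul_zero]
    rw [h.electricPart_riemann hp, hm, mul_zero, zero_smul, add_zero] at helectric
    exact ⟨helectric, hm⟩
  · rintro ⟨helectric, hm⟩
    rw [h.electricPart_riemann hp, h.spatialRicci_riemann hp, helectric, hm]
    simp

theorem entropyDensity_eq :
    entropyDensity N g p = weylRatio (k p) (m p) (weylElectricSq N g p) := by
  have hflat_iff := h.riemann_eq_zero_iff hp
  rw [entropyDensity, h.tensorNorm_weyl hp, h.tensorNorm_riemann hp]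
  rcases eq_or_ne (m p) 0 with hm | hm
  · rw [hm, weylRatio_zero_density]
    split_ifs with hflat
    · rfl
    · have hv : 0 < weylElectricSq N g p :=
        (h.weylElectricSq_nonneg hp).lt_of_ne' fun hv => hflat (hflat_iff.2 ⟨hv, hm⟩)
      rw [zero_pow two_ne_zero, mul_zero, zero_div, add_zero]
      exact div_self (by positivity)
  · rw [if_neg fun hflat => hm (hflat_iff.1 hflat).2, weylRatio_of_ne_zero hm]

theorem smooth_weylElectricOp : SmoothEntriesAt (weylElectricOp N g) p := by
  intro i j
  have hsmooth : ContDiffAt ℝ ∞ (fun q => spatialRicciOp N g q i j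
      - 2 / 3 * m q * (1 : Matrix (Fin 3) (Fin 3) ℝ) i j) p :=
    (h.smooth_spatialRicciOp hp i j).sub
      ((contDiffAt_const.mul (h.contDiffAt_density hp)).mul contDiffAt_const)
  refine hsmooth.congr_of_eventuallyEq ((h.eventually_mem hp).mono fun q hq => ?_)
  simp [h.spatialRicciOp_eq hq]

theorem differentiableAt_weylElectricSq : DifferentiableAt ℝ (weylElectricSq N g) p := by
  have hX := h.smooth_weylElectricOp hp
  unfold weylElectricSq
  exact DifferentiableAt.fun_sum fun i _ => (hX.mul hX).differentiableAt i i

theorem pd_weylElectricSq : pd 0 (weylElectricSq N g) p =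
    N p * (4 * meanCurv N g p * weylElectricSq N g p
      - 6 * (shapeOp N g p * (weylElectricOp N g p * weylElectricOp N g p)).trace
      + k p * m p * (shapeOp N g p * weylElectricOp N g p).trace) := by
  have hX := h.smooth_weylElectricOp hp
  unfold weylElectricSq
  rw [pd_trace (hX.mul hX).differentiableAt, pdM_mul hX.differentiableAt hX.differentiableAt,
    h.pdM_weylElectricOp hp, ← h.trace_shapeOp hp]
  have hX0 := h.trace_weylElectricOp hp
  set K := shapeOp N g p
  set X := weylElectricOp N g p
  have hXXK : (X * (X * K)).trace = (K * (X * X)).trace := by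
    rw [← Matrix.mul_assoc, Matrix.trace_mul_comm]
  have hXKX : (X * (K * X)).trace = (K * (X * X)).trace := by
    rw [Matrix.trace_mul_comm, Matrix.mul_assoc]
  rw [Matrix.trace_add, Matrix.trace_mul_comm _ X, ← two_mul]
  simp only [tracelessPart, Matrix.mul_smul, Matrix.mul_add, Matrix.mul_sub, Matrix.mul_one,
    Matrix.trace_smul, Matrix.trace_add, Matrix.trace_sub, smul_eq_mul, hXXK, hXKX, hX0,
    Matrix.trace_mul_comm X K]
  ring

end FluidChart

section TimeLine

variable {Ω : Set (ℝ × E3)} {N : ℝ × E3 → ℝ} {g : ℝ × E3 → Matrix (Fin 3) (Fin 3) ℝ}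
  {m k : ℝ × E3 → ℝ} (h : FluidChart Ω N g m k) {y : E3} {t : ℝ} (ht : (t, y) ∈ Ω)
include h ht

theorem FluidChart.hasDerivAt_density : HasDerivAt (fun s => m (s, y))
    (N (t, y) * (k (t, y) * m (t, y) * meanCurv N g (t, y))) t := by
  rw [← h.trace_shapeOp ht, ← h.pd_density ht]
  exact hasDerivAt_time ((h.contDiffAt_density ht).differentiableAt (by simp))

theorem FluidChart.hasDerivAt_weylElectricSq : HasDerivAt (fun s => weylElectricSq N g (s, y))
    (N (t, y) * (4 * meanCurv N g (t, y) * weylElectricSq N g (t, y)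
      - 6 * (shapeOp N g (t, y) * (weylElectricOp N g (t, y) * weylElectricOp N g (t, y))).trace
      + k (t, y) * m (t, y) * (shapeOp N g (t, y) * weylElectricOp N g (t, y)).trace)) t := by
  rw [← h.pd_weylElectricSq ht]
  exact hasDerivAt_time (h.differentiableAt_weylElectricSq ht)

theorem FluidChart.exists_weylElectricSq_kink {a : ℝ} (hexp : IsExpandingAt N g a (t, y))
    (hv : weylElectricSq N g (t, y) = 0) : ∃ w, 0 ≤ w ∧
      w ^ 2 ≤ (N (t, y) * k (t, y) * m (t, y) / 2) ^ 2
        * (2 / 3 * ((1 - 3 * a) * meanCurv N g (t, y)) ^ 2) ∧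
      HasOneSidedDerivs (fun s => √(weylElectricSq N g (s, y))) w (-w) t := by
  have hX0 := (h.weylElectricSq_eq_zero_iff ht).1 hv
  have hg := h.metric_pos _ ht
  have hK := h.posSemidef_of_isExpandingAt ht hexp
  have hX' : pdM 0 (weylElectricOp N g) (t, y) =
      (N (t, y) * k (t, y) * m (t, y) / 2) • tracelessPart (shapeOp N g (t, y)) := by
    rw [h.pdM_weylElectricOp ht, hX0]
    simp only [Matrix.mul_zero, Matrix.zero_mul, Matrix.trace_zero, zero_smul, smul_zero,
      sub_zero, add_zero, zero_add, smul_smul]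
    ring_nf
  have hkink := hasOneSidedDerivs_sqrt_trace_sq (X' := pdM 0 (weylElectricOp N g) (t, y))
    (fun i j => hasDerivAt_time ((h.smooth_weylElectricOp ht).differentiableAt i j)) hX0
  refine ⟨_, Real.sqrt_nonneg _, ?_, hkink⟩
  have hnonneg := trace_mul_self_nonneg hg (isSymm_mul_tracelessPart hg hK)
  have hle := trace_tracelessPart_sq_le hg hK
  rw [h.trace_shapeOp ht] at hle
  rw [hX', Matrix.smul_mul, Matrix.mul_smul, smul_smul, Matrix.trace_smul, smul_eq_mul, ← sq,
    Real.sq_sqrt (mul_nonneg (sq_nonneg _) hnonneg)]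
  refine mul_le_mul_of_nonneg_left (hle.trans_eq ?_) (sq_nonneg _)
  ring

omit ht in
theorem FluidChart.entropyLine {J : Set ℝ} {α κ β : ℝ → ℝ} (hJ : IsOpen J)
    (hΩ : ∀ t ∈ J, (t, y) ∈ Ω) (hexp : ∀ t ∈ J, IsExpandingAt N g (α t) (t, y))
    (hparam : ParameterLine J (fun t => N (t, y)) (fun t => k (t, y)) α κ β
      (fun t => meanCurv N g (t, y))) :
    EntropyLine J (fun t => N (t, y)) (fun t => m (t, y)) (fun t => k (t, y)) α κ β
      (fun t => meanCurv N g (t, y)) (fun t => weylElectricSq N g (t, y))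
      (fun t => (shapeOp N g (t, y) * weylElectricOp N g (t, y)).trace)
      (fun t => (shapeOp N g (t, y)
        * (weylElectricOp N g (t, y) * weylElectricOp N g (t, y))).trace)
      (fun t => √(g (t, y)).det)
      (fun t => (entropyDensity N g (t, y) + sCrit (k (t, y)) (α t)) * √(g (t, y)).det) where
  toParameterLine := hparam
  isOpen := hJ
  lapse_pos t ht := h.lapse_pos _ (hΩ t ht)
  volume_pos t ht := Real.sqrt_pos.2 (h.metric_pos _ (hΩ t ht)).det_pos
  meanCurv_nonpos t ht := h.meanCurv_nonpos (hΩ t ht) (hexp t ht)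
  continuousAt_lapse_mul_meanCurv t ht := h.continuousAt_lapse_mul_meanCurv (hΩ t ht)
  v_nonneg t ht := h.weylElectricSq_nonneg (hΩ t ht)
  τ₁_sq_le t ht := by
    refine (sq_trace_mul_le_of_trace_eq_zero (h.metric_pos _ (hΩ t ht))
      (h.posSemidef_of_isExpandingAt (hΩ t ht) (hexp t ht))
      (h.isSymm_metric_mul_weylElectricOp (hΩ t ht))
      (h.trace_weylElectricOp (hΩ t ht))).trans_eq ?_
    rw [h.trace_shapeOp (hΩ t ht), weylElectricSq]
    ring
  τ₂_le t ht := trace_mul_mul_self_le (h.metric_pos _ (hΩ t ht))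
    (h.posSemidef_of_isExpandingAt (hΩ t ht) (hexp t ht))
    (h.isSymm_metric_mul_weylElectricOp (hΩ t ht))
  τ₂_eq_zero t ht hH := by
    rw [h.shapeOp_eq_zero_of_meanCurv_eq_zero (hΩ t ht) (hexp t ht) hH, Matrix.zero_mul,
      Matrix.trace_zero]
  hasDerivAt_volume t ht := h.hasDerivAt_volume (hΩ t ht)
  hasDerivAt_density t ht := h.hasDerivAt_density (hΩ t ht)
  hasDerivAt_v t ht := h.hasDerivAt_weylElectricSq (hΩ t ht)
  sqrt_v_kink t ht := h.exists_weylElectricSq_kink (hΩ t ht) (hexp t ht)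
  entropy_eq t ht := by rw [h.entropyDensity_eq (hΩ t ht)]

end TimeLine

end FluidTimeLine

section Manifold

variable {M : Type*} {N u : ℝ → M → ℝ} {t : ℝ} {x : M}

theorem DT_eq_zero_iff (hN : N t x ≠ 0) : DT N u t x = 0 ↔ deriv (fun s => u s x) t = 0 := by
  rw [DT, mul_eq_zero, or_iff_right (inv_ne_zero hN)]

variable [TopologicalSpace M]
  {m k α : ℝ → M → ℝ} {J : Set ℝ} {U : Set M} {φ : OpenPartialHomeomorph M E3} {q : ℝ × E3}

/-- The region `J × U` in the coordinates `(t, φ)`. -/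
def chartRegion (J : Set ℝ) (U : Set M) (φ : OpenPartialHomeomorph M E3) : Set (ℝ × E3) :=
  J ×ˢ (φ.target ∩ φ.symm ⁻¹' U)

theorem mem_chartRegion (ht : t ∈ J) (hx : x ∈ φ.source ∩ U) : (t, φ x) ∈ chartRegion J U φ :=
  ⟨ht, φ.map_source hx.1, by rw [Set.mem_preimage, φ.left_inv hx.1]; exact hx.2⟩

theorem inChart_apply (f : ℝ → M → ℝ) (t : ℝ) (hx : x ∈ φ.source) :
    inChart φ f (t, φ x) = f t x := by
  rw [inChart, φ.left_inv hx]

variable [ChartedSpace E3 M]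
  {g : ℝ → (x : M) → TangentSpace (𝓡 3) x →L[ℝ] TangentSpace (𝓡 3) x →L[ℝ] ℝ}

theorem hasDerivAt_of_rate (hN : N t x ≠ 0) (hu : DifferentiableAt ℝ (fun s => u s x) t)
    (hstat : meanCurvAt N g φ t x = 0 → DT N u t x = 0) :
    HasDerivAt (fun s => u s x) (N t x * (rate N g u φ t x * meanCurvAt N g φ t x)) t := by
  rw [rate, div_mul_cancel_of_imp hstat, DT, mul_inv_cancel_left₀ hN]
  exact hu.hasDerivAt

theorem dotProduct_metricInChart_mulVec (w : Fin 3 → ℝ) :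
    w ⬝ᵥ (metricInChart φ g q *ᵥ w) = g q.1 (φ.symm q.2)
      (mfderiv (𝓡 3) (𝓡 3) φ.symm q.2 (WithLp.toLp 2 w : E3))
      (mfderiv (𝓡 3) (𝓡 3) φ.symm q.2 (WithLp.toLp 2 w : E3)) := by
  set A := mfderiv (𝓡 3) (𝓡 3) φ.symm q.2
  have hbasis : (WithLp.toLp 2 w : E3) =
      ∑ i, w i • (EuclideanSpace.single i (1 : ℝ) : E3) := by
    ext j
    simp [Pi.single_apply]
  have hmap : A (WithLp.toLp 2 w : E3) =
      ∑ i, w i • A (EuclideanSpace.single i (1 : ℝ) : E3) := by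
    rw [hbasis]
    exact (map_sum A _ _).trans (Finset.sum_congr rfl fun i _ => map_smul A _ _)
  rw [hmap]
  simp only [map_sum, map_smul, dotProduct, Matrix.mulVec, metricInChart, Matrix.of_apply,
    sum_apply, smul_apply, smul_eq_mul, Finset.mul_sum]
  rw [Finset.sum_comm]
  exact Finset.sum_congr rfl fun i _ => Finset.sum_congr rfl fun j _ =>
    (mul_assoc _ _ _).symm.trans (mul_comm _ _)

theorem IsFoliatedSpacetime.isOpen_chartRegion (hg : IsFoliatedSpacetime N g J U) :
    IsOpen (chartRegion J U φ) :=
  hg.isOpen_time.prod (φ.symm.isOpen_inter_preimage hg.isOpen_space)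

theorem parameterLine (h : IsPerfectFluidElectricRegion N g m k J U)
    (hexp : IsExpandingRegion N g α J U) (hpar : EvolutionInequalities N g k α J U)
    (hφ : IsChart φ) (hx : x ∈ φ.source ∩ U) :
    ParameterLine J (fun t => N t x) (fun t => k t x) (fun t => α t x)
      (fun t => rate N g k φ t x) (fun t => rate N g α φ t x)
      (fun t => meanCurvAt N g φ t x) where
  k_mem t ht := h.k_mem t ht x hx.2
  α_mem t ht := hexp.α_mem t ht x hx.2
  α_contDiffAt t ht := (hpar.α_diff x hx.2).contDiffAt (h.isOpen_time.mem_nhds ht)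
  k_rate_nonneg t ht := hpar.k_rate φ hφ t ht x hx
  α_rate_nonneg t ht := hpar.α_rate φ hφ t ht x hx
  k_rate_le t ht := by
    refine (hpar.k_rate_le φ hφ t ht x hx).trans (mul_le_of_le_one_right
      (mul_nonneg (h.k_mem t ht x hx.2).1 (ricciCoeff_pos _).le) ?_)
    split_ifs
    · exact le_rfl
    · exact min_le_right _ _
  k_rate_mul_le t ht := by
    have hcoeff : 0 ≤ k t x * ricciCoeff (k t x) :=
      mul_nonneg (h.k_mem t ht x hx.2).1 (ricciCoeff_pos _).le
    have hβ : 0 ≤ 9 * rate N g α φ t x := mul_nonneg (by norm_num) (hpar.α_rate φ hφ t ht x hx)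
    rcases (hexp.α_mem t ht x hx.2).2.eq_or_lt with hα | hα
    · rw [hα]
      simpa using mul_nonneg hcoeff hβ
    · have hden : 0 < 4 * (1 - 3 * α t x) := by linarith
      have hle := hpar.k_rate_le φ hφ t ht x hx
      rw [if_neg hα.ne] at hle
      rw [← le_div_iff₀ hden, mul_div_assoc]
      exact hle.trans (mul_le_mul_of_nonneg_left (min_le_left _ _) hcoeff)
  hasDerivAt_k t ht := hasDerivAt_of_rate (h.lapse_pos t ht x hx.2).ne'
    ((hpar.k_diff x hx.2).differentiableAt (h.isOpen_time.mem_nhds ht))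
    fun hH => (hpar.stationary φ hφ t ht x hx hH).1
  hasDerivAt_α t ht := hasDerivAt_of_rate (h.lapse_pos t ht x hx.2).ne'
    (((hpar.α_diff x hx.2).contDiffAt (h.isOpen_time.mem_nhds ht)).differentiableAt (by simp))
    fun hH => (hpar.stationary φ hφ t ht x hx hH).2

theorem IsChart.mfderiv_symm_injective [IsManifold (𝓡 3) ∞ M] (hφ : IsChart φ) {y : E3}
    (hy : y ∈ φ.target) : Function.Injective (mfderiv (𝓡 3) (𝓡 3) φ.symm y) :=
  have hdiff : φ.MDifferentiable (𝓡 3) (𝓡 3) :=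
    ⟨(contMDiffOn_of_mem_maximalAtlas hφ).mdifferentiableOn (by simp),
      (contMDiffOn_symm_of_mem_maximalAtlas hφ).mdifferentiableOn (by simp)⟩
  hdiff.symm.mfderiv_injective hy

variable [IsManifold (𝓡 3) ∞ M]

theorem IsFoliatedSpacetime.metricInChart_posDef (hg : IsFoliatedSpacetime N g J U)
    (hφ : IsChart φ) (hq : q ∈ chartRegion J U φ) : (metricInChart φ g q).PosDef := by
  obtain ⟨ht, hy, hU⟩ := hq
  refine .of_dotProduct_mulVec_pos ?_ fun w hw => ?_
  · ext i j
    exact hg.metric_symm _ ht _ hU _ _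
  · rw [star_trivial, dotProduct_metricInChart_mulVec]
    refine hg.metric_pos _ ht _ hU _ fun hzero => hw ?_
    have hw0 := IsChart.mfderiv_symm_injective hφ hy (hzero.trans (map_zero _).symm)
    exact (WithLp.toLp_eq_zero 2).1 hw0

theorem IsPerfectFluidElectricRegion.fluidChart (h : IsPerfectFluidElectricRegion N g m k J U)
    (hφ : IsChart φ) : FluidChart (chartRegion J U φ) (inChart φ N) (metricInChart φ g)
      (inChart φ m) (inChart φ k) where
  isOpen := h.isOpen_chartRegion
  lapse_smooth q hq := (h.lapse_smooth φ hφ).contDiffAt (h.isOpen_chartRegion.mem_nhds hq)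
  metric_smooth q hq i j :=
    (h.metric_smooth φ hφ i j).contDiffAt (h.isOpen_chartRegion.mem_nhds hq)
  lapse_pos q hq := h.lapse_pos _ hq.1 _ hq.2.2
  metric_pos q hq := h.metricInChart_posDef hφ hq
  einstein_eq q hq a b := by
    have heinstein :=
      h.einstein_eq φ hφ q.1 hq.1 (φ.symm q.2) ⟨φ.map_target hq.2.1, hq.2.2⟩ a b
    rw [einsteinAt, φ.right_inv hq.2.1] at heinstein
    exact heinstein
  electric q hq i j l := by
    simpa only [weylAt, φ.right_inv hq.2.1] using
      h.electric φ hφ q.1 hq.1 (φ.symm q.2) ⟨φ.map_target hq.2.1, hq.2.2⟩ i j l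

section Point

variable (h : IsPerfectFluidElectricRegion N g m k J U) (hφ : IsChart φ)
  (hx : x ∈ φ.source ∩ U)
include h hφ hx

theorem weylAt_eq_zero_iff (ht : t ∈ J) :
    weylAt N g φ t x = 0 ↔ weylElectricSq (inChart φ N) (metricInChart φ g) (t, φ x) = 0 :=
  (h.fluidChart hφ).weyl_eq_zero_iff (mem_chartRegion ht hx)

theorem riemannAt_eq_zero_iff (ht : t ∈ J) : riemannAt N g φ t x = 0 ↔
    weylElectricSq (inChart φ N) (metricInChart φ g) (t, φ x) = 0 ∧ m t x = 0 := by
  rw [← inChart_apply m t hx.1]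
  exact (h.fluidChart hφ).riemann_eq_zero_iff (mem_chartRegion ht hx)

theorem secondFormAt_eq_zero_iff (hexp : IsExpandingRegion N g α J U) (ht : t ∈ J) :
    secondFormAt N g φ t x = 0 ↔ meanCurvAt N g φ t x = 0 :=
  (h.fluidChart hφ).toFoliatedChart.secondForm_eq_zero_iff (mem_chartRegion ht hx)
    (hexp.expanding φ hφ t ht x hx)

theorem exists_entropyLine (hexp : IsExpandingRegion N g α J U)
    (hpar : EvolutionInequalities N g k α J U) : ∃ τ₁ τ₂ D,
    EntropyLine J (fun t => N t x) (fun t => m t x) (fun t => k t x) (fun t => α t x)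
      (fun t => rate N g k φ t x) (fun t => rate N g α φ t x) (fun t => meanCurvAt N g φ t x)
      (fun t => weylElectricSq (inChart φ N) (metricInChart φ g) (t, φ x)) τ₁ τ₂ D
      (fun t => entropyPF N g k α φ t x) := by
  have hparam := parameterLine h hexp hpar hφ hx
  simp only [← inChart_apply N _ hx.1, ← inChart_apply k _ hx.1] at hparam
  have hline := (h.fluidChart hφ).entropyLine h.isOpen_time (fun t ht => mem_chartRegion ht hx)
    (fun t ht => hexp.expanding φ hφ t ht x hx) hparam
  simp only [inChart_apply _ _ hx.1] at hline
  exact ⟨_, _, _, hline⟩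

end Point

end Manifold

end WeylEntropy

end

theorem theorem6p3
    {M : Type*} [TopologicalSpace M] [ChartedSpace WeylEntropy.E3 M] [IsManifold (𝓡 3) ∞ M]
    (N : ℝ → M → ℝ)
    (g : ℝ → (x : M) → TangentSpace (𝓡 3) x →L[ℝ] TangentSpace (𝓡 3) x →L[ℝ] ℝ)
    (m k α : ℝ → M → ℝ) (J : Set ℝ) (U : Set M)
    (hfluid : WeylEntropy.IsPerfectFluidElectricRegion N g m k J U)
    (hexp : WeylEntropy.IsExpandingRegion N g α J U)
    (hpar : WeylEntropy.EvolutionInequalities N g k α J U)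
    (φ : OpenPartialHomeomorph M WeylEntropy.E3) (hφ : WeylEntropy.IsChart φ)
    (x : M) (hx : x ∈ φ.source ∩ U) :
    -- monotonicity in time
    (∀ I : Set ℝ, I ⊆ J → I.OrdConnected →
      MonotoneOn (fun s => WeylEntropy.entropyPF N g k α φ s x) I) ∧
    ∀ t ∈ J,
      -- the one-sided derivatives `D_T S^pf` exist and are nonnegative
      (∃ a b : ℝ,
        HasDerivWithinAt (fun s => WeylEntropy.entropyPF N g k α φ s x) a (Set.Ici t) t ∧
        HasDerivWithinAt (fun s => WeylEntropy.entropyPF N g k α φ s x) b (Set.Iic t) t ∧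
        0 ≤ (N t x)⁻¹ * a ∧ 0 ≤ (N t x)⁻¹ * b) ∧
      -- the derivative `D_T S^pf` exists except possibly where the Weyl tensor vanishes and the
      -- Riemann tensor does not, and it is nonnegative wherever it exists
      (WeylEntropy.weylAt N g φ t x ≠ 0 ∨ WeylEntropy.riemannAt N g φ t x = 0 →
        DifferentiableAt ℝ (fun s => WeylEntropy.entropyPF N g k α φ s x) t) ∧
      (DifferentiableAt ℝ (fun s => WeylEntropy.entropyPF N g k α φ s x) t →
        0 ≤ WeylEntropy.DT N (WeylEntropy.entropyPF N g k α φ) t x) ∧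
      -- the equality case
      DifferentiableAt ℝ (fun s => WeylEntropy.sCrit (k s x) (α s x)) t ∧
      ((DifferentiableAt ℝ (fun s => WeylEntropy.entropyPF N g k α φ s x) t ∧
          WeylEntropy.DT N (WeylEntropy.entropyPF N g k α φ) t x = 0) ↔
        (WeylEntropy.DT N (fun s y => WeylEntropy.sCrit (k s y) (α s y)) t x = 0 ∧
          (WeylEntropy.secondFormAt N g φ t x = 0 ∨
            (WeylEntropy.weylAt N g φ t x = 0 ∧ WeylEntropy.riemannAt N g φ t x ≠ 0 ∧
              α t x = 1 / 3 ∧ WeylEntropy.sCrit (k t x) (α t x) = 0)))) := by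
  open WeylEntropy in
  obtain ⟨τ₁, τ₂, D, hline⟩ := exists_entropyLine hfluid hφ hx hexp hpar
  refine ⟨fun I hI hconn => monotoneOn_of_one_sided_derivs hconn fun t ht => ?_, fun t ht => ?_⟩
  · obtain ⟨a, b, hderivs, ha, -⟩ := hline.exists_hasOneSidedDerivs (hI ht)
    exact ⟨a, b, hderivs, ha⟩
  have hN := hfluid.lapse_pos t ht x hx.2
  obtain ⟨a, b, hderivs, ha, hb⟩ := hline.exists_hasOneSidedDerivs ht
  obtain ⟨c, -, hcrit⟩ := hline.exists_hasDerivAt_sCrit ht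
  have hweyl := weylAt_eq_zero_iff hfluid hφ hx ht
  have hriemann := riemannAt_eq_zero_iff hfluid hφ hx ht
  refine ⟨⟨a, b, hderivs.1, hderivs.2, mul_nonneg (inv_nonneg.2 hN.le) ha,
    mul_nonneg (inv_nonneg.2 hN.le) hb⟩, fun hreg => hline.differentiableAt_of_regular ht ?_,
    fun hdiff => mul_nonneg (inv_nonneg.2 hN.le) (hderivs.right_eq_deriv hdiff ▸ ha),
    hcrit.differentiableAt, ?_⟩
  · tauto
  · rw [DT_eq_zero_iff hN.ne', DT_eq_zero_iff hN.ne', hline.deriv_eq_zero_iff ht,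
      secondFormAt_eq_zero_iff hfluid hφ hx hexp ht,
      sCrit_eq_zero_iff (hfluid.k_mem t ht x hx.2).1 (hexp.α_mem t ht x hx.2).2]
    tauto
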